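/- **Setting.** All graphs are finite and simple. For a graph $H$ and a set $T\subseteq V(H)$ let $c_H(T)$ be the number of connected components of $H$ after removing the vertices of $T$; $T$ is a *cutset* of $H$ if $c_H(T\setminus\{i\})<c_H(T)$ for every $i\in T$, and $v$ is a *cutpoint* of $H$ if $\{v\}$ is a cutset. A *block* of $H$ is a connected subgraph without cutpoints of its own that is maximal with this property; $H$ is a *block graph* if all its blocks are complete graphs; an *endblock* of $H$ is a block containing exactly one cutpoint of $H$. The clique degree $\mathrm{cdeg}_H(v)$ is the number of maximal cliques of $H$ containing $v$, and $v$ is *free* in $H$ if $\mathrm{cdeg}_H(v)=1$. A graph $H$ is *decomposable* if $H=H_1\cup H_2$ with proper subgraphs $H_1,H_2\subsetneq H$ such that $V(H_1)\cap V(H_2)=\{v\}$ with $v$ free in $H_1$ and in $H_2$; recursively decomposing each connected component of $H$ one obtains the *indecomposable (connected) subgraphs* of $H$. Let $G$ be a graph on $[n]$, $K$ a field, $S=K[x_1,\dots,x_n,y_1,\dots,y_n]$, and let $J_G=(x_iy_j-x_jy_i : i<j,\ \{i,j\}\in E(G))$ be its binomial edge ideal. For $T\subseteq[n]$ let $P_T(G)\subseteq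 S$ be the ideal generated by $x_i,y_i$ for $i\in T$ and by all $x_iy_j-x_jy_i$ with $i<j$ lying in the same connected component of $G$ after removing $T$. **Algorithm.** Input: a connected block graph $G$ on $[n]$. 1. $\dim:=n+1$; 2. $\mathcal G:=\{G\}$; 3. for every graph $H\in\mathcal G$ (until $\mathcal G$ is empty): 4. $\quad\mathcal G:=\mathcal G\setminus\{H\}$; 5. $\quad$ decompose $H$ into its indecomposable subgraphs $\mathcal I=\{G_1,\dots,G_r\}$; 6. $\quad$ remove from $\mathcal I$ the graphs which are blocks (i.e. have no cutpoint); 7. $\quad$ for every graph $G_i\in\mathcal I$: 8. $\qquad$ take a vertex $v\in V(G_i)$ belonging to at least two endblocks of $G_i$; 9. $\qquad\dim:=\dim+\mathrm{cdeg}_{G_i}(v)-2$; 10. $\qquad\mathcal G:=\mathcal G\cup\{H_v\}$, where $H_v$ is obtained from $G_i$ by removing $v$ and the endblocks of $G_i$ to which $v$ belongs. Output: $\dim$. **Theorem.** (a) For every field $K$, every $n$ and every connected block graph $G$ on $[n]$, the algorithm is correct, whatever choices are made in lines 3, 7 and 8: it terminates after finitely many steps, it never gets stuck (a vertex $v$ as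 in line 8 always exists), and its output is the Krull dimension $\dim S/J_G$. Moreover the set $T$ of all vertices taken in line 8 is a cutset of $G$, and $P_T(G)$ is a minimal prime ideal of $J_G$ of minimum height among the minimal primes of $J_G$. (b) The algorithm can be implemented in linear time: there are a program for a unit-cost random access machine (registers and arrays of natural numbers, whose only arithmetic operations are $\pm1$ and comparison) and a constant $C$ such that for every $n$ and every connected block graph $G$ on $[n]$, given by adjacency lists in arbitrary order, the program halts after at most $C\,(|V(G)|+|E(G)|)$ steps and returns the output $\dim$ and the set $T$ of vertices taken in line 8 of some complete run of the algorithm on $G$. -/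

import Mathlib

namespace BEI

universe u

/-! ### Cutsets, blocks, cliques

All graphs that occur are subgraphs of a fixed ambient graph `G`; the notions below are stated for
an arbitrary subgraph `H` of `G` (for `G` itself take `H = ⊤`). -/

section Graphs

variable {V : Type u} {G : SimpleGraph V}

/-- The number `c(T)` of connected components of `H` after removing the vertices in `T`. -/
noncomputable def numComp (H : G.Subgraph) (T : Set V) : ℕ :=
  Nat.card (H.deleteVerts T).coe.ConnectedComponent

/-- `T` is a cutset of `H`: a set of vertices with `c(T \ {i}) < c(T)` for each `i ∈ T`. -/
def IsCutset (H : G.Subgraph) (T : Set V) : Prop :=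
  T ⊆ H.verts ∧ ∀ i ∈ T, numComp H (T \ {i}) < numComp H T

/-- A cutpoint is a vertex that is a cutset by itself. -/
def IsCutpoint (H : G.Subgraph) (v : V) : Prop :=
  IsCutset H {v}

/-- A block of `H`: a connected subgraph without cutpoints (of its own), maximal with this
property. -/
def IsBlock (H B : G.Subgraph) : Prop :=
  Maximal (fun B' : G.Subgraph => B' ≤ H ∧ B'.Connected ∧ ∀ v, ¬ IsCutpoint B' v) B

/-- `H` is a block graph: all its blocks are complete graphs. -/
def IsBlockGraph (H : G.Subgraph) : Prop :=
  ∀ B, IsBlock H B → ∀ u ∈ B.verts, ∀ v ∈ B.verts, u ≠ v → B.Adj u v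

/-- An endblock of `H`: a block containing exactly one cutpoint of `H`. -/
def IsEndblock (H B : G.Subgraph) : Prop :=
  IsBlock H B ∧ ∃! v, v ∈ B.verts ∧ IsCutpoint H v

/-- The set of endblocks of `H` containing `v`. -/
def endblocksAt (H : G.Subgraph) (v : V) : Set G.Subgraph :=
  {B | IsEndblock H B ∧ v ∈ B.verts}

/-- A clique of `H`. -/
def IsCliqueOf (H : G.Subgraph) (C : Set V) : Prop :=
  C ⊆ H.verts ∧ ∀ i ∈ C, ∀ j ∈ C, i ≠ j → H.Adj i j

/-- The clique degree of `v` in `H`: the number of maximal cliques of `H` containing `v`. -/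
noncomputable def cdeg (H : G.Subgraph) (v : V) : ℕ :=
  {C : Set V | Maximal (IsCliqueOf H) C ∧ v ∈ C}.ncard

/-- A free vertex of `H`: a vertex of clique degree one. -/
def IsFreeVertex (H : G.Subgraph) (v : V) : Prop :=
  v ∈ H.verts ∧ cdeg H v = 1

/-! ### Decomposition into indecomposable subgraphs -/

/-- `H = H₁ ∪ H₂`, where `H₁` and `H₂` have exactly one vertex in common and this vertex is free in
both. The trivial decompositions `H = H ∪ {v}` are excluded. -/
def IsGluing (H H₁ H₂ : G.Subgraph) : Prop :=
  H = H₁ ⊔ H₂ ∧ H₁ ≠ H ∧ H₂ ≠ H ∧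
    ∃ v, H₁.verts ∩ H₂.verts = {v} ∧ IsFreeVertex H₁ v ∧ IsFreeVertex H₂ v

/-- `H` is decomposable. -/
def IsDecomposable (H : G.Subgraph) : Prop :=
  ∃ H₁ H₂, IsGluing H H₁ H₂

/-- `DecomposesInto H I`: the recursive decomposition of `H` ends in the collection `I` of
connected indecomposable graphs. A disconnected graph is first broken into connected pieces. -/
inductive DecomposesInto : G.Subgraph → Multiset G.Subgraph → Prop
  | empty : DecomposesInto ⊥ 0
  | indecomposable (H : G.Subgraph) (hc : H.Connected) (hi : ¬ IsDecomposable H) :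
      DecomposesInto H {H}
  | glue (H H₁ H₂ : G.Subgraph) (I₁ I₂ : Multiset G.Subgraph) (hc : H.Connected)
      (hg : IsGluing H H₁ H₂) (h₁ : DecomposesInto H₁ I₁) (h₂ : DecomposesInto H₂ I₂) :
      DecomposesInto H (I₁ + I₂)
  | disjoint (H H₁ H₂ : G.Subgraph) (I₁ I₂ : Multiset G.Subgraph)
      (hu : H = H₁ ⊔ H₂) (hd : Disjoint H₁.verts H₂.verts)
      (h₁ : DecomposesInto H₁ I₁) (h₂ : DecomposesInto H₂ I₂) :
      DecomposesInto H (I₁ + I₂)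

/-! ### The algorithm -/

/-- `H_v`: the graph obtained from `H` by removing `v` and the endblocks to which `v` belongs. -/
def removeEndblocks (H : G.Subgraph) (v : V) : G.Subgraph :=
  H.deleteVerts ({v} ∪ ⋃ B ∈ endblocksAt H v, B.verts)

/-- A state of the algorithm: the current value of the variable `dim`, the collection `graphs` of
graphs still to be considered (`𝒢`), the collection `parts` of indecomposable non-block parts of
the current graph that the inner loop still has to treat (`ℐ`), and a record `taken` of the
vertices taken so far. -/
structure AlgState {V : Type u} (G : SimpleGraph V) where
  dim : ℕ
  graphs : Multiset G.Subgraph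
  parts : Multiset G.Subgraph
  taken : Set V

open Classical in
/-- One step of the (nondeterministic) algorithm.

`next`: the inner loop is finished; pick any `H ∈ 𝒢`, remove it from `𝒢`, decompose it into its
indecomposable subgraphs and discard those that are blocks.

`take`: pick any `P ∈ ℐ` and any vertex `v` of `P` lying in at least two endblocks of `P`; put
`dim := dim + cdeg(v) - 2` (clique degree in `P`; it is at least `2`, so the subtraction does not
truncate) and add the graph `P_v` to `𝒢`. -/
inductive Step : AlgState G → AlgState G → Prop
  | next (s : AlgState G) (H : G.Subgraph) (rest I : Multiset G.Subgraph)
      (hp : s.parts = 0) (hg : s.graphs = H ::ₘ rest) (hI : DecomposesInto H I) :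
      Step s { dim := s.dim
               graphs := rest
               parts := I.filter (fun P => ¬ IsBlock P P)
               taken := s.taken }
  | take (s : AlgState G) (P : G.Subgraph) (rest : Multiset G.Subgraph) (v : V)
      (hp : s.parts = P ::ₘ rest) (hv : v ∈ P.verts) (h2 : 2 ≤ (endblocksAt P v).ncard) :
      Step s { dim := s.dim + cdeg P v - 2
               graphs := removeEndblocks P v ::ₘ s.graphs
               parts := rest
               taken := insert v s.taken }

/-- The initial state: `dim := n + 1` and `𝒢 := {G}`. -/
noncomputable def initState (G : SimpleGraph V) : AlgState G where
  dim := Nat.card V + 1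
  graphs := {⊤}
  parts := 0
  taken := ∅

/-- `s` can be reached by the algorithm started on `G`. -/
def Reachable (s : AlgState G) : Prop :=
  Relation.ReflTransGen Step (initState G) s

/-- The algorithm has regularly finished: nothing is left to be considered. -/
def IsFinished (s : AlgState G) : Prop :=
  s.graphs = 0 ∧ s.parts = 0

end Graphs

/-! ### Binomial edge ideals -/

section Ideals

variable (K : Type u) [Field K] {n : ℕ}

/-- The polynomial ring `S = K[x₁, …, xₙ, y₁, …, yₙ]`. -/
abbrev PolyRing (n : ℕ) : Type u := MvPolynomial (Fin n ⊕ Fin n) K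

/-- The variable `x_i`. -/
noncomputable def xv (i : Fin n) : PolyRing K n := MvPolynomial.X (Sum.inl i)

/-- The variable `y_i`. -/
noncomputable def yv (i : Fin n) : PolyRing K n := MvPolynomial.X (Sum.inr i)

/-- The binomial edge ideal `J_G`. -/
noncomputable def binomialEdgeIdeal (G : SimpleGraph (Fin n)) : Ideal (PolyRing K n) :=
  Ideal.span {f | ∃ i j : Fin n, i < j ∧ G.Adj i j ∧ f = xv K i * yv K j - xv K j * yv K i}

/-- The disjoint union of the complete graphs on the vertex sets of the connected components of
`G` after removal of `T` (the vertices of `T` are kept as isolated vertices). -/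
def completedComponents (G : SimpleGraph (Fin n)) (T : Set (Fin n)) : SimpleGraph (Fin n) where
  Adj i j := i ≠ j ∧ ∃ (hi : i ∈ Tᶜ) (hj : j ∈ Tᶜ), (G.induce Tᶜ).Reachable ⟨i, hi⟩ ⟨j, hj⟩
  symm := ⟨fun _ _ h => ⟨h.1.symm, h.2.2.1, h.2.1, h.2.2.2.symm⟩⟩
  loopless := ⟨fun _ h => h.1 rfl⟩

/-- The ideal `P_T(G)`. -/
noncomputable def primeOf (G : SimpleGraph (Fin n)) (T : Set (Fin n)) : Ideal (PolyRing K n) :=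
  Ideal.span {f | ∃ i ∈ T, f = xv K i ∨ f = yv K i} ⊔
    binomialEdgeIdeal K (completedComponents G T)

/-- The minimal primes of `J_G` of minimum height. -/
def minHeightPrimes (G : SimpleGraph (Fin n)) : Set (Ideal (PolyRing K n)) :=
  {P | P ∈ (binomialEdgeIdeal K G).minimalPrimes ∧
    ∀ Q ∈ (binomialEdgeIdeal K G).minimalPrimes, P.height ≤ Q.height}

end Ideals

/-! ### Random access machine with unit cost

The memory consists of registers and of arrays of natural numbers. The only arithmetic is
`± 1`, so that after `t` steps no number exceeds the largest number of the input (or a constant of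
the program) by more than `t`; hence unit cost per instruction is realistic, and the addresses in
use are bounded in the same way. -/

/-- The memory: registers `reg 0, reg 1, …` and arrays `arr 0, arr 1, …`. -/
structure Mem where
  reg : ℕ → ℕ
  arr : ℕ → ℕ → ℕ

/-- `reg r := x`. -/
def Mem.setReg (m : Mem) (r x : ℕ) : Mem :=
  { m with reg := Function.update m.reg r x }

/-- `arr a [i] := x`. -/
def Mem.setArr (m : Mem) (a i x : ℕ) : Mem :=
  { m with arr := Function.update m.arr a (Function.update (m.arr a) i x) }

/-- Comparison of two registers. -/
inductive Test
  | eq (r s : ℕ)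
  | lt (r s : ℕ)

/-- The truth value of a comparison. -/
def Test.Holds : Test → Mem → Prop
  | .eq r s, m => m.reg r = m.reg s
  | .lt r s, m => m.reg r < m.reg s

/-- Programs. -/
inductive Prog
  | skip
  /-- `reg r := k` for a constant `k` -/
  | const (r k : ℕ)
  /-- `reg r := reg s` -/
  | copy (r s : ℕ)
  /-- `reg r := reg r + 1` -/
  | inc (r : ℕ)
  /-- `reg r := reg r - 1`, truncated at `0` -/
  | dec (r : ℕ)
  /-- `reg r := arr a [reg i]` -/
  | load (r a i : ℕ)
  /-- `arr a [reg i] := reg r` -/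
  | store (a i r : ℕ)
  | seq (p q : Prog)
  | ite (c : Test) (p q : Prog)
  | loop (c : Test) (p : Prog)

/-- `Exec p m t m'`: started with memory `m`, the program `p` halts after `t` steps with memory
`m'`. Every elementary instruction and every evaluation of a test is one step. -/
inductive Exec : Prog → Mem → ℕ → Mem → Prop
  | skip (m : Mem) : Exec .skip m 1 m
  | const (m : Mem) (r k : ℕ) : Exec (.const r k) m 1 (m.setReg r k)
  | copy (m : Mem) (r s : ℕ) : Exec (.copy r s) m 1 (m.setReg r (m.reg s))
  | inc (m : Mem) (r : ℕ) : Exec (.inc r) m 1 (m.setReg r (m.reg r + 1))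
  | dec (m : Mem) (r : ℕ) : Exec (.dec r) m 1 (m.setReg r (m.reg r - 1))
  | load (m : Mem) (r a i : ℕ) : Exec (.load r a i) m 1 (m.setReg r (m.arr a (m.reg i)))
  | store (m : Mem) (a i r : ℕ) : Exec (.store a i r) m 1 (m.setArr a (m.reg i) (m.reg r))
  | seq (p q : Prog) (m m' m'' : Mem) (t t' : ℕ) (hp : Exec p m t m') (hq : Exec q m' t' m'') :
      Exec (.seq p q) m (t + t') m''
  | iteTrue (c : Test) (p q : Prog) (m m' : Mem) (t : ℕ) (hc : c.Holds m) (hp : Exec p m t m') :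
      Exec (.ite c p q) m (t + 1) m'
  | iteFalse (c : Test) (p q : Prog) (m m' : Mem) (t : ℕ) (hc : ¬ c.Holds m)
      (hq : Exec q m t m') : Exec (.ite c p q) m (t + 1) m'
  | loopDone (c : Test) (p : Prog) (m : Mem) (hc : ¬ c.Holds m) : Exec (.loop c p) m 1 m
  | loopStep (c : Test) (p : Prog) (m m' m'' : Mem) (t t' : ℕ) (hc : c.Holds m)
      (hp : Exec p m t m') (hl : Exec (.loop c p) m' t' m'') :
      Exec (.loop c p) m (t + t' + 1) m''

/-- `L` is a family of adjacency lists of `G`: `L v` lists every neighbour of `v` exactly once, in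
an arbitrary order. -/
def IsAdjacencyList {n : ℕ} (G : SimpleGraph (Fin n)) (L : Fin n → List (Fin n)) : Prop :=
  ∀ v, (L v).Nodup ∧ ∀ w, w ∈ L v ↔ G.Adj v w

/-- The input memory for a graph given by adjacency lists: `reg 0` is the number of vertices,
`arr 1` is the concatenation of the lists `L 0, …, L (n - 1)`, and the list `L v` occupies the
positions `arr 0 [v], …, arr 0 [v + 1] - 1` of `arr 1`. Everything else is `0`. -/
def inputMem {n : ℕ} (L : Fin n → List (Fin n)) : Mem where
  reg r := if r = 0 then n else 0
  arr a i :=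
    if a = 0 then (((List.ofFn L).take i).map List.length).sum
    else if a = 1 then ((List.ofFn L).flatten.map Fin.val).getD i 0
    else 0

end BEI

/-!
The proof compares the algorithm with the numbers `n + c(T) - |T|`, where `T` runs through all sets
of vertices and `c(T)` is the number of components of `G` after removal of `T`.

*Algebra.* Every prime ideal that contains `J_G` contains some `P_T(G)`: modulo such a prime the
`2 × 2` minors propagate along paths through vertices `i` for which `x_i` and `y_i` do not both
vanish (`exists_primeOf_le`). Each `P_T(G)` is the kernel of the toric parametrization
`x_i ↦ s_i a_{c(i)}`, `y_i ↦ s_i b_{c(i)}` for `i ∉ T`, where `c(i)` is the component of `i`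
(`primeOf_eq`), hence prime. Explicit chains of kernels of degenerate parametrizations bound its
height and its coheight from below by `n + |T| - c(T)` and `n + c(T) - |T|`; the sum of these bounds
is `2n = dim S`, so both are attained (`height_coheight_paramPrime`). Thus `dim S / J_G` is the
maximum of `n + c(T) - |T|`, and the `T` attaining it give the minimal primes of minimum height
(`ringKrullDim_and_mem_minHeightPrimes`).

*Combinatorics.* Components of block graphs are counted with a rank function for which the
neighbours of lower rank of any vertex form a clique: an induced subgraph has as many components as
vertices without a neighbour of lower rank. This yields the basic formula that the removal of `v`
adds `cdeg(v) - 1` components (`comp_erase`). Let the excess of a graph be the maximum of the gain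
`c(T) - |T| - c(∅)`. Since a vertex lying in at most two blocks never improves the gain, the excess
is subadditive for decompositions at a free vertex (`IsGlueOf.excess_le`), and blocks have excess
zero. If `v` lies in two endblocks of `P`, then an optimal `T` may be assumed to contain `v`, so
that the excess of `P` is at most `cdeg(v) - 2` plus that of `P_v` (`IsPruning.excess_le`).
Therefore `dim` plus the excesses of the graphs still to be treated is an upper bound for all
`n + c(T) - |T|`; on the other hand every vertex taken really produces the components it is credited
for. At the end the two bounds meet (`IsSound.optimal`). The algorithm does not get stuck: among the
vertices of an indecomposable graph that lie in several blocks, one of maximal rank lies in at least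
three blocks, of which only the one towards lower ranks can fail to be an endblock
(`exists_endblocks`). It terminates because the number of vertices minus the number of components
decreases (`work_lt`).

*Linear time.* The run that always takes the vertex of highest rank can be read off directly: its
vertices are those at which at least three blocks are left when all vertices of higher rank have
been treated (`exists_greedy_run`). Breadth-first search supplies a rank. Going through the search
order backwards, a vertex `w` that is not taken leaves a block at its parent, which is counted there
unless an earlier treated vertex of the same block has already been counted; marking the other
neighbours of `w` records this (`IsSearch.isMarked_iff`). Time is estimated by loop invariants with
a potential, which is linear in the lengths of the adjacency lists still to be read (`exists_exec`).
-/

namespace BEI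

universe u

set_option linter.unusedSectionVars false

/-! ### Perfect ranks and the number of components -/

section Combinatorics

variable {V : Type u} [Fintype V] [DecidableEq V]

open Classical in
/-- The class of `u` among the neighbours of `v`: the block through the edge `vu`, without `v`
itself. Blocks at `v` are represented by these sets. -/
noncomputable def cls (G : SimpleGraph V) (v u : V) : Finset V :=
  Finset.univ.filter fun x => G.Adj v x ∧ (x = u ∨ G.Adj u x)

open Classical in
/-- The neighbours of `v` in the vertex set `W`. -/
noncomputable def nbrs (G : SimpleGraph V) (W : Finset V) (v : V) : Finset V :=
  W.filter (G.Adj v)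

/-- The number of blocks of the induced graph `G[W]` through `v` that have an edge at `v`. -/
noncomputable def deg (G : SimpleGraph V) (W : Finset V) (v : V) : ℕ :=
  ((nbrs G W v).image (cls G v)).card

/-- Two neighbours of a vertex `v` that are joined by a walk avoiding `v` are adjacent. For a
connected graph this says that all blocks are complete. -/
def CycleClosed (G : SimpleGraph V) : Prop :=
  ∀ v a b, G.Adj v a → G.Adj v b → a ≠ b → ∀ p : G.Walk a b, v ∉ p.support → G.Adj a b

/-- `r` ranks the vertices so that the neighbours of lower rank of any vertex form a clique. -/
structure IsPerfectRank (G : SimpleGraph V) (r : V → ℕ) : Prop where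
  inj : Function.Injective r
  clique : ∀ w a b, G.Adj w a → G.Adj w b → a ≠ b → r a < r w → r b < r w → G.Adj a b

open Classical in
/-- The vertices of `W` without neighbours of lower rank in `W`. -/
noncomputable def minima (G : SimpleGraph V) (r : V → ℕ) (W : Finset V) : Finset V :=
  W.filter fun w => ∀ x ∈ W, G.Adj w x → r w < r x

/-- The number of vertices of `W` without neighbours of lower rank in `W`; for a perfect rank this
is the number of connected components of `G[W]`. -/
noncomputable def comp (G : SimpleGraph V) (r : V → ℕ) (W : Finset V) : ℕ :=
  (minima G r W).card

variable {G : SimpleGraph V} {r : V → ℕ} {W A B : Finset V} {u v w x a b : V}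

theorem mem_cls : x ∈ cls G v u ↔ G.Adj v x ∧ (x = u ∨ G.Adj u x) := by simp [cls]

theorem mem_nbrs : x ∈ nbrs G W v ↔ x ∈ W ∧ G.Adj v x := by simp [nbrs]

theorem mem_minima : w ∈ minima G r W ↔ w ∈ W ∧ ∀ x ∈ W, G.Adj w x → r w < r x := by
  simp [minima]

theorem CycleClosed.trans (hG : CycleClosed G) (ha : G.Adj v a) (hb : G.Adj v b) (hab : a ≠ b)
    (hc : G.Adj v x) (hac : G.Adj a x) (hbc : G.Adj x b) : G.Adj a b := by
  refine hG v a b ha hb hab (.cons hac (.cons hbc .nil)) ?_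
  simp [ha.ne, hb.ne, hc.ne]

theorem cls_eq_iff (hG : CycleClosed G) (ha : G.Adj v a) (hb : G.Adj v b) :
    cls G v a = cls G v b ↔ a = b ∨ G.Adj a b := by
  constructor
  · intro h
    have : a ∈ cls G v b := by rw [← h, mem_cls]; exact ⟨ha, .inl rfl⟩
    rw [mem_cls] at this
    exact this.2.imp id fun h => h.symm
  · have key : ∀ a b, G.Adj v a → G.Adj v b → G.Adj a b → cls G v a ⊆ cls G v b := by
      intro a b ha hb hab x hx
      rw [mem_cls] at hx ⊢
      refine ⟨hx.1, ?_⟩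
      by_cases hxb : x = b
      · exact .inl hxb
      · right
        rcases hx.2 with rfl | h
        · exact hab.symm
        · exact hG.trans hb hx.1 (Ne.symm hxb) ha hab.symm h
    rintro (rfl | h)
    · rfl
    · exact (key a b ha hb h).antisymm (key b a hb ha h.symm)

theorem deg_mono (h : A ⊆ B) (v : V) : deg G A v ≤ deg G B v :=
  Finset.card_le_card (Finset.image_subset_image fun x hx => by
    rw [mem_nbrs] at hx ⊢; exact ⟨h hx.1, hx.2⟩)

theorem nbrs_union : nbrs G (A ∪ B) v = nbrs G A v ∪ nbrs G B v := by
  ext x; simp [mem_nbrs, or_and_right]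

theorem deg_union_le : deg G (A ∪ B) v ≤ deg G A v + deg G B v := by
  unfold deg
  rw [nbrs_union, Finset.image_union]
  exact Finset.card_union_le _ _

theorem deg_eq_zero_iff : deg G W v = 0 ↔ ∀ x ∈ W, ¬ G.Adj v x := by
  rw [deg, Finset.card_eq_zero, Finset.image_eq_empty, Finset.eq_empty_iff_forall_notMem]
  simp [mem_nbrs]

theorem deg_congr (h : nbrs G A v = nbrs G B v) : deg G A v = deg G B v := by
  rw [deg, h, deg]

theorem two_le_deg_iff (hG : CycleClosed G) :
    2 ≤ deg G W v ↔ ∃ a ∈ W, ∃ b ∈ W, G.Adj v a ∧ G.Adj v b ∧ a ≠ b ∧ ¬ G.Adj a b := by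
  unfold deg
  rw [← Nat.lt_iff_add_one_le, Finset.one_lt_card]
  constructor
  · rintro ⟨C, hC, D, hD, hCD⟩
    rw [Finset.mem_image] at hC hD
    obtain ⟨a, ha, rfl⟩ := hC
    obtain ⟨b, hb, rfl⟩ := hD
    rw [mem_nbrs] at ha hb
    rw [ne_eq, cls_eq_iff hG ha.2 hb.2, not_or] at hCD
    exact ⟨a, ha.1, b, hb.1, ha.2, hb.2, hCD⟩
  · rintro ⟨a, ha, b, hb, hva, hvb, h⟩
    refine ⟨_, Finset.mem_image_of_mem _ (mem_nbrs.2 ⟨ha, hva⟩), _,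
      Finset.mem_image_of_mem _ (mem_nbrs.2 ⟨hb, hvb⟩), ?_⟩
    rw [ne_eq, cls_eq_iff hG hva hvb, not_or]
    exact h

theorem adj_of_deg_le_one (hG : CycleClosed G) (h : deg G W v ≤ 1) (ha : a ∈ W) (hb : b ∈ W)
    (hva : G.Adj v a) (hvb : G.Adj v b) (hab : a ≠ b) : G.Adj a b := by
  by_contra hn
  have := (two_le_deg_iff hG).2 ⟨a, ha, b, hb, hva, hvb, hab, hn⟩
  omega

/-- Removing `v` from `G[W]` replaces the component of `v` by as many components as there are
blocks at `v`. -/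
theorem comp_erase (hG : CycleClosed G) (hr : IsPerfectRank G r) (hv : v ∈ W) :
    comp G r (W.erase v) + 1 = comp G r W + deg G W v := by
  classical
  -- the blocks at `v` without vertices of lower rank than `v` are represented by the vertices
  -- whose only neighbour of lower rank is `v`
  set D := (nbrs G W v).filter fun w => r v < r w ∧ ∀ x ∈ W, G.Adj w x → r x < r w → x = v
    with hD
  set N := (nbrs G W v).filter fun w => r w < r v with hN
  have h1 : minima G r (W.erase v) = (minima G r W).erase v ∪ D := by
    ext w
    simp only [mem_minima, Finset.mem_erase, Finset.mem_union, hD, Finset.mem_filter, mem_nbrs]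
    constructor
    · rintro ⟨⟨h1, h2⟩, h3⟩
      by_cases h : G.Adj w v ∧ r v < r w
      · right
        refine ⟨⟨h2, h.1.symm⟩, h.2, fun x hx hwx hlt => ?_⟩
        by_contra hxv
        have := h3 x ⟨hxv, hx⟩ hwx
        omega
      · left
        refine ⟨h1, h2, fun x hx hwx => ?_⟩
        by_cases hxv : x = v
        · subst hxv
          have : r x ≠ r w := fun h => h1 (hr.inj h).symm
          have : ¬ r x < r w := fun h' => h ⟨hwx, h'⟩
          omega
        · exact h3 x ⟨hxv, hx⟩ hwx
    · rintro (⟨h1, h2, h3⟩ | ⟨⟨h1, h2⟩, h3, h4⟩)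
      · exact ⟨⟨h1, h2⟩, fun x hx => h3 x hx.2⟩
      · refine ⟨⟨fun h => h2.ne h.symm, h1⟩, fun x hx hwx => ?_⟩
        by_contra hlt
        have : r x ≠ r w := fun h => hwx.ne (hr.inj h).symm
        exact hx.1 (h4 x hx.2 hwx (by omega))
  have h2 : Disjoint ((minima G r W).erase v) D := by
    rw [Finset.disjoint_left]
    intro w hw hwD
    rw [Finset.mem_erase, mem_minima] at hw
    rw [hD, Finset.mem_filter, mem_nbrs] at hwD
    have := hw.2.2 v hv hwD.1.2.symm
    omega
  have h3 : comp G r (W.erase v) = ((minima G r W).erase v).card + D.card := by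
    rw [comp, h1, Finset.card_union_of_disjoint h2]
  have h4 : (nbrs G W v).image (cls G v) = N.image (cls G v) ∪ D.image (cls G v) := by
    rw [← Finset.image_union]
    refine Finset.Subset.antisymm ?_ (Finset.image_subset_image
      (Finset.union_subset (Finset.filter_subset _ _) (Finset.filter_subset _ _)))
    intro C hC
    rw [Finset.mem_image] at hC
    obtain ⟨a, ha, rfl⟩ := hC
    have hne : (cls G v a ∩ W).Nonempty := by
      rw [mem_nbrs] at ha
      exact ⟨a, by rw [Finset.mem_inter, mem_cls]; exact ⟨⟨ha.2, .inl rfl⟩, ha.1⟩⟩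
    obtain ⟨m, hm, hmin⟩ := Finset.exists_min_image _ r hne
    rw [Finset.mem_inter, mem_cls] at hm
    rw [mem_nbrs] at ha
    have hcls : cls G v m = cls G v a :=
      (cls_eq_iff hG hm.1.1 ha.2).2 (hm.1.2.imp id fun h => h.symm)
    rw [Finset.mem_image]
    refine ⟨m, ?_, hcls⟩
    simp only [Finset.mem_union, hN, hD, Finset.mem_filter, mem_nbrs]
    by_cases hlt : r m < r v
    · exact .inl ⟨⟨hm.2, hm.1.1⟩, hlt⟩
    · have hne : r m ≠ r v := fun h => hm.1.1.ne (hr.inj h).symm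
      refine .inr ⟨⟨hm.2, hm.1.1⟩, by omega, fun x hx hmx hxm => ?_⟩
      by_contra hxv
      have hadj := hr.clique m x v hmx hm.1.1.symm hxv hxm (by omega)
      have := hmin x (by
        rw [Finset.mem_inter, ← hcls, mem_cls]; exact ⟨⟨hadj.symm, .inr hmx⟩, hx⟩)
      omega
  have h5 : Disjoint (N.image (cls G v)) (D.image (cls G v)) := by
    rw [Finset.disjoint_left]
    intro C hC hC'
    rw [Finset.mem_image] at hC hC'
    obtain ⟨a, ha, rfl⟩ := hC
    obtain ⟨d, hd, h⟩ := hC'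
    simp only [hN, hD, Finset.mem_filter, mem_nbrs] at ha hd
    rw [cls_eq_iff hG hd.1.2 ha.1.2] at h
    rcases h with rfl | h
    · omega
    · exact ha.1.2.ne (hd.2.2 a ha.1.1 h (by omega)).symm
  have h6 : (D.image (cls G v)).card = D.card := by
    apply Finset.card_image_of_injOn
    intro d hd e he h
    simp only [hD, Finset.coe_filter, Set.mem_ofPred_eq, mem_nbrs] at hd he
    by_contra hde
    rcases (cls_eq_iff hG hd.1.2 he.1.2).1 h with h | h
    · exact hde h
    · rcases lt_trichotomy (r d) (r e) with hlt | heq | hlt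
      · exact hd.1.2.ne (he.2.2 d hd.1.1 h.symm hlt).symm
      · exact hde (hr.inj heq)
      · exact he.1.2.ne (hd.2.2 e he.1.1 h hlt).symm
  have h7 : deg G W v = (N.image (cls G v)).card + D.card := by
    rw [deg, h4, Finset.card_union_of_disjoint h5, h6]
  rw [h3, h7]
  by_cases hm : v ∈ minima G r W
  · have hN0 : N = ∅ := by
      rw [Finset.eq_empty_iff_forall_notMem]
      intro x hx
      simp only [hN, Finset.mem_filter, mem_nbrs] at hx
      rw [mem_minima] at hm
      have := hm.2 x hx.1.1 hx.1.2
      omega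
    rw [hN0, comp, ← Finset.card_erase_add_one hm]
    simp
    omega
  · have hN1 : (N.image (cls G v)).card = 1 := by
      rw [mem_minima] at hm
      push Not at hm
      obtain ⟨y, hy, hvy, hle⟩ := hm hv
      have hne : r y ≠ r v := fun h => hvy.ne (hr.inj h).symm
      rw [Finset.card_eq_one]
      refine ⟨cls G v y, ?_⟩
      ext C
      rw [Finset.mem_image, Finset.mem_singleton]
      constructor
      · rintro ⟨a, ha, rfl⟩
        simp only [hN, Finset.mem_filter, mem_nbrs] at ha
        rw [cls_eq_iff hG ha.1.2 hvy]
        by_cases hay : a = y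
        · exact .inl hay
        · exact .inr (hr.clique v a y ha.1.2 hvy hay ha.2 (by omega))
      · rintro rfl
        refine ⟨y, ?_, rfl⟩
        simp only [hN, Finset.mem_filter, mem_nbrs]
        exact ⟨⟨hy, hvy⟩, by omega⟩
    rw [hN1, comp, Finset.erase_eq_of_notMem hm]
    omega

/-- The number of components is additive for unions without edges between the two parts. -/
theorem comp_union (hd : Disjoint A B) (hE : ∀ a ∈ A, ∀ b ∈ B, ¬ G.Adj a b) :
    comp G r (A ∪ B) = comp G r A + comp G r B := by
  classical
  rw [comp, comp, comp, ← Finset.card_union_of_disjoint]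
  · congr 1
    ext w
    simp only [mem_minima, Finset.mem_union]
    constructor
    · rintro ⟨h | h, h'⟩
      · exact .inl ⟨h, fun x hx => h' x (.inl hx)⟩
      · exact .inr ⟨h, fun x hx => h' x (.inr hx)⟩
    · rintro (⟨h, h'⟩ | ⟨h, h'⟩)
      · exact ⟨.inl h, fun x hx hwx => hx.elim (fun hx => h' x hx hwx)
          fun hx => absurd hwx (hE w h x hx)⟩
      · exact ⟨.inr h, fun x hx hwx => hx.elim (fun hx => absurd hwx.symm (hE x hx w h))
          fun hx => h' x hx hwx⟩
  · exact hd.mono (Finset.filter_subset _ _) (Finset.filter_subset _ _)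

/-- Gluing two graphs along one vertex merges two components. -/
theorem comp_glue (hG : CycleClosed G) (hr : IsPerfectRank G r) (hAB : A ∩ B = {u})
    (hE : ∀ a ∈ A, ∀ b ∈ B, a ≠ u → b ≠ u → ¬ G.Adj a b) :
    comp G r (A ∪ B) + 1 = comp G r A + comp G r B := by
  classical
  have hu : u ∈ A ∩ B := by rw [hAB]; exact Finset.mem_singleton_self u
  rw [Finset.mem_inter] at hu
  have h1 := comp_erase hG hr hu.1
  have h2 := comp_erase hG hr hu.2
  have h3 := comp_erase hG hr (Finset.mem_union_left B hu.1)
  have h4 : comp G r ((A ∪ B).erase u) = comp G r (A.erase u) + comp G r (B.erase u) := by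
    rw [Finset.erase_union_distrib, comp_union]
    · rw [Finset.disjoint_left]
      intro x hx hx'
      rw [Finset.mem_erase] at hx hx'
      have : x ∈ A ∩ B := Finset.mem_inter.2 ⟨hx.2, hx'.2⟩
      rw [hAB, Finset.mem_singleton] at this
      exact hx.1 this
    · intro a ha b hb
      rw [Finset.mem_erase] at ha hb
      exact hE a ha.2 b hb.2 ha.1 hb.1
  have h5 : deg G (A ∪ B) u = deg G A u + deg G B u := by
    rw [deg, nbrs_union, Finset.image_union, Finset.card_union_of_disjoint, deg, deg]
    rw [Finset.disjoint_left]
    intro C hC hC'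
    rw [Finset.mem_image] at hC hC'
    obtain ⟨a, ha, rfl⟩ := hC
    obtain ⟨b, hb, h⟩ := hC'
    rw [mem_nbrs] at ha hb
    rw [cls_eq_iff hG hb.2 ha.2] at h
    rcases h with rfl | h
    · have : b ∈ A ∩ B := Finset.mem_inter.2 ⟨ha.1, hb.1⟩
      rw [hAB, Finset.mem_singleton] at this
      exact hb.2.ne this.symm
    · exact hE a ha.1 b hb.1 ha.2.ne' hb.2.ne' h.symm
  omega

theorem comp_le_card : comp G r W ≤ W.card :=
  Finset.card_le_card fun _ h => (mem_minima.1 h).1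

open Classical in
/-- The vertex reached from `w` by passing to neighbours of lower rank in `W` as long as
possible. -/
noncomputable def root (G : SimpleGraph V) (r : V → ℕ) (W : Finset V) (w : V) : V :=
  if h : ∃ x ∈ W, G.Adj w x ∧ r x < r w then root G r W h.choose else w
termination_by r w
decreasing_by exact h.choose_spec.2.2

theorem root_cases (G : SimpleGraph V) (r : V → ℕ) (W : Finset V) (w : V) :
    (∃ x ∈ W, G.Adj w x ∧ r x < r w ∧ root G r W w = root G r W x) ∨
      ((∀ x ∈ W, G.Adj w x → ¬ r x < r w) ∧ root G r W w = w) := by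
  by_cases h : ∃ x ∈ W, G.Adj w x ∧ r x < r w
  · left
    refine ⟨h.choose, h.choose_spec.1, h.choose_spec.2.1, h.choose_spec.2.2, ?_⟩
    conv_lhs => rw [root]
    rw [dif_pos h]
  · right
    push Not at h
    refine ⟨fun x hx hwx => not_lt.2 (h x hx hwx), ?_⟩
    rw [root, dif_neg]
    push Not
    exact h

theorem root_induction {P : V → V → Prop} (refl : ∀ w ∈ W, P w w)
    (step : ∀ w ∈ W, ∀ x ∈ W, ∀ y, G.Adj w x → P x y → P w y) (hw : w ∈ W) :
    P w (root G r W w) := by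
  induction h : r w using Nat.strong_induction_on generalizing w with
  | _ k ih =>
    rcases root_cases G r W w with ⟨x, hx, hwx, hlt, he⟩ | ⟨-, he⟩
    · rw [he]
      exact step w hw x hx _ hwx (ih (r x) (h ▸ hlt) hx rfl)
    · rw [he]; exact refl w hw

theorem root_mem_minima (hr : IsPerfectRank G r) (hw : w ∈ W) :
    root G r W w ∈ minima G r W := by
  induction h : r w using Nat.strong_induction_on generalizing w with
  | _ k ih =>
    rcases root_cases G r W w with ⟨x, hx, hwx, hlt, he⟩ | ⟨hn, he⟩
    · rw [he]
      exact ih (r x) (h ▸ hlt) hx rfl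
    · rw [he, mem_minima]
      refine ⟨hw, fun x hx hwx => ?_⟩
      have h1 := hn x hx hwx
      have h2 : r x ≠ r w := fun h => hwx.ne (hr.inj h).symm
      omega

theorem root_eq_self (hw : w ∈ minima G r W) : root G r W w = w := by
  rw [mem_minima] at hw
  rcases root_cases G r W w with ⟨x, hx, hwx, hlt, he⟩ | ⟨-, he⟩
  · have := hw.2 x hx hwx
    omega
  · exact he

theorem root_eq_of_adj (hr : IsPerfectRank G r) (ha : a ∈ W) (hb : b ∈ W) (hab : G.Adj a b) :
    root G r W a = root G r W b := by
  have key : ∀ k, ∀ a ∈ W, ∀ b ∈ W, G.Adj a b → r a < r b → r b = k →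
      root G r W a = root G r W b := by
    intro k
    induction k using Nat.strong_induction_on with
    | _ k ih =>
      intro a ha b hb hab hlt hk
      rcases root_cases G r W b with ⟨x, hx, hbx, hxb, he⟩ | ⟨hn, -⟩
      · rw [he]
        by_cases hax : a = x
        · rw [hax]
        · have hadj := hr.clique b a x hab.symm hbx hax hlt hxb
          rcases lt_trichotomy (r a) (r x) with h | h | h
          · exact ih (r x) (hk ▸ hxb) a ha x hx hadj h rfl
          · rw [hr.inj h]
          · exact (ih (r a) (hk ▸ hlt) x hx a ha hadj.symm h rfl).symm
      · exact absurd hlt (hn a ha hab.symm)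
  rcases lt_trichotomy (r a) (r b) with h | h | h
  · exact key _ a ha b hb hab h rfl
  · rw [hr.inj h]
  · exact (key _ b hb a ha hab.symm h rfl).symm

end Combinatorics

/-! ### Components, cutpoints and blocks of block graphs -/

section Blocks

variable {V : Type u} [Fintype V] [DecidableEq V]
variable {G : SimpleGraph V} {r : V → ℕ} {H B : G.Subgraph} {v w a b : V}

theorem numComp_le_one {T : Set V} (h : (H.deleteVerts T).Preconnected) : numComp H T ≤ 1 := by
  have := h.coe.subsingleton_connectedComponent
  exact Finite.card_le_one_iff_subsingleton.2 this

theorem numComp_pos {T : Set V} (h : (H.verts \ T).Nonempty) : 0 < numComp H T := by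
  obtain ⟨x, hx⟩ := h
  have : Nonempty (H.deleteVerts T).coe.ConnectedComponent :=
    ⟨SimpleGraph.connectedComponentMk _ ⟨x, hx⟩⟩
  exact Nat.card_pos

theorem not_isCutpoint_of_preconnected (h : (H.deleteVerts {v}).Preconnected) :
    ¬ IsCutpoint H v := by
  intro hc
  have h1 := hc.2 v rfl
  have h2 : 0 < numComp H ({v} \ {v}) := numComp_pos ⟨v, hc.1 rfl, by simp⟩
  have h3 := numComp_le_one h
  omega

/-- A cycle has no cutpoints: what remains after removing a vertex is a path. -/
theorem not_isCutpoint_toSubgraph_of_isCycle {c : G.Walk a a} (hc : c.IsCycle) (v : V) :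
    ¬ IsCutpoint c.toSubgraph v := by
  intro hv
  have hvs : v ∈ c.support := by
    have := hv.1 (Set.mem_singleton v)
    rwa [SimpleGraph.Walk.mem_verts_toSubgraph] at this
  rw [← c.toSubgraph_rotate hvs] at hv
  have hc' : (c.rotate v hvs).IsCycle := SimpleGraph.Walk.isCycle_rotate hvs |>.2 hc
  revert hv
  generalize c.rotate v hvs = d at hc'
  cases d with
  | nil => exact absurd hc' SimpleGraph.Walk.not_isCycle_nil
  | @cons _ y _ h p =>
    rw [SimpleGraph.Walk.cons_isCycle_iff] at hc'
    rw [SimpleGraph.Walk.toSubgraph, ← p.toSubgraph_reverse]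
    have hp := hc'.1.reverse
    revert hp
    generalize p.reverse = q
    intro hp
    cases q with
    | nil => exact absurd rfl h.ne
    | @cons _ z _ h2 q =>
      rw [SimpleGraph.Walk.cons_isPath_iff] at hp
      apply not_isCutpoint_of_preconnected
      refine (SimpleGraph.Subgraph.Connected.mono (H := q.toSubgraph) ?_ ?_
        q.toSubgraph_connected).preconnected
      · constructor
        · intro x hx
          rw [SimpleGraph.Walk.mem_verts_toSubgraph] at hx
          refine ⟨?_, fun h => hp.2 (h ▸ hx)⟩
          simp [hx]
        · intro x y hxy
          have hx := SimpleGraph.Walk.mem_support_of_adj_toSubgraph hxy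
          have hy := SimpleGraph.Walk.mem_support_of_adj_toSubgraph hxy.symm
          rw [SimpleGraph.Subgraph.deleteVerts_adj]
          refine ⟨?_, fun h => hp.2 (h ▸ hx), ?_, fun h => hp.2 (h ▸ hy), ?_⟩
          · simp [hx]
          · simp [hy]
          · simp [hxy]
      · ext x
        have h1 : y ∈ q.support := q.end_mem_support
        have h2 : z ∈ q.support := q.start_mem_support
        have h3 := hp.2
        simp only [SimpleGraph.Walk.verts_toSubgraph, Set.mem_ofPred_eq,
          SimpleGraph.Subgraph.deleteVerts_verts, SimpleGraph.Subgraph.verts_sup,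
          SimpleGraph.subgraphOfAdj_verts, SimpleGraph.Walk.toSubgraph, Set.mem_sdiff,
          Set.mem_union, Set.mem_insert_iff, Set.mem_singleton_iff]
        constructor
        · intro hx
          exact ⟨.inr (.inr hx), fun h => h3 (h ▸ hx)⟩
        · rintro ⟨(h | h) | (h | h) | h, h'⟩
          · exact absurd h h'
          · exact h ▸ h1
          · exact absurd h h'
          · exact h ▸ h2
          · exact h

theorem IsBlockGraph.adj_of_le (hG : IsBlockGraph (⊤ : G.Subgraph)) (hB : B.Connected)
    (hc : ∀ v, ¬ IsCutpoint B v) (ha : a ∈ B.verts) (hb : b ∈ B.verts) (hab : a ≠ b) :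
    G.Adj a b := by
  obtain ⟨C, hBC, hC⟩ := (Set.toFinite {B' : G.Subgraph | B' ≤ ⊤ ∧ B'.Connected ∧
    ∀ v, ¬ IsCutpoint B' v}).exists_le_maximal (a := B) ⟨le_top, hB, hc⟩
  exact (hG C hC a (hBC.1 ha) b (hBC.1 hb) hab).adj_sub

theorem IsBlockGraph.cycleClosed (hG : IsBlockGraph (⊤ : G.Subgraph)) : CycleClosed G := by
  intro v a b ha hb hab p hp
  have hp' : v ∉ p.bypass.support := fun h => hp (p.support_bypass_subset_support h)
  have hcyc : (SimpleGraph.Walk.cons ha (p.bypass.concat hb.symm)).IsCycle := by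
    rw [SimpleGraph.Walk.cons_isCycle_iff]
    refine ⟨p.bypass_isPath.concat hp' _, ?_⟩
    rw [SimpleGraph.Walk.edges_concat, List.concat_eq_append, List.mem_append, not_or]
    refine ⟨fun h => hp' (p.bypass.fst_mem_support_of_mem_edges h), ?_⟩
    simp [hab, hb.ne]
  refine hG.adj_of_le (SimpleGraph.Walk.toSubgraph_connected _)
    (not_isCutpoint_toSubgraph_of_isCycle hcyc) ?_ ?_ hab
  · simp
  · simp

/-- An order in which every vertex but the first has an earlier neighbour is perfect. -/
theorem CycleClosed.isPerfectRank (hG : CycleClosed G) (hinj : Function.Injective r) (x₀ : V)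
    (h0 : ∀ x, x ≠ x₀ → ∃ y, G.Adj x y ∧ r y < r x) : IsPerfectRank G r := by
  refine ⟨hinj, fun w a b ha hb hab hra hrb => ?_⟩
  -- every vertex is joined to the first one by a walk of falling rank
  have key : ∀ x, ∃ p : G.Walk x x₀, ∀ y ∈ p.support, r y ≤ r x := by
    intro x
    induction h : r x using Nat.strong_induction_on generalizing x with
    | _ k ih =>
      by_cases hx : x = x₀
      · subst hx
        exact ⟨.nil, by simp [h]⟩
      · obtain ⟨y, hxy, hlt⟩ := h0 x hx
        obtain ⟨p, hp⟩ := ih (r y) (h ▸ hlt) y rfl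
        refine ⟨.cons hxy p, fun z hz => ?_⟩
        rw [SimpleGraph.Walk.support_cons, List.mem_cons] at hz
        rcases hz with rfl | hz
        · exact h.le
        · have := hp z hz
          omega
  obtain ⟨p, hp⟩ := key a
  obtain ⟨q, hq⟩ := key b
  refine hG w a b ha hb hab (p.append q.reverse) ?_
  rw [SimpleGraph.Walk.mem_support_append_iff, SimpleGraph.Walk.support_reverse, List.mem_reverse]
  rintro (h | h)
  · have := hp w h
    omega
  · have := hq w h
    omega

theorem exists_isPerfectRank (hG : CycleClosed G) (hc : G.Connected) :
    ∃ r : V → ℕ, IsPerfectRank G r := by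
  -- rank by the distance to a fixed vertex, ties being broken arbitrarily
  obtain ⟨x₀⟩ := hc.nonempty
  let e := Fintype.equivFin V
  let N := Fintype.card V
  refine ⟨fun v => G.dist x₀ v * N + (e v : ℕ), hG.isPerfectRank ?_ x₀ ?_⟩
  · intro v w h
    have h1 := congrArg (· % N) h
    have hv : (e v : ℕ) < N := (e v).2
    have hw : (e w : ℕ) < N := (e w).2
    simp only [Nat.mul_add_mod_self_right, Nat.mod_eq_of_lt hv, Nat.mod_eq_of_lt hw] at h1
    exact e.injective (Fin.ext h1)
  · intro x hx
    obtain ⟨p, hp⟩ := hc.exists_walk_length_eq_dist x x₀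
    cases p with
    | nil => exact absurd rfl hx
    | @cons _ y _ h p =>
      refine ⟨y, h, ?_⟩
      have h1 : G.dist x₀ y ≤ p.length := by
        rw [SimpleGraph.dist_comm]; exact SimpleGraph.dist_le p
      have h2 : G.dist x₀ x = p.length + 1 := by
        rw [SimpleGraph.dist_comm, ← hp, SimpleGraph.Walk.length_cons]
      have h3 : G.dist x₀ y * N ≤ p.length * N := Nat.mul_le_mul_right _ h1
      have h4 : (e y : ℕ) < N := (e y).2
      rw [h2, add_mul]
      omega

open Classical in
/-- The vertices of a subgraph as a `Finset`. -/
noncomputable def vs (H : G.Subgraph) : Finset V := Finset.univ.filter (· ∈ H.verts)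

theorem mem_vs : v ∈ vs H ↔ v ∈ H.verts := by simp [vs]

theorem coe_vs : (vs H : Set V) = H.verts := by ext; simp [mem_vs]

theorem isInduced_deleteVerts (hH : H.IsInduced) (T : Set V) : (H.deleteVerts T).IsInduced := by
  intro a ha b hb hab
  rw [SimpleGraph.Subgraph.deleteVerts_adj]
  exact ⟨ha.1, ha.2, hb.1, hb.2, hH ha.1 hb.1 hab⟩

theorem reachable_root (hH : H.IsInduced) (w : H.verts) :
    ∃ h : root G r (vs H) w ∈ H.verts, H.coe.Reachable w ⟨root G r (vs H) w, h⟩ := by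
  refine root_induction (P := fun a b => ∀ ha : a ∈ H.verts, ∃ hb : b ∈ H.verts,
    H.coe.Reachable ⟨a, ha⟩ ⟨b, hb⟩) (W := vs H) ?_ ?_ (mem_vs.2 w.2) w.2
  · exact fun w _ hw => ⟨hw, .rfl⟩
  · intro w hw x hx y hwx h hw'
    rw [mem_vs] at hw hx
    obtain ⟨hy, h⟩ := h hx
    refine ⟨hy, .trans (SimpleGraph.Adj.reachable ?_) h⟩
    exact hH hw hx hwx

theorem root_eq_of_reachable (hr : IsPerfectRank G r) {a b : H.verts}
    (h : H.coe.Reachable a b) : root G r (vs H) a = root G r (vs H) b := by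
  obtain ⟨p⟩ := h
  induction p with
  | nil => rfl
  | cons h _ ih =>
    rw [← ih]
    exact root_eq_of_adj hr (mem_vs.2 (Subtype.prop _)) (mem_vs.2 (Subtype.prop _))
      (H.adj_sub h)

theorem card_connectedComponent (hr : IsPerfectRank G r) (hH : H.IsInduced) :
    Nat.card H.coe.ConnectedComponent = comp G r (vs H) := by
  have hbij : Function.Bijective (fun w : minima G r (vs H) =>
      H.coe.connectedComponentMk ⟨w, mem_vs.1 (mem_minima.1 w.2).1⟩) := by
    constructor
    · intro a b hab
      have h := root_eq_of_reachable hr (SimpleGraph.ConnectedComponent.exact hab)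
      dsimp only at h
      rw [root_eq_self a.2, root_eq_self b.2] at h
      exact Subtype.ext h
    · intro C
      induction C using SimpleGraph.ConnectedComponent.ind with
      | _ w =>
        obtain ⟨h, hw⟩ := reachable_root (r := r) hH w
        exact ⟨⟨_, root_mem_minima hr (mem_vs.2 w.2)⟩,
          (SimpleGraph.ConnectedComponent.sound hw).symm⟩
  rw [← Nat.card_eq_of_bijective _ hbij, Nat.card_eq_fintype_card, Fintype.card_coe, comp]

theorem numComp_eq (hr : IsPerfectRank G r) (hH : H.IsInduced) (T : Set V) :
    numComp H T = comp G r (vs (H.deleteVerts T)) :=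
  card_connectedComponent hr (isInduced_deleteVerts hH T)

theorem comp_eq_one (hr : IsPerfectRank G r) (hH : H.IsInduced) (hc : H.Connected) :
    comp G r (vs H) = 1 := by
  rw [← card_connectedComponent hr hH]
  have h1 := hc.coe.preconnected.subsingleton_connectedComponent
  have h2 := hc.coe.nonempty
  have h3 : Nonempty H.coe.ConnectedComponent := h2.map H.coe.connectedComponentMk
  exact Nat.card_unique

theorem vs_deleteVerts_singleton : vs (H.deleteVerts {v}) = (vs H).erase v := by
  ext x
  simp only [mem_vs, SimpleGraph.Subgraph.deleteVerts_verts, Finset.mem_erase, Set.mem_sdiff,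
    Set.mem_singleton_iff]
  tauto

/-- A vertex is a cutpoint if and only if it lies in at least two blocks. -/
theorem isCutpoint_iff (hG : CycleClosed G) (hr : IsPerfectRank G r) (hH : H.IsInduced) :
    IsCutpoint H v ↔ v ∈ H.verts ∧ 2 ≤ deg G (vs H) v := by
  have key : v ∈ H.verts → (numComp H ({v} \ {v}) < numComp H {v} ↔ 2 ≤ deg G (vs H) v) := by
    intro hv
    rw [numComp_eq hr hH, numComp_eq hr hH, vs_deleteVerts_singleton, Set.sdiff_self,
      SimpleGraph.Subgraph.deleteVerts_empty]
    have := comp_erase hG hr (mem_vs.2 hv)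
    omega
  constructor
  · intro h
    have hv : v ∈ H.verts := h.1 rfl
    exact ⟨hv, (key hv).1 (h.2 v rfl)⟩
  · rintro ⟨hv, h⟩
    refine ⟨Set.singleton_subset_iff.2 hv, fun i hi => ?_⟩
    rw [Set.mem_singleton_iff] at hi
    subst hi
    exact (key hv).2 h

theorem deg_le_one_of_isBlock_self (hG : CycleClosed G) (hr : IsPerfectRank G r)
    (hH : H.IsInduced) (hb : IsBlock H H) (hv : v ∈ H.verts) : deg G (vs H) v ≤ 1 := by
  by_contra h
  exact hb.1.2.2 v ((isCutpoint_iff hG hr hH).2 ⟨hv, by omega⟩)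

theorem exists_two_le_deg_of_not_isBlock (hG : CycleClosed G) (hr : IsPerfectRank G r)
    (hH : H.IsInduced) (hc : H.Connected) (hb : ¬ IsBlock H H) :
    ∃ v ∈ vs H, 2 ≤ deg G (vs H) v := by
  by_contra h
  push Not at h
  refine hb ⟨⟨le_rfl, hc, fun v hv => ?_⟩, fun B hB _ => hB.1⟩
  rw [isCutpoint_iff hG hr hH, ← mem_vs] at hv
  have := h v hv.1
  omega

/-! ### Blocks as maximal cliques -/

theorem IsInduced.le_of_verts_subset {H' : G.Subgraph} (hH : H.IsInduced)
    (h : H'.verts ⊆ H.verts) : H' ≤ H :=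
  ⟨h, fun _ _ hab => hH (h (H'.edge_vert hab)) (h (H'.edge_vert hab.symm)) hab.adj_sub⟩

theorem isInduced_induce_top (C : Set V) : ((⊤ : G.Subgraph).induce C).IsInduced := by
  rw [SimpleGraph.Subgraph.isInduced_iff_exists_eq_induce_top]
  exact ⟨C, rfl⟩

theorem isBlock_of_maximal (hB : IsBlockGraph (⊤ : G.Subgraph)) (hr : IsPerfectRank G r)
    (hH : H.IsInduced) {C : Set V} (hC : Maximal (IsCliqueOf H) C) (hne : C.Nonempty) :
    IsBlock H ((⊤ : G.Subgraph).induce C) := by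
  have hG := hB.cycleClosed
  have hind := isInduced_induce_top (G := G) C
  refine ⟨⟨IsInduced.le_of_verts_subset hH hC.1.1, ?_, ?_⟩, ?_⟩
  · rw [SimpleGraph.Subgraph.connected_iff]
    refine ⟨⟨fun a b => ?_⟩, hne⟩
    by_cases hab : a = b
    · rw [hab]
    · refine SimpleGraph.Adj.reachable ?_
      exact hind a.2 b.2 (hC.1.2 a a.2 b b.2 fun h => hab (Subtype.ext h)).adj_sub
  · intro v hv
    rw [isCutpoint_iff hG hr hind, two_le_deg_iff hG] at hv
    obtain ⟨-, a, ha, b, hb, -, -, hab, hn⟩ := hv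
    rw [mem_vs] at ha hb
    exact hn (hC.1.2 a ha b hb hab).adj_sub
  · rintro B ⟨hBH, hBc, hBn⟩ hle
    refine IsInduced.le_of_verts_subset hind ?_
    refine hC.2 ⟨hBH.1, fun a ha b hb hab => ?_⟩ hle.1
    exact hH (hBH.1 ha) (hBH.1 hb) (hB.adj_of_le hBc hBn ha hb hab)

theorem IsBlock.maximal (hB : IsBlockGraph (⊤ : G.Subgraph)) (hr : IsPerfectRank G r)
    (hH : H.IsInduced) (h : IsBlock H B) : Maximal (IsCliqueOf H) B.verts ∧ B.IsInduced := by
  have hclq : IsCliqueOf H B.verts := ⟨h.1.1.1, fun a ha b hb hab =>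
    hH (h.1.1.1 ha) (h.1.1.1 hb) (hB.adj_of_le h.1.2.1 h.1.2.2 ha hb hab)⟩
  obtain ⟨C, hBC, hC⟩ := (Set.toFinite {C | IsCliqueOf H C}).exists_le_maximal hclq
  have hCne : C.Nonempty := h.1.2.1.nonempty.mono hBC
  have h1 := h.2 (isBlock_of_maximal hB hr hH hC hCne).1 ⟨hBC, fun a b hab =>
    isInduced_induce_top C (hBC (B.edge_vert hab)) (hBC (B.edge_vert hab.symm)) hab.adj_sub⟩
  have h2 : B.verts = C := Set.Subset.antisymm hBC h1.1
  refine ⟨h2 ▸ hC, fun a ha b hb hab => h1.2 ?_⟩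
  exact isInduced_induce_top C (hBC ha) (hBC hb) hab

/-- The maximal clique of `H` through the edge `vu`. -/
def lineOf (H : G.Subgraph) (v : V) (L : Finset V) : Set V := {x ∈ H.verts | x = v ∨ x ∈ L}

theorem lineOf_maximal (hG : CycleClosed G) (hH : H.IsInduced) (hv : v ∈ H.verts)
    (ha : a ∈ H.verts) (hva : G.Adj v a) : Maximal (IsCliqueOf H) (lineOf H v (cls G v a)) := by
  refine ⟨⟨fun x hx => hx.1, ?_⟩, ?_⟩
  · rintro x ⟨hx, hx'⟩ y ⟨hy, hy'⟩ hxy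
    refine hH hx hy ?_
    rcases hx' with rfl | hx' <;> rcases hy' with rfl | hy'
    · exact absurd rfl hxy
    · exact (mem_cls.1 hy').1
    · exact (mem_cls.1 hx').1.symm
    · rw [mem_cls] at hx' hy'
      have h1 := (cls_eq_iff hG hx'.1 hva).2 (hx'.2.imp id fun h => h.symm)
      have h2 := (cls_eq_iff hG hy'.1 hva).2 (hy'.2.imp id fun h => h.symm)
      exact ((cls_eq_iff hG hx'.1 hy'.1).1 (h1.trans h2.symm)).resolve_left hxy
  · intro C hC hle x hx
    refine ⟨hC.1 hx, ?_⟩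
    have hvC : v ∈ C := hle ⟨hv, .inl rfl⟩
    have haC : a ∈ C := hle ⟨ha, .inr (mem_cls.2 ⟨hva, .inl rfl⟩)⟩
    by_cases hxv : x = v
    · exact .inl hxv
    · right
      rw [mem_cls]
      refine ⟨(hC.2 v hvC x hx (Ne.symm hxv)).adj_sub, ?_⟩
      by_cases hxa : x = a
      · exact .inl hxa
      · exact .inr (hC.2 a haC x hx (Ne.symm hxa)).adj_sub

theorem eq_lineOf (hG : CycleClosed G) (hH : H.IsInduced) {C : Set V}
    (hC : Maximal (IsCliqueOf H) C) (hv : v ∈ C) (ha : a ∈ C) (hva : v ≠ a) :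
    C = lineOf H v (cls G v a) := by
  have hadj := (hC.1.2 v hv a ha hva).adj_sub
  refine hC.eq_of_subset (lineOf_maximal hG hH (hC.1.1 hv) (hC.1.1 ha) hadj).1 fun x hx => ?_
  refine ⟨hC.1.1 hx, ?_⟩
  by_cases hxv : x = v
  · exact .inl hxv
  · right
    rw [mem_cls]
    refine ⟨(hC.1.2 v hv x hx (Ne.symm hxv)).adj_sub, ?_⟩
    by_cases hxa : x = a
    · exact .inl hxa
    · exact .inr (hC.1.2 a ha x hx (Ne.symm hxa)).adj_sub

/-- The clique degree of a vertex that is not isolated is the number of blocks at it. -/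
theorem cdeg_eq_deg (hG : CycleClosed G) (hH : H.IsInduced) (hv : v ∈ H.verts)
    (h : 1 ≤ deg G (vs H) v) : cdeg H v = deg G (vs H) v := by
  have himg : {C : Set V | Maximal (IsCliqueOf H) C ∧ v ∈ C} =
      lineOf H v '' ((nbrs G (vs H) v).image (cls G v) : Finset (Finset V)) := by
    ext C
    simp only [Set.mem_ofPred_eq, Set.mem_image, Finset.mem_coe, Finset.mem_image, mem_nbrs, mem_vs]
    constructor
    · rintro ⟨hC, hvC⟩
      -- as `v` has a neighbour, the clique `{v}` is not maximal
      have : ∃ a ∈ C, v ≠ a := by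
        by_contra hn
        push Not at hn
        rw [Nat.one_le_iff_ne_zero, ne_eq, deg_eq_zero_iff] at h
        push Not at h
        obtain ⟨a, ha, hva⟩ := h
        rw [mem_vs] at ha
        have hm := lineOf_maximal hG hH hv ha hva
        have hle : C ⊆ lineOf H v (cls G v a) := fun x hx => by
          rw [← hn x hx]; exact ⟨hv, .inl rfl⟩
        have : a ∈ C := hC.2 hm.1 hle ⟨ha, .inr (mem_cls.2 ⟨hva, .inl rfl⟩)⟩
        exact hva.ne (hn a this)
      obtain ⟨a, ha, hva⟩ := this
      exact ⟨_, ⟨a, ⟨hC.1.1 ha, (hC.1.2 v hvC a ha hva).adj_sub⟩, rfl⟩,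
        (eq_lineOf hG hH hC hvC ha hva).symm⟩
    · rintro ⟨_, ⟨a, ⟨ha, hva⟩, rfl⟩, rfl⟩
      exact ⟨lineOf_maximal hG hH hv ha hva, hv, .inl rfl⟩
  rw [cdeg, himg, Set.InjOn.ncard_image, Set.ncard_coe_finset, deg]
  intro L hL L' hL' he
  simp only [Finset.mem_coe, Finset.mem_image, mem_nbrs, mem_vs] at hL hL'
  obtain ⟨a, ⟨ha, hva⟩, rfl⟩ := hL
  obtain ⟨b, ⟨hb, hvb⟩, rfl⟩ := hL'
  have : a ∈ lineOf H v (cls G v b) := by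
    rw [← he]; exact ⟨ha, .inr (mem_cls.2 ⟨hva, .inl rfl⟩)⟩
  rcases this.2 with h | h
  · exact absurd h hva.ne'
  · rw [mem_cls] at h
    exact (cls_eq_iff hG hva hvb).2 (h.2.imp id fun h => h.symm)

theorem IsFreeVertex.deg_le_one (hG : CycleClosed G) (hH : H.IsInduced) (h : IsFreeVertex H v) :
    deg G (vs H) v ≤ 1 := by
  by_contra hn
  have := cdeg_eq_deg hG hH h.1 (by omega)
  have := h.2
  omega

theorem isFreeVertex_of_deg_eq_one (hG : CycleClosed G) (hH : H.IsInduced) (hv : v ∈ H.verts)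
    (h : deg G (vs H) v = 1) : IsFreeVertex H v :=
  ⟨hv, (cdeg_eq_deg hG hH hv h.ge).trans h⟩

end Blocks

/-! ### Removing endblocks, and decompositions -/

section Pruning

variable {V : Type u} [Fintype V] [DecidableEq V]
variable {G : SimpleGraph V} {r : V → ℕ} {H B : G.Subgraph} {W W' : Finset V} {v w a b : V}

/-- `W'` arises from `W` by removing `v` and the endblocks at `v`, of which there are at least
two: the removed vertices other than `v` lie in one block only and have no neighbours in `W'`, and
two of them lie in different blocks at `v`. -/
structure IsPruning (G : SimpleGraph V) (W : Finset V) (v : V) (W' : Finset V) : Prop where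
  mem : v ∈ W
  subset : W' ⊆ W.erase v
  deg_le : ∀ w ∈ W, w ≠ v → w ∉ W' → deg G W w ≤ 1
  not_adj : ∀ w ∈ W, w ≠ v → w ∉ W' → ∀ x ∈ W', ¬ G.Adj w x
  two : ∃ a ∈ W, ∃ b ∈ W, a ∉ W' ∧ b ∉ W' ∧ G.Adj v a ∧ G.Adj v b ∧ a ≠ b ∧ ¬ G.Adj a b

theorem IsPruning.two_le_deg (hG : CycleClosed G) (h : IsPruning G W v W') :
    2 ≤ deg G W v := by
  obtain ⟨a, ha, b, hb, -, -, hva, hvb, hab⟩ := h.two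
  exact (two_le_deg_iff hG).2 ⟨a, ha, b, hb, hva, hvb, hab⟩

theorem vs_removeEndblocks : w ∈ vs (removeEndblocks H v) ↔
    w ∈ vs H ∧ w ≠ v ∧ ∀ B ∈ endblocksAt H v, w ∉ B.verts := by
  simp [mem_vs, removeEndblocks]

theorem isInduced_removeEndblocks (hH : H.IsInduced) : (removeEndblocks H v).IsInduced :=
  isInduced_deleteVerts hH _

theorem isPruning_removeEndblocks (hB : IsBlockGraph (⊤ : G.Subgraph)) (hr : IsPerfectRank G r)
    (hH : H.IsInduced) (hv : v ∈ H.verts) (h2 : 2 ≤ (endblocksAt H v).ncard) :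
    IsPruning G (vs H) v (vs (removeEndblocks H v)) := by
  have hG := hB.cycleClosed
  have htwo : ∃ a ∈ vs H, ∃ b ∈ vs H, a ∉ vs (removeEndblocks H v) ∧
      b ∉ vs (removeEndblocks H v) ∧ G.Adj v a ∧ G.Adj v b ∧ a ≠ b ∧ ¬ G.Adj a b := by
    obtain ⟨B, hBe, C, hCe, hBC⟩ := (Set.one_lt_ncard (Set.toFinite _)).1 (by omega :
      1 < (endblocksAt H v).ncard)
    obtain ⟨hBm, hBi⟩ := hBe.1.1.maximal hB hr hH
    obtain ⟨hCm, hCi⟩ := hCe.1.1.maximal hB hr hH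
    have hBC' : ¬ B.verts ⊆ C.verts := fun h =>
      hBC (hBe.1.1.eq_of_le hCe.1.1.1 (IsInduced.le_of_verts_subset hCi h))
    have hCB' : ¬ C.verts ⊆ B.verts := fun h =>
      hBC (hCe.1.1.eq_of_le hBe.1.1.1 (IsInduced.le_of_verts_subset hBi h)).symm
    obtain ⟨a, haB, haC⟩ := Set.not_subset.1 hBC'
    obtain ⟨b, hbC, hbB⟩ := Set.not_subset.1 hCB'
    have hva : v ≠ a := fun h => haC (h ▸ hCe.2)
    have hvb : v ≠ b := fun h => hbB (h ▸ hBe.2)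
    have hadja := (hBm.1.2 v hBe.2 a haB hva).adj_sub
    have hadjb := (hCm.1.2 v hCe.2 b hbC hvb).adj_sub
    refine ⟨a, mem_vs.2 (hBm.1.1 haB), b, mem_vs.2 (hCm.1.1 hbC), ?_, ?_, hadja, hadjb,
      fun h => haC (h ▸ hbC), fun h => ?_⟩
    · rw [vs_removeEndblocks]
      exact fun h => h.2.2 B hBe haB
    · rw [vs_removeEndblocks]
      exact fun h => h.2.2 C hCe hbC
    · refine haC ?_
      rw [eq_lineOf hG hH hCm hCe.2 hbC hvb]
      exact ⟨hBm.1.1 haB, .inr (mem_cls.2 ⟨hadja, .inr h.symm⟩)⟩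
  have hcut : IsCutpoint H v := by
    obtain ⟨a, ha, b, hb, -, -, hva, hvb, hab⟩ := htwo
    exact (isCutpoint_iff hG hr hH).2 ⟨hv, (two_le_deg_iff hG).2 ⟨a, ha, b, hb, hva, hvb, hab⟩⟩
  have hrem : ∀ w ∈ vs H, w ≠ v → w ∉ vs (removeEndblocks H v) →
      ∃ B ∈ endblocksAt H v, w ∈ B.verts := by
    intro w hw hwv hn
    rw [vs_removeEndblocks] at hn
    push Not at hn
    exact hn hw hwv
  have hdeg : ∀ w ∈ vs H, w ≠ v → w ∉ vs (removeEndblocks H v) → deg G (vs H) w ≤ 1 := by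
    intro w hw hwv hn
    obtain ⟨B, hBe, hwB⟩ := hrem w hw hwv hn
    by_contra hlt
    refine hwv (hBe.1.2.unique ⟨hwB, ?_⟩ ⟨hBe.2, hcut⟩)
    exact (isCutpoint_iff hG hr hH).2 ⟨mem_vs.1 hw, by omega⟩
  refine ⟨mem_vs.2 hv, ?_, hdeg, ?_, htwo⟩
  · intro w hw
    rw [vs_removeEndblocks] at hw
    exact Finset.mem_erase.2 ⟨hw.2.1, hw.1⟩
  · intro w hw hwv hn x hx hadj
    obtain ⟨B, hBe, hwB⟩ := hrem w hw hwv hn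
    rw [vs_removeEndblocks] at hx
    refine hx.2.2 B hBe ?_
    obtain ⟨hBm, -⟩ := hBe.1.1.maximal hB hr hH
    rw [eq_lineOf hG hH hBm hBe.2 hwB hwv.symm]
    have hvw := (hBm.1.2 v hBe.2 w hwB hwv.symm).adj_sub
    refine ⟨mem_vs.1 hx.1, .inr (mem_cls.2 ⟨?_, .inr hadj⟩)⟩
    exact adj_of_deg_le_one hG (hdeg w hw hwv hn) (mem_vs.2 hv) hx.1 hvw.symm hadj hx.2.1.symm

/-- If no vertex of rank above that of `v` lies in more than one block, then every block at `v` is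
an endblock, except possibly the one that contains neighbours of lower rank. -/
theorem two_le_ncard_endblocksAt (hB : IsBlockGraph (⊤ : G.Subgraph)) (hr : IsPerfectRank G r)
    (hH : H.IsInduced) (hv : v ∈ H.verts) (h3 : 3 ≤ deg G (vs H) v)
    (hmax : ∀ x ∈ vs H, 2 ≤ deg G (vs H) x → r x ≤ r v) : 2 ≤ (endblocksAt H v).ncard := by
  have hG := hB.cycleClosed
  -- the classes at `v` without vertices of lower rank
  set S := ((nbrs G (vs H) v).image (cls G v)).filter fun L => ∀ x ∈ L, x ∈ vs H → r v < r x
    with hS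
  have hcard : 2 ≤ S.card := by
    have h1 := Finset.card_filter_add_card_filter_not (s := (nbrs G (vs H) v).image (cls G v))
      (fun L => ∀ x ∈ L, x ∈ vs H → r v < r x)
    have h2 : (((nbrs G (vs H) v).image (cls G v)).filter
        fun L => ¬ ∀ x ∈ L, x ∈ vs H → r v < r x).card ≤ 1 := by
      rw [Finset.card_le_one]
      intro L hL L' hL'
      simp only [Finset.mem_filter, Finset.mem_image, mem_nbrs] at hL hL'
      obtain ⟨⟨a, ha, rfl⟩, hL⟩ := hL
      obtain ⟨⟨b, hb, rfl⟩, hL'⟩ := hL'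
      push Not at hL hL'
      obtain ⟨x, hx, hxH, hxv⟩ := hL
      obtain ⟨y, hy, hyH, hyv⟩ := hL'
      rw [mem_cls] at hx hy
      rw [← (cls_eq_iff hG hx.1 ha.2).2 (hx.2.imp id fun h => h.symm),
        ← (cls_eq_iff hG hy.1 hb.2).2 (hy.2.imp id fun h => h.symm), cls_eq_iff hG hx.1 hy.1]
      by_cases hxy : x = y
      · exact .inl hxy
      · have h1 : r x ≠ r v := fun h => hx.1.ne (hr.inj h).symm
        have h2 : r y ≠ r v := fun h => hy.1.ne (hr.inj h).symm
        exact .inr (hr.clique v x y hx.1 hy.1 hxy (by omega) (by omega))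
    rw [deg] at h3
    rw [← hS] at h1
    omega
  have hsub : (fun L => (⊤ : G.Subgraph).induce (lineOf H v L)) '' (S : Set (Finset V)) ⊆
      endblocksAt H v := by
    rintro _ ⟨L, hL, rfl⟩
    simp only [hS, Finset.mem_coe, Finset.mem_filter, Finset.mem_image, mem_nbrs, mem_vs] at hL
    obtain ⟨⟨a, ⟨ha, hva⟩, rfl⟩, hL⟩ := hL
    have hvm : v ∈ lineOf H v (cls G v a) := ⟨hv, .inl rfl⟩
    refine ⟨⟨isBlock_of_maximal hB hr hH (lineOf_maximal hG hH hv ha hva) ⟨v, hvm⟩, v,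
      ⟨hvm, (isCutpoint_iff hG hr hH).2 ⟨hv, by omega⟩⟩, ?_⟩, hvm⟩
    rintro w ⟨hw, hwc⟩
    rw [isCutpoint_iff hG hr hH] at hwc
    rcases hw.2 with h | h
    · exact h
    · have h1 := hL w h hwc.1
      have h2 := hmax w (mem_vs.2 hwc.1) hwc.2
      omega
  refine le_trans ?_ (Set.ncard_le_ncard hsub (Set.toFinite _))
  rw [Set.InjOn.ncard_image, Set.ncard_coe_finset]
  · exact hcard
  · intro L hL L' hL' he
    simp only [hS, Finset.mem_coe, Finset.mem_filter, Finset.mem_image, mem_nbrs, mem_vs] at hL hL'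
    obtain ⟨⟨a, ⟨ha, hva⟩, rfl⟩, -⟩ := hL
    obtain ⟨⟨b, ⟨hb, hvb⟩, rfl⟩, -⟩ := hL'
    have : a ∈ lineOf H v (cls G v b) := by
      have h1 : a ∈ lineOf H v (cls G v a) := ⟨ha, .inr (mem_cls.2 ⟨hva, .inl rfl⟩)⟩
      have h2 : lineOf H v (cls G v a) = lineOf H v (cls G v b) :=
        congrArg SimpleGraph.Subgraph.verts he
      exact h2 ▸ h1
    rcases this.2 with h | h
    · exact absurd h hva.ne'
    · rw [mem_cls] at h
      exact (cls_eq_iff hG hva hvb).2 (h.2.imp id fun h => h.symm)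

/-- Among the vertices of `W` lying in at least two blocks there is one of maximal rank. -/
theorem exists_maxRank (h : ∃ v ∈ W, 2 ≤ deg G W v) (r : V → ℕ) :
    ∃ v ∈ W, 2 ≤ deg G W v ∧ ∀ x ∈ W, 2 ≤ deg G W x → r x ≤ r v := by
  obtain ⟨v, hv, hd⟩ := h
  obtain ⟨m, hm, hmax⟩ := Finset.exists_max_image (W.filter fun v => 2 ≤ deg G W v) r
    ⟨v, Finset.mem_filter.2 ⟨hv, hd⟩⟩
  rw [Finset.mem_filter] at hm
  exact ⟨m, hm.1, hm.2, fun x hx hd => hmax x (Finset.mem_filter.2 ⟨hx, hd⟩)⟩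

/-- `G[W]` is glued from `G[A]` and `G[B]` along the vertex `u`, which lies in at most one block of
each of them. -/
structure IsGlueOf (G : SimpleGraph V) (W A B : Finset V) (u : V) : Prop where
  union : W = A ∪ B
  inter : A ∩ B = {u}
  not_adj : ∀ a ∈ A, ∀ b ∈ B, a ≠ u → b ≠ u → ¬ G.Adj a b
  deg_left : deg G A u ≤ 1
  deg_right : deg G B u ≤ 1

theorem vs_sup {H₁ H₂ : G.Subgraph} : vs (H₁ ⊔ H₂) = vs H₁ ∪ vs H₂ := by
  ext; simp [mem_vs]

theorem isInduced_of_sup {H₁ H₂ : G.Subgraph} (hH : (H₁ ⊔ H₂).IsInduced)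
    (h : (H₁.verts ∩ H₂.verts).Subsingleton) : H₁.IsInduced ∧ H₂.IsInduced := by
  constructor
  · intro a ha b hb hab
    rcases hH (.inl ha) (.inl hb) hab with h' | h'
    · exact h'
    · exact absurd (h ⟨ha, H₂.edge_vert h'⟩ ⟨hb, H₂.edge_vert h'.symm⟩) hab.ne
  · intro a ha b hb hab
    rcases hH (.inr ha) (.inr hb) hab with h' | h'
    · exact absurd (h ⟨H₁.edge_vert h', ha⟩ ⟨H₁.edge_vert h'.symm, hb⟩) hab.ne
    · exact h'

theorem IsGluing.isGlueOf (hG : CycleClosed G) (hH : H.IsInduced) {H₁ H₂ : G.Subgraph}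
    (h : IsGluing H H₁ H₂) :
    H₁.IsInduced ∧ H₂.IsInduced ∧ ∃ u, IsGlueOf G (vs H) (vs H₁) (vs H₂) u := by
  obtain ⟨rfl, -, -, u, hu, h1, h2⟩ := h
  obtain ⟨hi1, hi2⟩ := isInduced_of_sup hH (hu ▸ Set.subsingleton_singleton)
  have hmem : ∀ x, x ∈ H₁.verts → x ∈ H₂.verts → x = u := fun x hx hx' =>
    Set.mem_singleton_iff.1 (hu ▸ (⟨hx, hx'⟩ : x ∈ H₁.verts ∩ H₂.verts))
  refine ⟨hi1, hi2, u, vs_sup, ?_, ?_, h1.deg_le_one hG hi1, h2.deg_le_one hG hi2⟩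
  · apply Finset.coe_injective
    rw [Finset.coe_inter, coe_vs, coe_vs, hu, Finset.coe_singleton]
  · intro a ha b hb hau hbu hab
    rw [mem_vs] at ha hb
    rcases hH (.inl ha) (.inr hb) hab with h' | h'
    · exact hbu (hmem b (H₁.edge_vert h'.symm) hb)
    · exact hau (hmem a ha (H₂.edge_vert h'))

theorem not_adj_of_disjoint {H₁ H₂ : G.Subgraph} (hH : (H₁ ⊔ H₂).IsInduced)
    (hd : Disjoint H₁.verts H₂.verts) : ∀ a ∈ vs H₁, ∀ b ∈ vs H₂, ¬ G.Adj a b := by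
  intro a ha b hb hab
  rw [mem_vs] at ha hb
  rcases hH (.inl ha) (.inr hb) hab with h' | h'
  · exact Set.disjoint_left.1 hd (H₁.edge_vert h'.symm) hb
  · exact Set.disjoint_left.1 hd ha (H₂.edge_vert h')

theorem disjoint_vs {H₁ H₂ : G.Subgraph} (hd : Disjoint H₁.verts H₂.verts) :
    Disjoint (vs H₁) (vs H₂) := by
  rw [Finset.disjoint_left]
  intro x hx hx'
  rw [mem_vs] at hx hx'
  exact Set.disjoint_left.1 hd hx hx'

/-- A connected graph decomposes at every vertex lying in exactly two blocks. -/
theorem isDecomposable_of_deg_eq_two (hG : CycleClosed G) (hH : H.IsInduced)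
    (hv : v ∈ H.verts) (h2 : deg G (vs H) v = 2) : IsDecomposable H := by
  obtain ⟨a, ha, b, hb, hva, hvb, hab, hn⟩ := (two_le_deg_iff hG).1 h2.ge
  rw [mem_vs] at ha hb
  -- the vertices joined to `a` by a walk in `H` avoiding `v`
  set S : Set V := {x | ∃ p : G.Walk a x, ∀ y ∈ p.support, y ∈ H.verts ∧ y ≠ v} with hS
  have haS : a ∈ S := ⟨.nil, by simp [ha, hva.ne']⟩
  have hvS : v ∉ S := fun ⟨p, hp⟩ => (hp v p.end_mem_support).2 rfl
  have hSH : S ⊆ H.verts := fun x ⟨p, hp⟩ => (hp x p.end_mem_support).1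
  have hstep : ∀ x ∈ S, ∀ y ∈ H.verts, y ≠ v → G.Adj x y → y ∈ S := by
    rintro x ⟨p, hp⟩ y hy hyv hxy
    refine ⟨p.concat hxy, fun z hz => ?_⟩
    rw [SimpleGraph.Walk.support_concat, List.mem_append, List.mem_singleton] at hz
    rcases hz with hz | rfl
    · exact hp z hz
    · exact ⟨hy, hyv⟩
  have hSa : ∀ x ∈ S, G.Adj v x → x = a ∨ G.Adj x a := by
    rintro x ⟨p, hp⟩ hvx
    by_cases hxa : x = a
    · exact .inl hxa
    · exact .inr (hG v a x hva hvx (Ne.symm hxa) p fun h => (hp v h).2 rfl).symm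
  have hbS : b ∉ S := fun h => by
    rcases hSa b h hvb with h | h
    · exact hab h.symm
    · exact hn h.symm
  have hi1 := isInduced_induce_top (G := G) (insert v S)
  have hi2 := isInduced_induce_top (G := G) (H.verts \ S)
  refine ⟨(⊤ : G.Subgraph).induce (insert v S), (⊤ : G.Subgraph).induce (H.verts \ S), ?_, ?_, ?_,
    v, ?_, ?_, ?_⟩
  · refine le_antisymm ?_ (sup_le (IsInduced.le_of_verts_subset hH
      (Set.insert_subset hv hSH)) (IsInduced.le_of_verts_subset hH Set.sdiff_subset))
    constructor
    · intro x hx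
      by_cases hxS : x ∈ S
      · exact .inl (.inr hxS)
      · exact .inr ⟨hx, hxS⟩
    · intro x y hxy
      have hx := H.edge_vert hxy
      have hy := H.edge_vert hxy.symm
      have hadj := hxy.adj_sub
      by_cases hxS : x ∈ S <;> by_cases hyS : y ∈ S
      · exact .inl (hi1 (.inr hxS) (.inr hyS) hadj)
      · by_cases hyv : y = v
        · exact .inl (hi1 (.inr hxS) (.inl hyv) hadj)
        · exact absurd (hstep x hxS y hy hyv hadj) hyS
      · by_cases hxv : x = v
        · exact .inl (hi1 (.inl hxv) (.inr hyS) hadj)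
        · exact absurd (hstep y hyS x hx hxv hadj.symm) hxS
      · exact .inr (hi2 ⟨hx, hxS⟩ ⟨hy, hyS⟩ hadj)
  · intro h
    have : b ∈ insert v S := by
      have h' := congrArg SimpleGraph.Subgraph.verts h
      exact h'.ge hb
    rcases this with h | h
    · exact hvb.ne h.symm
    · exact hbS h
  · intro h
    have : a ∈ H.verts \ S := by
      have h' := congrArg SimpleGraph.Subgraph.verts h
      exact h'.ge ha
    exact this.2 haS
  · ext x
    simp only [SimpleGraph.Subgraph.induce_verts, Set.mem_inter_iff, Set.mem_insert_iff,
      Set.mem_sdiff, Set.mem_singleton_iff]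
    constructor
    · rintro ⟨h | h, h'⟩
      · exact h
      · exact absurd h h'.2
    · rintro rfl
      exact ⟨.inl rfl, hv, hvS⟩
  · refine isFreeVertex_of_deg_eq_one hG hi1 (.inl rfl) ?_
    have h1 : deg G (vs ((⊤ : G.Subgraph).induce (insert v S))) v ≠ 0 := by
      rw [ne_eq, deg_eq_zero_iff]
      push Not
      exact ⟨a, mem_vs.2 (.inr haS), hva⟩
    have h3 : ¬ 2 ≤ deg G (vs ((⊤ : G.Subgraph).induce (insert v S))) v := by
      rw [two_le_deg_iff hG]
      rintro ⟨x, hx, y, hy, hvx, hvy, hxy, hnxy⟩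
      have hxS := (mem_vs.1 hx).resolve_left hvx.ne'
      have hyS := (mem_vs.1 hy).resolve_left hvy.ne'
      have e1 := (cls_eq_iff hG hvx hva).2 (hSa x hxS hvx)
      have e2 := (cls_eq_iff hG hvy hva).2 (hSa y hyS hvy)
      rcases (cls_eq_iff hG hvx hvy).1 (e1.trans e2.symm) with h | h
      · exact hxy h
      · exact hnxy h
    omega
  · refine isFreeVertex_of_deg_eq_one hG hi2 ⟨hv, hvS⟩ ?_
    have h1 : deg G (vs ((⊤ : G.Subgraph).induce (H.verts \ S))) v ≠ 0 := by
      rw [ne_eq, deg_eq_zero_iff]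
      push Not
      exact ⟨b, mem_vs.2 ⟨hb, hbS⟩, hvb⟩
    -- the class of `a` is lost, and so at most one class remains
    have h3 : deg G (vs ((⊤ : G.Subgraph).induce (H.verts \ S))) v < deg G (vs H) v := by
      refine Finset.card_lt_card ((Finset.ssubset_iff_of_subset ?_).2 ⟨cls G v a, ?_, ?_⟩)
      · refine Finset.image_subset_image fun x hx => ?_
        rw [mem_nbrs, mem_vs] at hx ⊢
        exact ⟨hx.1.1, hx.2⟩
      · exact Finset.mem_image_of_mem _ (mem_nbrs.2 ⟨mem_vs.2 ha, hva⟩)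
      · rw [Finset.mem_image]
        rintro ⟨x, hx, he⟩
        rw [mem_nbrs, mem_vs] at hx
        rcases (cls_eq_iff hG hx.2 hva).1 he with h | h
        · exact hx.1.2 (h ▸ haS)
        · exact hx.1.2 (hstep a haS x hx.1.1 hx.2.ne' h.symm)
    omega

theorem exists_decomposesInto (H : G.Subgraph) : ∃ I, DecomposesInto H I := by
  induction hk : (vs H).card using Nat.strong_induction_on generalizing H with
  | _ k ih =>
    have ih' : ∀ H' : G.Subgraph, H'.verts ⊂ H.verts → ∃ I, DecomposesInto H' I := by
      intro H' hlt
      refine ih _ (hk ▸ Finset.card_lt_card ?_) H' rfl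
      rw [← Finset.coe_ssubset, coe_vs, coe_vs]
      exact hlt
    by_cases hc : H.Connected
    · by_cases hd : IsDecomposable H
      · obtain ⟨H₁, H₂, hg⟩ := hd
        have key : ∀ H₁ H₂ : G.Subgraph, H = H₁ ⊔ H₂ → H₁ ≠ H →
            ∀ v, H₁.verts ∩ H₂.verts = {v} → H₁.verts ⊂ H.verts := by
          intro H₁ H₂ he hne v hv
          have hle : H₁ ≤ H := he ▸ le_sup_left
          refine hle.1.ssubset_of_ne fun heq => hne (le_antisymm hle ⟨heq.ge, fun x y hxy => ?_⟩)
          rw [he] at hxy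
          rcases hxy with h | h
          · exact h
          · have h2 : H₂ ≤ H := he ▸ le_sup_right
            have hx : x ∈ H₁.verts ∩ H₂.verts := ⟨heq.ge (h2.1 (H₂.edge_vert h)), H₂.edge_vert h⟩
            have hy : y ∈ H₁.verts ∩ H₂.verts :=
              ⟨heq.ge (h2.1 (H₂.edge_vert h.symm)), H₂.edge_vert h.symm⟩
            rw [hv] at hx hy
            exact absurd (hx.trans hy.symm) h.adj_sub.ne
        have hg' := hg
        obtain ⟨he, hn1, hn2, v, hv, -, -⟩ := hg
        obtain ⟨I₁, h1⟩ := ih' H₁ (key H₁ H₂ he hn1 v hv)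
        obtain ⟨I₂, h2⟩ := ih' H₂ (key H₂ H₁ (he.trans (sup_comm _ _)) hn2 v
          ((Set.inter_comm _ _).trans hv))
        exact ⟨_, .glue H H₁ H₂ I₁ I₂ hc hg' h1 h2⟩
      · exact ⟨_, .indecomposable H hc hd⟩
    · by_cases hne : H.verts.Nonempty
      · have hpre : ¬ H.coe.Preconnected := fun h =>
          hc (SimpleGraph.Subgraph.connected_iff.2 ⟨⟨h⟩, hne⟩)
        rw [SimpleGraph.Preconnected] at hpre
        push Not at hpre
        obtain ⟨x, y, hxy⟩ := hpre
        set S : Set V := {z | ∃ hz : z ∈ H.verts, H.coe.Reachable x ⟨z, hz⟩} with hS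
        have hadj : ∀ a b, H.Adj a b → a ∈ S → b ∈ S := fun a b hab ⟨ha, h⟩ =>
          ⟨H.edge_vert hab.symm, h.trans (SimpleGraph.Adj.reachable (by exact hab))⟩
        have hxS : (x : V) ∈ S := ⟨x.2, .rfl⟩
        have hyS : (y : V) ∉ S := fun ⟨_, h⟩ => hxy h
        obtain ⟨I₁, h1⟩ := ih' (H.induce S) (by
          refine ⟨fun z hz => hz.1, fun h => hyS (h y.2)⟩)
        obtain ⟨I₂, h2⟩ := ih' (H.deleteVerts S) (by
          refine ⟨fun z hz => hz.1, fun h => (h x.2).2 hxS⟩)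
        refine ⟨_, .disjoint H _ _ I₁ I₂ ?_ ?_ h1 h2⟩
        · refine le_antisymm ?_ (sup_le ?_ SimpleGraph.Subgraph.deleteVerts_le)
          rotate_left
          · constructor
            · rintro z ⟨hz, -⟩
              exact hz
            · exact fun a b hab => hab.2.2
          constructor
          · intro z hz
            by_cases hzS : z ∈ S
            · exact .inl hzS
            · exact .inr ⟨hz, hzS⟩
          · intro a b hab
            by_cases haS : a ∈ S
            · exact .inl ⟨haS, hadj a b hab haS, hab⟩
            · refine .inr ?_
              rw [SimpleGraph.Subgraph.deleteVerts_adj]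
              exact ⟨H.edge_vert hab, haS, H.edge_vert hab.symm,
                fun h => haS (hadj b a hab.symm h), hab⟩
        · exact Set.disjoint_left.2 fun z hz hz' => hz'.2 hz
      · have : H = ⊥ := by
          rw [Set.not_nonempty_iff_eq_empty] at hne
          refine le_antisymm ?_ bot_le
          refine ⟨hne.le, fun a b hab => ?_⟩
          exact absurd (H.edge_vert hab) (by rw [hne]; exact fun h => h)
        exact ⟨0, this ▸ .empty⟩

end Pruning

/-! ### The maximal gain of components -/

section Excess

variable {V : Type u} [Fintype V] [DecidableEq V]
variable {G : SimpleGraph V} {r : V → ℕ} {H : G.Subgraph} {W W' A B T : Finset V} {u v : V}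

/-- The number of components gained by removing `T` from `G[W]`, diminished by the size of `T`. -/
noncomputable def gain (G : SimpleGraph V) (r : V → ℕ) (W T : Finset V) : ℤ :=
  comp G r (W \ T) - T.card - comp G r W

/-- The maximum of `gain` over all sets of vertices of `G[W]`. -/
noncomputable def excess (G : SimpleGraph V) (r : V → ℕ) (W : Finset V) : ℤ :=
  W.powerset.sup' ⟨∅, Finset.empty_mem_powerset W⟩ (gain G r W)

/-- The number of vertices minus the number of components, that is, the number of edges of a
spanning forest. It is additive for decompositions and serves to prove termination. -/
noncomputable def rank (G : SimpleGraph V) (r : V → ℕ) (W : Finset V) : ℕ :=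
  W.card - comp G r W

theorem gain_le_excess (hT : T ⊆ W) : gain G r W T ≤ excess G r W :=
  Finset.le_sup' (gain G r W) (Finset.mem_powerset.2 hT)

theorem gain_empty : gain G r W ∅ = 0 := by simp [gain]

/-- Removing a vertex in at most two blocks does not pay. -/
theorem gain_le_gain_erase (hG : CycleClosed G) (hr : IsPerfectRank G r) (hT : T ⊆ W) (hv : v ∈ T)
    (h2 : deg G W v ≤ 2) : gain G r W T ≤ gain G r W (T.erase v) := by
  have h1 : W \ T = (W \ T.erase v).erase v := by
    ext x
    simp only [Finset.mem_sdiff, Finset.mem_erase]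
    by_cases hxv : x = v
    · subst hxv; tauto
    · tauto
  have h3 := comp_erase hG hr (W := W \ T.erase v) (v := v) (by simp [hT hv])
  have h4 := (deg_mono (G := G) (Finset.sdiff_subset : W \ T.erase v ⊆ W) v).trans h2
  have h5 := Finset.card_erase_add_one hv
  unfold gain
  rw [h1]
  omega

/-- For an upper bound on the excess only sets of vertices lying in at least three blocks matter,
as the other vertices can be left out one by one. -/
theorem excess_le_of_core (hG : CycleClosed G) (hr : IsPerfectRank G r) {c : ℤ}
    (h : ∀ T ⊆ W, (∀ t ∈ T, 3 ≤ deg G W t) → gain G r W T ≤ c) : excess G r W ≤ c := by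
  refine Finset.sup'_le _ _ fun T hT => ?_
  rw [Finset.mem_powerset] at hT
  induction hk : T.card using Nat.strong_induction_on generalizing T with
  | _ k ih =>
    by_cases hc : ∀ t ∈ T, 3 ≤ deg G W t
    · exact h T hT hc
    · push Not at hc
      obtain ⟨t, ht, hlt⟩ := hc
      refine (gain_le_gain_erase hG hr hT ht (by omega)).trans
        (ih _ ?_ _ ((Finset.erase_subset t T).trans hT) rfl)
      rw [← hk]
      exact Finset.card_erase_lt_of_mem ht

theorem excess_nonpos (hG : CycleClosed G) (hr : IsPerfectRank G r)
    (h : ∀ v ∈ W, deg G W v ≤ 1) : excess G r W ≤ 0 := by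
  refine excess_le_of_core hG hr fun T hT hc => ?_
  have : T = ∅ := Finset.eq_empty_of_forall_notMem fun t ht => by
    have := hc t ht
    have := h t (hT ht)
    omega
  rw [this, gain_empty]

theorem excess_union (hd : Disjoint A B)
    (hE : ∀ a ∈ A, ∀ b ∈ B, ¬ G.Adj a b) :
    excess G r (A ∪ B) ≤ excess G r A + excess G r B := by
  refine Finset.sup'_le _ _ fun T hT => ?_
  rw [Finset.mem_powerset] at hT
  have h1 : (A ∪ B) \ T = (A \ (T ∩ A)) ∪ (B \ (T ∩ B)) := by
    rw [Finset.union_sdiff_distrib, Finset.sdiff_inter_self_right, Finset.sdiff_inter_self_right]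
  have h2 : comp G r ((A ∪ B) \ T) = comp G r (A \ (T ∩ A)) + comp G r (B \ (T ∩ B)) := by
    rw [h1]
    exact comp_union (hd.mono Finset.sdiff_subset Finset.sdiff_subset) fun a ha b hb =>
      hE a (Finset.sdiff_subset ha) b (Finset.sdiff_subset hb)
  have h3 : T.card = (T ∩ A).card + (T ∩ B).card := by
    rw [← Finset.card_union_of_disjoint (hd.mono Finset.inter_subset_right
      Finset.inter_subset_right), ← Finset.inter_union_distrib_left,
      Finset.inter_eq_left.2 hT]
  have h4 := comp_union (r := r) hd hE
  have h5 := gain_le_excess (G := G) (r := r) (Finset.inter_subset_right : T ∩ A ⊆ A)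
  have h6 := gain_le_excess (G := G) (r := r) (Finset.inter_subset_right : T ∩ B ⊆ B)
  unfold gain at h5 h6 ⊢
  omega

theorem IsGlueOf.mem_left (h : IsGlueOf G W A B u) : u ∈ A :=
  (Finset.mem_inter.1 (h.inter.ge (Finset.mem_singleton_self u))).1

theorem IsGlueOf.mem_right (h : IsGlueOf G W A B u) : u ∈ B :=
  (Finset.mem_inter.1 (h.inter.ge (Finset.mem_singleton_self u))).2

theorem IsGlueOf.eq_of_mem (h : IsGlueOf G W A B u) {x : V} (hA : x ∈ A) (hB : x ∈ B) : x = u :=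
  Finset.mem_singleton.1 (h.inter.le (Finset.mem_inter.2 ⟨hA, hB⟩))

theorem IsGlueOf.deg_le_two (h : IsGlueOf G W A B u) : deg G W u ≤ 2 := by
  have h1 := deg_union_le (G := G) (A := A) (B := B) (v := u)
  have h2 := h.deg_left
  have h3 := h.deg_right
  rw [h.union]
  omega

theorem IsGlueOf.nbrs_left (h : IsGlueOf G W A B u) {x : V} (hx : x ∈ A) (hxu : x ≠ u) :
    nbrs G A x = nbrs G W x := by
  ext y
  rw [mem_nbrs, mem_nbrs, h.union, Finset.mem_union]
  refine ⟨fun hy => ⟨.inl hy.1, hy.2⟩, fun hy => ⟨?_, hy.2⟩⟩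
  refine hy.1.elim id fun hyB => ?_
  by_cases hyu : y = u
  · exact hyu ▸ h.mem_left
  · exact absurd hy.2 (h.not_adj x hx y hyB hxu hyu)

theorem IsGlueOf.symm (h : IsGlueOf G W A B u) : IsGlueOf G W B A u :=
  ⟨h.union.trans (Finset.union_comm _ _), (Finset.inter_comm _ _).trans h.inter,
    fun a ha b hb hau hbu hab => h.not_adj b hb a ha hbu hau hab.symm, h.deg_right, h.deg_left⟩

theorem IsGlueOf.comp (hG : CycleClosed G) (hr : IsPerfectRank G r) (h : IsGlueOf G W A B u) :
    comp G r W + 1 = comp G r A + comp G r B := by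
  rw [h.union]
  exact comp_glue hG hr h.inter h.not_adj

/-- The excess is subadditive for gluings: the common vertex lies in at most two blocks, and so it
need not be removed. -/
theorem IsGlueOf.excess_le (hG : CycleClosed G) (hr : IsPerfectRank G r)
    (h : IsGlueOf G W A B u) : excess G r W ≤ excess G r A + excess G r B := by
  refine excess_le_of_core hG hr fun T hT hc => ?_
  have huT : u ∉ T := fun hu => by
    have := hc u hu
    have := h.deg_le_two
    omega
  have h1 : W \ T = (A \ (T ∩ A)) ∪ (B \ (T ∩ B)) := by
    rw [h.union, Finset.union_sdiff_distrib, Finset.sdiff_inter_self_right,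
      Finset.sdiff_inter_self_right]
  have h2 : BEI.comp G r (W \ T) + 1 =
      BEI.comp G r (A \ (T ∩ A)) + BEI.comp G r (B \ (T ∩ B)) := by
    rw [h1]
    refine comp_glue hG hr (u := u) ?_ fun a ha b hb =>
      h.not_adj a (Finset.sdiff_subset ha) b (Finset.sdiff_subset hb)
    ext x
    simp only [Finset.mem_inter, Finset.mem_sdiff, Finset.mem_singleton]
    constructor
    · exact fun hx => h.eq_of_mem hx.1.1 hx.2.1
    · rintro rfl
      exact ⟨⟨h.mem_left, fun h => huT h.1⟩, ⟨h.mem_right, fun h => huT h.1⟩⟩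
  have h3 : T.card = (T ∩ A).card + (T ∩ B).card := by
    rw [← Finset.card_union_of_disjoint, ← Finset.inter_union_distrib_left, ← h.union,
      Finset.inter_eq_left.2 hT]
    rw [Finset.disjoint_left]
    intro x hx hx'
    rw [Finset.mem_inter] at hx hx'
    exact huT (h.eq_of_mem hx.2 hx'.2 ▸ hx.1)
  have h4 := h.comp hG hr
  have h5 := gain_le_excess (G := G) (r := r) (Finset.inter_subset_right : T ∩ A ⊆ A)
  have h6 := gain_le_excess (G := G) (r := r) (Finset.inter_subset_right : T ∩ B ⊆ B)
  unfold gain at h5 h6 ⊢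
  omega

theorem IsGlueOf.rank (hG : CycleClosed G) (hr : IsPerfectRank G r)
    (h : IsGlueOf G W A B u) : rank G r W = rank G r A + rank G r B := by
  have h1 := h.comp hG hr
  have h2 := Finset.card_union_add_card_inter A B
  rw [h.inter, ← h.union, Finset.card_singleton] at h2
  have h3 := comp_le_card (G := G) (r := r) (W := A)
  have h4 := comp_le_card (G := G) (r := r) (W := B)
  have h5 := comp_le_card (G := G) (r := r) (W := W)
  unfold BEI.rank
  omega

theorem rank_union (hd : Disjoint A B) (hE : ∀ a ∈ A, ∀ b ∈ B, ¬ G.Adj a b) :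
    rank G r (A ∪ B) = rank G r A + rank G r B := by
  have h1 := comp_union (r := r) hd hE
  have h2 := Finset.card_union_of_disjoint hd
  have h3 := comp_le_card (G := G) (r := r) (W := A)
  have h4 := comp_le_card (G := G) (r := r) (W := B)
  unfold rank
  omega

theorem IsPruning.erase_eq (h : IsPruning G W v W') : W.erase v = W' ∪ (W.erase v \ W') :=
  (Finset.union_sdiff_of_subset h.subset).symm

theorem IsPruning.not_adj_removed (h : IsPruning G W v W') :
    ∀ a ∈ W', ∀ b ∈ W.erase v \ W', ¬ G.Adj a b := by
  intro a ha b hb hab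
  rw [Finset.mem_sdiff, Finset.mem_erase] at hb
  exact h.not_adj b hb.1.2 hb.1.1 hb.2 a ha hab.symm

theorem IsPruning.comp (hG : CycleClosed G) (hr : IsPerfectRank G r) (h : IsPruning G W v W') :
    comp G r W' + comp G r (W.erase v \ W') + 1 = comp G r W + deg G W v := by
  rw [← comp_erase hG hr h.mem, ← comp_union Finset.disjoint_sdiff h.not_adj_removed,
    ← h.erase_eq]

theorem IsPruning.rank_lt (hG : CycleClosed G) (hr : IsPerfectRank G r)
    (h : IsPruning G W v W') : rank G r W' < rank G r W := by
  have h1 := h.comp hG hr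
  have h2 := h.two_le_deg hG
  have h3 := comp_le_card (G := G) (r := r) (W := W')
  have h4 := comp_le_card (G := G) (r := r) (W := W.erase v \ W')
  have h5 := comp_le_card (G := G) (r := r) (W := W)
  have h6 := Finset.card_union_of_disjoint (s := W') (t := W.erase v \ W') Finset.disjoint_sdiff
  have h7 := Finset.card_erase_add_one h.mem
  rw [← h.erase_eq] at h6
  unfold rank
  omega

/-- A vertex in two endblocks may be assumed to lie in an optimal set: adding it to a set without
inner vertices of these endblocks increases the number of components. -/
theorem IsPruning.excess_le (hG : CycleClosed G) (hr : IsPerfectRank G r)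
    (h : IsPruning G W v W') : excess G r W ≤ deg G W v - 2 + excess G r W' := by
  refine excess_le_of_core hG hr fun T hT hc => ?_
  have hremoved : ∀ x ∈ W, x ≠ v → x ∉ W' → x ∉ T := fun x hx hxv hx' hxT => by
    have := hc x hxT
    have := h.deg_le x hx hxv hx'
    omega
  have h1 : gain G r W T ≤ gain G r W (insert v T) := by
    by_cases hv : v ∈ T
    · rw [Finset.insert_eq_of_mem hv]
    · have h2 := comp_erase hG hr (Finset.mem_sdiff.2 ⟨h.mem, hv⟩)
      have h3 : 2 ≤ deg G (W \ T) v := by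
        obtain ⟨a, ha, b, hb, ha', hb', hva, hvb, hab⟩ := h.two
        exact (two_le_deg_iff hG).2 ⟨a, Finset.mem_sdiff.2 ⟨ha, hremoved a ha hva.ne' ha'⟩, b,
          Finset.mem_sdiff.2 ⟨hb, hremoved b hb hvb.ne' hb'⟩, hva, hvb, hab⟩
      unfold gain
      rw [Finset.card_insert_of_notMem hv, Finset.sdiff_insert]
      push_cast
      omega
  have h2 : T.erase v ⊆ W' := by
    intro x hx
    rw [Finset.mem_erase] at hx
    by_contra hx'
    exact hremoved x (hT hx.2) hx.1 hx' hx.2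
  have h3 : W \ insert v T = (W' \ T.erase v) ∪ (W.erase v \ W') := by
    ext x
    simp only [Finset.mem_sdiff, Finset.mem_insert, Finset.mem_union, Finset.mem_erase, not_or]
    constructor
    · rintro ⟨hx, hxv, hxT⟩
      by_cases hx' : x ∈ W'
      · exact .inl ⟨hx', fun h => hxT h.2⟩
      · exact .inr ⟨⟨hxv, hx⟩, hx'⟩
    · rintro (⟨hx, hx'⟩ | ⟨⟨hxv, hx⟩, hx'⟩)
      · have := Finset.mem_erase.1 (h.subset hx)
        exact ⟨this.2, this.1, fun h => hx' ⟨this.1, h⟩⟩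
      · exact ⟨hx, hxv, hremoved x hx hxv hx'⟩
  have h4 : BEI.comp G r (W \ insert v T) =
      BEI.comp G r (W' \ T.erase v) + BEI.comp G r (W.erase v \ W') := by
    rw [h3]
    exact comp_union (Finset.disjoint_sdiff.mono_left Finset.sdiff_subset) fun a ha =>
      h.not_adj_removed a (Finset.sdiff_subset ha)
  have h5 := h.comp hG hr
  have h6 := gain_le_excess (G := G) (r := r) h2
  have h7 : (insert v T).card = (T.erase v).card + 1 := by
    rw [← Finset.card_erase_add_one (Finset.mem_insert_self v T), Finset.erase_insert_eq_erase]
  refine h1.trans ?_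
  unfold gain at h6 ⊢
  omega

/-- Induction along a decomposition of an induced subgraph. -/
theorem DecomposesInto.induced_induction (hG : CycleClosed G)
    {motive : G.Subgraph → Multiset G.Subgraph → Prop} (empty : motive ⊥ 0)
    (indecomposable : ∀ H : G.Subgraph, H.IsInduced → H.Connected → ¬ IsDecomposable H →
      motive H {H})
    (glue : ∀ (H H₁ H₂ : G.Subgraph) (I₁ I₂ : Multiset G.Subgraph) (u : V),
      IsGlueOf G (vs H) (vs H₁) (vs H₂) u → motive H₁ I₁ → motive H₂ I₂ → motive H (I₁ + I₂))
    (disjoint : ∀ (H H₁ H₂ : G.Subgraph) (I₁ I₂ : Multiset G.Subgraph),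
      vs H = vs H₁ ∪ vs H₂ → Disjoint (vs H₁) (vs H₂) →
      (∀ a ∈ vs H₁, ∀ b ∈ vs H₂, ¬ G.Adj a b) → motive H₁ I₁ → motive H₂ I₂ → motive H (I₁ + I₂))
    {H : G.Subgraph} {I : Multiset G.Subgraph} (h : DecomposesInto H I) (hH : H.IsInduced) :
    motive H I := by
  induction h with
  | empty => exact empty
  | indecomposable H hc hi => exact indecomposable H hH hc hi
  | glue H H₁ H₂ I₁ I₂ hc hg h₁ h₂ ih₁ ih₂ =>
    obtain ⟨hi1, hi2, u, hu⟩ := hg.isGlueOf hG hH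
    exact glue H H₁ H₂ I₁ I₂ u hu (ih₁ hi1) (ih₂ hi2)
  | disjoint H H₁ H₂ I₁ I₂ hu hd h₁ h₂ ih₁ ih₂ =>
    subst hu
    obtain ⟨hi1, hi2⟩ := isInduced_of_sup hH (by
      rw [Set.disjoint_iff_inter_eq_empty.1 hd]; exact Set.subsingleton_empty)
    exact disjoint _ H₁ H₂ I₁ I₂ vs_sup (disjoint_vs hd) (not_adj_of_disjoint hH hd)
      (ih₁ hi1) (ih₂ hi2)

theorem DecomposesInto.parts (hG : CycleClosed G) {I : Multiset G.Subgraph}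
    (h : DecomposesInto H I) (hH : H.IsInduced) :
    ∀ P ∈ I, P.IsInduced ∧ P.Connected ∧ ¬ IsDecomposable P ∧ vs P ⊆ vs H := by
  refine h.induced_induction (motive := fun H I => ∀ P ∈ I, P.IsInduced ∧ P.Connected ∧
    ¬ IsDecomposable P ∧ vs P ⊆ vs H) hG ?_ ?_ ?_ ?_ hH
  · simp
  · intro H hH hc hi P hP
    rw [Multiset.mem_singleton] at hP
    subst hP
    exact ⟨hH, hc, hi, subset_rfl⟩
  · intro H H₁ H₂ I₁ I₂ u hu h1 h2 P hP
    rw [hu.union]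
    rcases Multiset.mem_add.1 hP with hP | hP
    · obtain ⟨a, b, c, d⟩ := h1 P hP
      exact ⟨a, b, c, d.trans Finset.subset_union_left⟩
    · obtain ⟨a, b, c, d⟩ := h2 P hP
      exact ⟨a, b, c, d.trans Finset.subset_union_right⟩
  · intro H H₁ H₂ I₁ I₂ hu _ _ h1 h2 P hP
    rw [hu]
    rcases Multiset.mem_add.1 hP with hP | hP
    · obtain ⟨a, b, c, d⟩ := h1 P hP
      exact ⟨a, b, c, d.trans Finset.subset_union_left⟩
    · obtain ⟨a, b, c, d⟩ := h2 P hP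
      exact ⟨a, b, c, d.trans Finset.subset_union_right⟩

theorem vs_bot : vs (⊥ : G.Subgraph) = ∅ := by
  ext; simp [mem_vs]

theorem DecomposesInto.rank_excess (hG : CycleClosed G) (hr : IsPerfectRank G r)
    {I : Multiset G.Subgraph} (h : DecomposesInto H I) (hH : H.IsInduced) :
    rank G r (vs H) = (I.map fun P => rank G r (vs P)).sum ∧
      excess G r (vs H) ≤ (I.map fun P => excess G r (vs P)).sum := by
  refine h.induced_induction (motive := fun H I => rank G r (vs H) =
    (I.map fun P => rank G r (vs P)).sum ∧
      excess G r (vs H) ≤ (I.map fun P => excess G r (vs P)).sum) hG ?_ ?_ ?_ ?_ hH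
  · rw [vs_bot]
    exact ⟨by simp [rank], by simpa using excess_nonpos hG hr (by simp)⟩
  · simp
  · intro H H₁ H₂ I₁ I₂ u hu h1 h2
    simp only [Multiset.map_add, Multiset.sum_add]
    rw [hu.rank hG hr, h1.1, h2.1]
    exact ⟨rfl, (hu.excess_le hG hr).trans (add_le_add h1.2 h2.2)⟩
  · intro H H₁ H₂ I₁ I₂ hu hd hE h1 h2
    simp only [Multiset.map_add, Multiset.sum_add]
    rw [hu, rank_union hd hE, h1.1, h2.1]
    exact ⟨rfl, (excess_union hd hE).trans (add_le_add h1.2 h2.2)⟩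

/-- A vertex lying in several blocks of one of the parts belongs to no other part, because parts
meet in vertices that are free in both. -/
theorem DecomposesInto.countP_le_one (hG : CycleClosed G)
    {I : Multiset G.Subgraph} (h : DecomposesInto H I) (hH : H.IsInduced) :
    (∀ v ∉ vs H, I.countP (v ∈ vs ·) = 0) ∧
    ∀ P ∈ I, ∀ v ∈ vs P, 2 ≤ deg G (vs P) v → I.countP (v ∈ vs ·) ≤ 1 := by
  have hzero : ∀ {H : G.Subgraph} {I : Multiset G.Subgraph} {v : V}, (∀ P ∈ I, vs P ⊆ vs H) →
      v ∉ vs H → I.countP (v ∈ vs ·) = 0 := by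
    intro H I v hI hv
    rw [Multiset.countP_eq_zero]
    exact fun P hP hvP => hv (hI P hP hvP)
  refine ⟨fun v hv => hzero (fun P hP => (h.parts hG hH P hP).2.2.2) hv, ?_⟩
  refine (h.induced_induction (motive := fun H I => (∀ P ∈ I, vs P ⊆ vs H) ∧ ∀ P ∈ I, ∀ v ∈ vs P,
    2 ≤ deg G (vs P) v → I.countP (v ∈ vs ·) ≤ 1) hG ?_ ?_ ?_ ?_ hH).2
  · simp
  · intro H _ _ _
    refine ⟨by simp, fun P _ v _ _ => ?_⟩
    exact (Multiset.countP_le_card _ _).trans (by simp)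
  · intro H H₁ H₂ I₁ I₂ u hu h1 h2
    have key : ∀ {H₁ H₂ : G.Subgraph} {I₁ I₂ : Multiset G.Subgraph},
        IsGlueOf G (vs H) (vs H₁) (vs H₂) u → (∀ P ∈ I₁, vs P ⊆ vs H₁) → (∀ P ∈ I₂, vs P ⊆ vs H₂) →
        (∀ P ∈ I₁, ∀ v ∈ vs P, 2 ≤ deg G (vs P) v → I₁.countP (v ∈ vs ·) ≤ 1) →
        ∀ P ∈ I₁, ∀ v ∈ vs P, 2 ≤ deg G (vs P) v →
          I₁.countP (v ∈ vs ·) + I₂.countP (v ∈ vs ·) ≤ 1 := by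
      intro H₁ H₂ I₁ I₂ hu hs1 hs2 h P hP v hv hd
      have hv2 : v ∉ vs H₂ := fun hv2 => by
        have := hu.eq_of_mem (hs1 P hP hv) hv2
        subst this
        have := (deg_mono (G := G) (hs1 P hP) v).trans hu.deg_left
        omega
      rw [hzero hs2 hv2]
      exact h P hP v hv hd
    constructor
    · intro P hP
      rw [hu.union]
      rcases Multiset.mem_add.1 hP with hP | hP
      · exact (h1.1 P hP).trans Finset.subset_union_left
      · exact (h2.1 P hP).trans Finset.subset_union_right
    · intro P hP v hv hd
      rw [Multiset.countP_add]
      rcases Multiset.mem_add.1 hP with hP | hP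
      · exact key hu h1.1 h2.1 h1.2 P hP v hv hd
      · rw [add_comm]
        exact key hu.symm h2.1 h1.1 h2.2 P hP v hv hd
  · intro H H₁ H₂ I₁ I₂ hu hd hE h1 h2
    constructor
    · intro P hP
      rw [hu]
      rcases Multiset.mem_add.1 hP with hP | hP
      · exact (h1.1 P hP).trans Finset.subset_union_left
      · exact (h2.1 P hP).trans Finset.subset_union_right
    · intro P hP v hv hdeg
      rw [Multiset.countP_add]
      rcases Multiset.mem_add.1 hP with hP | hP
      · rw [hzero h2.1 (Finset.disjoint_left.1 hd (h1.1 P hP hv))]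
        exact h1.2 P hP v hv hdeg
      · rw [hzero h1.1 (Finset.disjoint_right.1 hd (h2.1 P hP hv)), zero_add]
        exact h2.2 P hP v hv hdeg

end Excess

/-! ### Runs of the algorithm -/

section Runs

variable {V : Type u} [Fintype V] [DecidableEq V]
variable {G : SimpleGraph V} {r : V → ℕ} {s s' : AlgState G} {v : V}

open Classical in
/-- A set of vertices as a `Finset`. -/
noncomputable def fs (T : Set V) : Finset V := Finset.univ.filter (· ∈ T)

theorem mem_fs {T : Set V} : v ∈ fs T ↔ v ∈ T := by simp [fs]

theorem vs_top : vs (⊤ : G.Subgraph) = Finset.univ := by ext; simp [mem_vs]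

/-- The graphs that still have to be treated. -/
def members (s : AlgState G) : Multiset G.Subgraph := s.graphs + s.parts

/-- The invariant shared by all runs: what the state consists of. -/
structure IsRegular (s : AlgState G) : Prop where
  isInduced : ∀ X ∈ members s, X.IsInduced
  parts : ∀ P ∈ s.parts, P.Connected ∧ ¬ IsDecomposable P ∧ ¬ IsBlock P P

/-- The invariant behind the correctness of the algorithm. By `upper` no set of vertices can do
better than the current value of `dim` together with the best possible continuation; by `lower` the
vertices taken so far separate `G` as `dim` promises. The other two fields keep the graphs that
are still to be treated apart from each other and from the vertices taken. -/
structure IsSound (r : V → ℕ) (s : AlgState G) : Prop where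
  upper : (Nat.card V : ℤ) + 1 + excess G r Finset.univ ≤
    s.dim + ((members s).map fun X => excess G r (vs X)).sum
  lower : s.dim + (fs s.taken).card ≤ Nat.card V + comp G r (Finset.univ \ fs s.taken)
  notMem : ∀ v ∈ s.taken, (members s).countP (v ∈ vs ·) = 0
  unique : ∀ X ∈ members s, ∀ v ∈ vs X, 2 ≤ deg G (vs X) v → (members s).countP (v ∈ vs ·) ≤ 1

theorem isRegular_initState : IsRegular (initState G) := by
  refine ⟨fun X hX => ?_, fun P hP => ?_⟩
  · simp only [members, initState, add_zero, Multiset.mem_singleton] at hX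
    exact hX ▸ SimpleGraph.Subgraph.IsInduced.top
  · simp [initState] at hP

theorem comp_univ (hr : IsPerfectRank G r) (hc : G.Connected) : comp G r Finset.univ = 1 := by
  rw [← vs_top (G := G)]
  refine comp_eq_one hr SimpleGraph.Subgraph.IsInduced.top ?_
  rw [SimpleGraph.Subgraph.connected_iff']
  exact (SimpleGraph.Subgraph.topIso (G := G)).connected_iff.2 hc

theorem isSound_initState (hr : IsPerfectRank G r) (hc : G.Connected) :
    IsSound r (initState G) := by
  have h0 : fs (∅ : Set V) = ∅ := by ext; simp [mem_fs]
  refine ⟨?_, ?_, ?_, ?_⟩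
  · simp [members, initState, vs_top]
  · simp [initState, h0, comp_univ hr hc]
  · simp [initState]
  · intro X _ v _ _
    exact (Multiset.countP_le_card _ _).trans (by simp [members, initState])

open Classical in
theorem IsRegular.step (hG : CycleClosed G) (h : IsRegular s) (hs : Step s s') :
    IsRegular s' := by
  cases hs with
  | next H rest I hp hg hI =>
    have hH : H.IsInduced := h.isInduced H (by simp [members, hg])
    constructor
    · intro X hX
      rcases Multiset.mem_add.1 hX with hX | hX
      · exact h.isInduced X (by simp only [members, hg, Multiset.mem_add, Multiset.mem_cons]; tauto)
      · exact (hI.parts hG hH X (Multiset.mem_of_mem_filter hX)).1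
    · intro P hP
      rw [Multiset.mem_filter] at hP
      have := hI.parts hG hH P hP.1
      exact ⟨this.2.1, this.2.2.1, hP.2⟩
  | take P rest v hp hv h2 =>
    have hP : P.IsInduced := h.isInduced P (by simp [members, hp])
    constructor
    · intro X hX
      simp only [members, Multiset.mem_add, Multiset.mem_cons] at hX
      rcases hX with (rfl | hX) | hX
      · exact isInduced_removeEndblocks hP
      · exact h.isInduced X (by simp only [members, Multiset.mem_add]; tauto)
      · exact h.isInduced X (by simp only [members, hp, Multiset.mem_add, Multiset.mem_cons]; tauto)
    · intro X hX
      exact h.parts X (by rw [hp]; exact Multiset.mem_cons_of_mem hX)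

theorem fs_insert {T : Set V} : fs (insert v T) = insert v (fs T) := by
  ext; simp [mem_fs]

open Classical in
/-- Treating a decomposition loses nothing since the excess is subadditive; taking `v` increases
`dim` by `deg v - 2`, which bounds the loss of excess, and the new components appear in `G` as well
because no vertex of `P` has been taken before. -/
theorem IsSound.step (hB : IsBlockGraph (⊤ : G.Subgraph)) (hr : IsPerfectRank G r)
    (hreg : IsRegular s) (h : IsSound r s) (hs : Step s s') : IsSound r s' := by
  have hG := hB.cycleClosed
  cases hs with
  | next H rest I hp hg hI =>
    have hmem : members s = H ::ₘ rest := by simp [members, hp, hg]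
    have hH : H.IsInduced := hreg.isInduced H (by simp [hmem])
    obtain ⟨hc0, hc1⟩ := hI.countP_le_one hG hH
    have hparts := hI.parts hG hH
    have hcount : ∀ v, Multiset.countP (v ∈ vs ·) (I.filter fun P => ¬ IsBlock P P) ≤
        I.countP (v ∈ vs ·) := fun v => Multiset.countP_le_of_le _ (Multiset.filter_le _ _)
    have hcons : ∀ v, (members s).countP (v ∈ vs ·) =
        rest.countP (v ∈ vs ·) + if v ∈ vs H then 1 else 0 := fun v => by
      rw [hmem, Multiset.countP_cons]
    have hzero : ∀ v, (members s).countP (v ∈ vs ·) = 0 → I.countP (v ∈ vs ·) = 0 := by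
      intro v hv
      rw [hcons] at hv
      refine hc0 v fun hvH => ?_
      rw [if_pos hvH] at hv
      omega
    refine ⟨?_, h.lower, ?_, ?_⟩
    · have h1 := h.upper
      rw [hmem, Multiset.map_cons, Multiset.sum_cons] at h1
      have h2 := (hI.rank_excess hG hr hH).2
      have h3 : (I.map fun P => excess G r (vs P)).sum ≤
          ((I.filter fun P => ¬ IsBlock P P).map fun P => excess G r (vs P)).sum := by
        conv_lhs => rw [← Multiset.filter_add_not (fun P => ¬ IsBlock P P) I]
        rw [Multiset.map_add, Multiset.sum_add]
        have : ((I.filter fun P => ¬¬ IsBlock P P).map fun P => excess G r (vs P)).sum ≤ 0 := by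
          refine (Multiset.sum_le_card_nsmul _ 0 fun x hx => ?_).trans (smul_zero _).le
          rw [Multiset.mem_map] at hx
          obtain ⟨P, hP, rfl⟩ := hx
          rw [Multiset.mem_filter, not_not] at hP
          exact excess_nonpos hG hr fun v hv =>
            deg_le_one_of_isBlock_self hG hr (hparts P hP.1).1 hP.2 (mem_vs.1 hv)
        omega
      simp only [members, Multiset.map_add, Multiset.sum_add]
      omega
    · intro v hv
      have h1 := h.notMem v hv
      have h2 := hzero v h1
      have h3 := hcount v
      rw [hcons] at h1
      simp only [members, Multiset.countP_add]
      omega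
    · intro X hX v hvX hd
      simp only [members, Multiset.countP_add]
      have h3 := hcount v
      rcases Multiset.mem_add.1 hX with hX | hX
      · have h1 := h.unique X (by rw [hmem]; exact Multiset.mem_cons_of_mem hX) v hvX hd
        have h2 : 0 < rest.countP (v ∈ vs ·) := Multiset.countP_pos.2 ⟨X, hX, hvX⟩
        rw [hcons] at h1
        have h4 := hc0 v fun hvH => by
          rw [if_pos hvH] at h1
          omega
        omega
      · have hXI := Multiset.mem_of_mem_filter hX
        have h4 := hc1 X hXI v hvX hd
        have hXH := (hparts X hXI).2.2.2
        have h1 := h.unique H (by simp [hmem]) v (hXH hvX) (hd.trans (deg_mono hXH v))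
        rw [hcons, if_pos (hXH hvX)] at h1
        omega
  | take P rest v hp hv h2 =>
    have hmem : members s = P ::ₘ (rest + s.graphs) := by
      simp only [members, hp]
      rw [add_comm, Multiset.cons_add]
    have hPm : P ∈ members s := by simp [hmem]
    have hP : P.IsInduced := hreg.isInduced P hPm
    have hpr := isPruning_removeEndblocks hB hr hP hv h2
    have hdeg := hpr.two_le_deg hG
    have hvP : v ∈ vs P := mem_vs.2 hv
    have hcdeg := cdeg_eq_deg hG hP hv (by omega)
    have hmem' : removeEndblocks P v ::ₘ s.graphs + rest =
        removeEndblocks P v ::ₘ (rest + s.graphs) := by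
      rw [Multiset.cons_add, add_comm]
    have hsub : vs (removeEndblocks P v) ⊆ vs P := hpr.subset.trans (Finset.erase_subset _ _)
    have hcons : ∀ w, (members s).countP (w ∈ vs ·) =
        (rest + s.graphs).countP (w ∈ vs ·) + if w ∈ vs P then 1 else 0 := fun w => by
      rw [hmem, Multiset.countP_cons]
    have hle : ∀ w, (removeEndblocks P v ::ₘ (rest + s.graphs)).countP (w ∈ vs ·) ≤
        (members s).countP (w ∈ vs ·) := fun w => by
      rw [hcons, Multiset.countP_cons]
      by_cases hw : w ∈ vs (removeEndblocks P v)
      · rw [if_pos hw, if_pos (hsub hw)]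
      · rw [if_neg hw]
        omega
    have hnot : ∀ w ∈ vs P, w ∉ s.taken := fun w hw hwt => by
      have := h.notMem w hwt
      rw [hcons, if_pos hw] at this
      omega
    refine ⟨?_, ?_, ?_, ?_⟩
    · have h1 := h.upper
      have h3 := hpr.excess_le hG hr
      rw [hmem, Multiset.map_cons, Multiset.sum_cons] at h1
      simp only [members]
      rw [hmem', Multiset.map_cons, Multiset.sum_cons]
      omega
    · have h1 := h.lower
      have hvt : v ∉ fs s.taken := fun hvt => hnot v hvP (mem_fs.1 hvt)
      have h3 := comp_erase hG hr (Finset.mem_sdiff.2 ⟨Finset.mem_univ v, hvt⟩)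
      have h4 : deg G (vs P) v ≤ deg G (Finset.univ \ fs s.taken) v :=
        deg_mono (fun w hw => Finset.mem_sdiff.2 ⟨Finset.mem_univ w,
          fun hwt => hnot w hw (mem_fs.1 hwt)⟩) v
      dsimp only
      rw [fs_insert, Finset.card_insert_of_notMem hvt, Finset.sdiff_insert]
      omega
    · intro w hw
      simp only [members]
      rw [hmem']
      rcases hw with rfl | hw
      · have h1 := h.unique P hPm w hvP hdeg
        rw [hcons, if_pos hvP] at h1
        rw [Multiset.countP_cons, if_neg fun hw => (Finset.mem_erase.1 (hpr.subset hw)).1 rfl]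
        omega
      · have h1 := h.notMem w hw
        have h3 := hle w
        omega
    · intro X hX w hw hd
      simp only [members] at hX ⊢
      rw [hmem'] at hX ⊢
      refine (hle w).trans ?_
      rcases Multiset.mem_cons.1 hX with rfl | hX
      · exact h.unique P hPm w (hsub hw) (hd.trans (deg_mono hsub w))
      · exact h.unique X (by rw [hmem]; exact Multiset.mem_cons_of_mem hX) w hw hd

/-- A measure of the work left, which decreases in every step. -/
noncomputable def work (r : V → ℕ) (s : AlgState G) : ℕ :=
  (s.graphs.map fun X => 2 * rank G r (vs X) + 1).sum +
    (s.parts.map fun X => 2 * rank G r (vs X)).sum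

open Classical in
theorem work_lt (hB : IsBlockGraph (⊤ : G.Subgraph)) (hr : IsPerfectRank G r)
    (hreg : IsRegular s) (hs : Step s s') : work r s' < work r s := by
  have hG := hB.cycleClosed
  cases hs with
  | next H rest I hp hg hI =>
    have hH : H.IsInduced := hreg.isInduced H (by simp [members, hg])
    have h1 := (hI.rank_excess hG hr hH).1
    have h2 : ((I.filter fun P => ¬ IsBlock P P).map fun P => 2 * rank G r (vs P)).sum ≤
        2 * rank G r (vs H) := by
      rw [h1, ← Multiset.sum_map_mul_left]
      obtain ⟨J, hJ⟩ := Multiset.le_iff_exists_add.1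
        (Multiset.filter_le (fun P => ¬ IsBlock P P) I)
      conv_rhs => rw [hJ]
      rw [Multiset.map_add, Multiset.sum_add]
      exact Nat.le_add_right _ _
    simp only [work, hg, hp, Multiset.map_cons, Multiset.sum_cons, Multiset.map_zero,
      Multiset.sum_zero]
    omega
  | take P rest v hp hv h2 =>
    have hP : P.IsInduced := hreg.isInduced P (by simp [members, hp])
    have h1 := (isPruning_removeEndblocks hB hr hP hv h2).rank_lt hG hr
    simp only [work, hp, Multiset.map_cons, Multiset.sum_cons]
    omega

theorem Reachable.isRegular (hG : CycleClosed G) (h : Reachable s) : IsRegular s := by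
  induction h with
  | refl => exact isRegular_initState
  | tail _ hs ih => exact ih.step hG hs

theorem Reachable.isSound (hB : IsBlockGraph (⊤ : G.Subgraph)) (hr : IsPerfectRank G r)
    (hc : G.Connected) (h : Reachable s) : IsSound r s := by
  induction h with
  | refl => exact isSound_initState hr hc
  | tail h hs ih => exact ih.step hB hr (Reachable.isRegular hB.cycleClosed h) hs

theorem not_exists_infinite_run (hB : IsBlockGraph (⊤ : G.Subgraph)) (hr : IsPerfectRank G r) :
    ¬ ∃ run : ℕ → AlgState G, run 0 = initState G ∧ ∀ k, Step (run k) (run (k + 1)) := by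
  rintro ⟨run, h0, hstep⟩
  have hreg : ∀ k, IsRegular (run k) := by
    intro k
    induction k with
    | zero => exact h0 ▸ isRegular_initState
    | succ k ih => exact ih.step hB.cycleClosed (hstep k)
  have hlt : ∀ k, work r (run (k + 1)) < work r (run k) := fun k =>
    work_lt hB hr (hreg k) (hstep k)
  have hle : ∀ k, work r (run k) + k ≤ work r (run 0) := by
    intro k
    induction k with
    | zero => exact le_rfl
    | succ k ih =>
      have := hlt k
      omega
  have := hle (work r (run 0) + 1)
  omega

/-- An indecomposable graph that is not a block has a vertex in at least two endblocks, namely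
the one of maximal rank among those lying in several blocks. -/
theorem exists_endblocks (hB : IsBlockGraph (⊤ : G.Subgraph)) (hr : IsPerfectRank G r)
    {P : G.Subgraph} (hP : P.IsInduced) (hc : P.Connected) (hi : ¬ IsDecomposable P)
    (hb : ¬ IsBlock P P) : ∃ v ∈ P.verts, 3 ≤ deg G (vs P) v ∧
      (∀ x ∈ vs P, 2 ≤ deg G (vs P) x → r x ≤ r v) ∧ 2 ≤ (endblocksAt P v).ncard := by
  have hG := hB.cycleClosed
  obtain ⟨v, hv, hd, hmax⟩ := exists_maxRank (exists_two_le_deg_of_not_isBlock hG hr hP hc hb) r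
  rw [mem_vs] at hv
  have h3 : 3 ≤ deg G (vs P) v := by
    have : deg G (vs P) v ≠ 2 := fun h => hi (isDecomposable_of_deg_eq_two hG hP hv h)
    omega
  exact ⟨v, hv, h3, hmax, two_le_ncard_endblocksAt hB hr hP hv h3 hmax⟩

theorem isFinished_of_stuck (hB : IsBlockGraph (⊤ : G.Subgraph)) (hr : IsPerfectRank G r)
    (h : IsRegular s) (hs : ∀ s', ¬ Step s s') : IsFinished s := by
  have hp : s.parts = 0 := by
    by_contra hne
    obtain ⟨P, hP⟩ := Multiset.exists_mem_of_ne_zero hne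
    obtain ⟨rest, hrest⟩ := Multiset.exists_cons_of_mem hP
    obtain ⟨hc, hi, hb⟩ := h.parts P hP
    obtain ⟨v, hv, -, -, h2⟩ := exists_endblocks hB hr
      (h.isInduced P (Multiset.mem_add.2 (.inr hP))) hc hi hb
    exact hs _ (.take s P rest v hrest hv h2)
  refine ⟨?_, hp⟩
  by_contra hne
  obtain ⟨H, hH⟩ := Multiset.exists_mem_of_ne_zero hne
  obtain ⟨rest, hrest⟩ := Multiset.exists_cons_of_mem hH
  obtain ⟨I, hI⟩ := exists_decomposesInto H
  exact hs _ (.next s H rest I hp hrest hI)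

/-- A finished run has found a set `T` for which `comp (V \ T) - |T|` is maximal. -/
theorem IsSound.optimal (hr : IsPerfectRank G r) (hc : G.Connected) (h : IsSound r s)
    (hf : IsFinished s) :
    s.dim + (fs s.taken).card = Nat.card V + comp G r (Finset.univ \ fs s.taken) ∧
    ∀ T : Finset V, Nat.card V + comp G r (Finset.univ \ T) ≤ s.dim + T.card := by
  have h1 := h.upper
  have h2 := h.lower
  have h3 := comp_univ hr hc
  simp only [members, hf.1, hf.2, add_zero, Multiset.map_zero, Multiset.sum_zero] at h1
  have key : ∀ T : Finset V, Nat.card V + comp G r (Finset.univ \ T) ≤ s.dim + T.card := by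
    intro T
    have h4 := gain_le_excess (G := G) (r := r) (Finset.subset_univ T)
    unfold gain at h4
    omega
  exact ⟨le_antisymm h2 (key _), key⟩

theorem vs_top_deleteVerts {T : Set V} :
    vs ((⊤ : G.Subgraph).deleteVerts T) = Finset.univ \ fs T := by
  ext; simp [mem_vs, mem_fs]

/-- If some `i ∈ T` did not separate anything, then `T \ {i}` would be better than `T`. -/
theorem isCutset_of_optimal (hr : IsPerfectRank G r) {T : Set V} {d : ℕ}
    (h1 : d + (fs T).card = Nat.card V + comp G r (Finset.univ \ fs T))
    (h2 : ∀ T : Finset V, Nat.card V + comp G r (Finset.univ \ T) ≤ d + T.card) :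
    IsCutset (⊤ : G.Subgraph) T := by
  refine ⟨fun _ _ => trivial, fun i hi => ?_⟩
  rw [numComp_eq hr SimpleGraph.Subgraph.IsInduced.top,
    numComp_eq hr SimpleGraph.Subgraph.IsInduced.top, vs_top_deleteVerts, vs_top_deleteVerts]
  have h3 := h2 (fs (T \ {i}))
  have h4 : fs (T \ {i}) = (fs T).erase i := by
    ext x; simp [mem_fs, and_comm]
  have h5 := Finset.card_erase_add_one (mem_fs.2 hi)
  rw [h4] at h3 ⊢
  omega

end Runs

/-! ### The run that takes vertices in the order of falling rank -/

section Greedy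

variable {V : Type u} [Fintype V] [DecidableEq V]
variable {G : SimpleGraph V} {r : V → ℕ} {H : G.Subgraph} {W W' A B T : Finset V} {u v w : V}
  {s : AlgState G}

open Classical in
/-- The neighbours of `v` that are left when `T` has been treated down to the rank of `v`: all those
of lower rank, and those of higher rank outside `T`. -/
noncomputable def liveNbrs (G : SimpleGraph V) (r : V → ℕ) (T : Finset V) (v : V) : Finset V :=
  Finset.univ.filter fun x => G.Adj v x ∧ (r x < r v ∨ x ∉ T)

/-- The number of blocks at `v` that are left when `T` has been treated down to the rank of `v`. -/
noncomputable def liveDeg (G : SimpleGraph V) (r : V → ℕ) (T : Finset V) (v : V) : ℕ :=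
  ((liveNbrs G r T v).image (cls G v)).card

/-- `T` is the set of vertices taken when the vertices are treated in the order of falling rank: a
vertex is taken if and only if at least three blocks are left at it. -/
def IsGreedySet (G : SimpleGraph V) (r : V → ℕ) (T : Finset V) : Prop :=
  ∀ v, v ∈ T ↔ 3 ≤ liveDeg G r T v

/-- `G[W]` can occur in a run of the algorithm that always takes the vertex of maximal rank among
those lying in several blocks. -/
structure IsConsistent (G : SimpleGraph V) (r : V → ℕ) (T W : Finset V) : Prop where
  three_le : ∀ v ∈ W, v ∈ T → 3 ≤ deg G W v
  subset : ∀ v ∈ W, 3 ≤ deg G W v → liveNbrs G r T v ⊆ W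

/-- The total contribution of the vertices of `T ∩ W` to the variable `dim`. -/
noncomputable def weight (G : SimpleGraph V) (r : V → ℕ) (T W : Finset V) : ℕ :=
  ∑ v ∈ T ∩ W, (liveDeg G r T v - 2)

theorem mem_liveNbrs : u ∈ liveNbrs G r T v ↔ G.Adj v u ∧ (r u < r v ∨ u ∉ T) := by
  simp [liveNbrs]

theorem liveDeg_le_deg (h : liveNbrs G r T v ⊆ W) : liveDeg G r T v ≤ deg G W v :=
  Finset.card_le_card (Finset.image_subset_image fun _ hx =>
    mem_nbrs.2 ⟨h hx, (mem_liveNbrs.1 hx).1⟩)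

/-- At a vertex of maximal rank among those lying in several blocks, `G[W]` shows the blocks that
the greedy set has left: vertices of higher rank in `W` lie in one block only, and so are not in
`T`. -/
theorem IsConsistent.deg_eq (hr : IsPerfectRank G r) (h : IsConsistent G r T W) (hv : v ∈ W)
    (h3 : 3 ≤ deg G W v) (hmax : ∀ x ∈ W, 2 ≤ deg G W x → r x ≤ r v) :
    deg G W v = liveDeg G r T v := by
  have : nbrs G W v = liveNbrs G r T v := by
    ext x
    rw [mem_nbrs, mem_liveNbrs]
    constructor
    · rintro ⟨hx, hvx⟩
      refine ⟨hvx, ?_⟩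
      by_contra hn
      push Not at hn
      have h1 := hmax x hx (by have := h.three_le x hx hn.2; omega)
      exact hvx.ne (hr.inj (le_antisymm hn.1 h1))
    · intro hx
      exact ⟨h.subset v hv h3 (mem_liveNbrs.2 hx), hx.1⟩
  rw [deg, this, liveDeg]

theorem IsConsistent.prune (hT : IsGreedySet G r T)
    (h : IsConsistent G r T W) (hp : IsPruning G W v W') (hvT : v ∈ T)
    (hmax : ∀ x ∈ W, 2 ≤ deg G W x → r x ≤ r v) : IsConsistent G r T W' := by
  have hW : W' ⊆ W := hp.subset.trans (Finset.erase_subset _ _)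
  have key : ∀ w ∈ W', 3 ≤ deg G W w → liveNbrs G r T w ⊆ W' := by
    intro w hw h3 x hx
    have hxW := h.subset w (hW hw) h3 hx
    rw [mem_liveNbrs] at hx
    have hxv : x ≠ v := by
      rintro rfl
      have := hmax w (hW hw) (by omega)
      rcases hx.2 with h | h
      · omega
      · exact h hvT
    by_contra hx'
    exact hp.not_adj x hxW hxv hx' w hw hx.1.symm
  constructor
  · intro w hw hwT
    exact ((hT w).1 hwT).trans (liveDeg_le_deg (key w hw (h.three_le w (hW hw) hwT)))
  · intro w hw h3
    exact key w hw (h3.trans (deg_mono hW w))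

/-- Removing endblocks at `v` removes no vertex of `T` other than `v`, since such a vertex lies in
three blocks. -/
theorem IsConsistent.inter_eq (h : IsConsistent G r T W) (hp : IsPruning G W v W')
    (hvT : v ∈ T) : T ∩ W = insert v (T ∩ W') := by
  ext w
  rw [Finset.mem_insert, Finset.mem_inter, Finset.mem_inter]
  constructor
  · rintro ⟨hwT, hw⟩
    by_cases hwv : w = v
    · exact .inl hwv
    · refine .inr ⟨hwT, ?_⟩
      by_contra hw'
      have h1 := hp.deg_le w hw hwv hw'
      have h2 := h.three_le w hw hwT
      omega
  · rintro (rfl | ⟨hwT, hw⟩)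
    · exact ⟨hvT, hp.mem⟩
    · exact ⟨hwT, (Finset.mem_erase.1 (hp.subset hw)).2⟩

theorem IsConsistent.weight_prune (h : IsConsistent G r T W) (hp : IsPruning G W v W')
    (hvT : v ∈ T) : weight G r T W = liveDeg G r T v - 2 + weight G r T W' := by
  rw [weight, h.inter_eq hp hvT, Finset.sum_insert, weight]
  intro hv
  exact (Finset.mem_erase.1 (hp.subset (Finset.mem_inter.1 hv).2)).1 rfl

theorem IsConsistent.glue (h : IsConsistent G r T W) (hg : IsGlueOf G W A B u) :
    IsConsistent G r T A := by
  have hAW : A ⊆ W := hg.union ▸ Finset.subset_union_left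
  constructor
  · intro v hv hvT
    have h3 := h.three_le v (hAW hv) hvT
    have hvu : v ≠ u := by
      rintro rfl
      have := hg.deg_le_two
      omega
    rwa [deg_congr (hg.nbrs_left hv hvu)]
  · intro v hv h3
    have hvu : v ≠ u := by
      rintro rfl
      have := hg.deg_left
      omega
    have hn := hg.nbrs_left hv hvu
    rw [deg_congr hn] at h3
    intro x hx
    have := mem_nbrs.2 ⟨h.subset v (hAW hv) h3 hx, (mem_liveNbrs.1 hx).1⟩
    rw [← hn] at this
    exact (mem_nbrs.1 this).1

theorem IsConsistent.weight_glue (h : IsConsistent G r T W) (hg : IsGlueOf G W A B u) :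
    weight G r T W = weight G r T A + weight G r T B := by
  rw [weight, weight, weight, ← Finset.sum_union, ← Finset.inter_union_distrib_left, hg.union]
  rw [Finset.disjoint_left]
  intro x hx hx'
  rw [Finset.mem_inter] at hx hx'
  have hxu := hg.eq_of_mem hx.2 hx'.2
  have h3 := h.three_le x (hg.union ▸ Finset.mem_union_left B hx.2) hx.1
  have h2 := hg.deg_le_two
  rw [hxu] at h3
  omega

theorem nbrs_eq_of_not_adj (hE : ∀ a ∈ A, ∀ b ∈ B, ¬ G.Adj a b) (hv : v ∈ A) :
    nbrs G A v = nbrs G (A ∪ B) v := by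
  ext x
  rw [mem_nbrs, mem_nbrs, Finset.mem_union]
  exact ⟨fun hx => ⟨.inl hx.1, hx.2⟩,
    fun hx => ⟨hx.1.resolve_right fun hxB => hE v hv x hxB hx.2, hx.2⟩⟩

theorem IsConsistent.of_union (hE : ∀ a ∈ A, ∀ b ∈ B, ¬ G.Adj a b)
    (h : IsConsistent G r T (A ∪ B)) : IsConsistent G r T A := by
  constructor
  · intro v hv hvT
    rw [deg_congr (nbrs_eq_of_not_adj hE hv)]
    exact h.three_le v (Finset.mem_union_left B hv) hvT
  · intro v hv h3
    rw [deg_congr (nbrs_eq_of_not_adj hE hv)] at h3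
    intro x hx
    have := mem_nbrs.2 ⟨h.subset v (Finset.mem_union_left B hv) h3 hx, (mem_liveNbrs.1 hx).1⟩
    rw [← nbrs_eq_of_not_adj hE hv] at this
    exact (mem_nbrs.1 this).1

theorem weight_union (hd : Disjoint A B) :
    weight G r T (A ∪ B) = weight G r T A + weight G r T B := by
  rw [weight, weight, weight, ← Finset.sum_union, ← Finset.inter_union_distrib_left]
  exact hd.mono Finset.inter_subset_right Finset.inter_subset_right

theorem DecomposesInto.isConsistent (hG : CycleClosed G) {I : Multiset G.Subgraph}
    (hI : DecomposesInto H I) (hH : H.IsInduced) (h : IsConsistent G r T (vs H)) :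
    (∀ P ∈ I, IsConsistent G r T (vs P)) ∧
      (I.map fun P => weight G r T (vs P)).sum = weight G r T (vs H) ∧
      ∀ v, v ∈ vs H ↔ ∃ P ∈ I, v ∈ vs P := by
  refine hI.induced_induction (motive := fun H I => IsConsistent G r T (vs H) →
    (∀ P ∈ I, IsConsistent G r T (vs P)) ∧
      (I.map fun P => weight G r T (vs P)).sum = weight G r T (vs H) ∧
      ∀ v, v ∈ vs H ↔ ∃ P ∈ I, v ∈ vs P) hG ?_ ?_ ?_ ?_ hH h
  · intro _
    simp [vs_bot, weight]
  · intro H _ _ _ h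
    simp [h]
  · intro H H₁ H₂ I₁ I₂ u hu h1 h2 h
    obtain ⟨a1, b1, c1⟩ := h1 (h.glue hu)
    obtain ⟨a2, b2, c2⟩ := h2 (h.glue hu.symm)
    refine ⟨fun P hP => (Multiset.mem_add.1 hP).elim (a1 P) (a2 P), ?_, fun v => ?_⟩
    · rw [Multiset.map_add, Multiset.sum_add, b1, b2, h.weight_glue hu]
    · rw [hu.union, Finset.mem_union, c1, c2]
      simp only [Multiset.mem_add, or_and_right, exists_or]
  · intro H H₁ H₂ I₁ I₂ hu hd hE h1 h2 h
    rw [hu] at h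
    obtain ⟨a1, b1, c1⟩ := h1 (h.of_union hE)
    obtain ⟨a2, b2, c2⟩ := h2
      (IsConsistent.of_union (B := vs H₁) (fun a ha b hb hab => hE b hb a ha hab.symm)
        (by rwa [Finset.union_comm]))
    refine ⟨fun P hP => (Multiset.mem_add.1 hP).elim (a1 P) (a2 P), ?_, fun v => ?_⟩
    · rw [Multiset.map_add, Multiset.sum_add, b1, b2, hu, weight_union hd]
    · rw [hu, Finset.mem_union, c1, c2]
      simp only [Multiset.mem_add, or_and_right, exists_or]

/-- The invariant of the run that takes exactly the vertices of the greedy set `T`. -/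
structure IsGreedyState (r : V → ℕ) (T : Finset V) (s : AlgState G) : Prop where
  consistent : ∀ X ∈ members s, IsConsistent G r T (vs X)
  dim : s.dim + ((members s).map fun X => weight G r T (vs X)).sum =
    Nat.card V + 1 + weight G r T Finset.univ
  mem_iff : ∀ v, v ∈ T ↔ v ∈ s.taken ∨ v ∈ T ∧ ∃ X ∈ members s, v ∈ vs X

theorem isGreedyState_initState (hT : IsGreedySet G r T) : IsGreedyState r T (initState G) := by
  refine ⟨fun X hX => ?_, ?_, ?_⟩
  · simp only [members, initState, add_zero, Multiset.mem_singleton] at hX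
    rw [hX, vs_top]
    exact ⟨fun v _ hv => ((hT v).1 hv).trans (liveDeg_le_deg (Finset.subset_univ _)),
      fun v _ _ => Finset.subset_univ _⟩
  · simp [members, initState, vs_top]
  · simp [members, initState, vs_top]

open Classical in
/-- The greedy run can be continued by taking the vertex of maximal rank among those of a part that
lie in several blocks. -/
theorem IsGreedyState.exists_step (hB : IsBlockGraph (⊤ : G.Subgraph)) (hr : IsPerfectRank G r)
    (hT : IsGreedySet G r T) (hreg : IsRegular s) (h : IsGreedyState r T s) :
    IsFinished s ∨ ∃ s', Step s s' ∧ IsGreedyState r T s' := by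
  have hG := hB.cycleClosed
  by_cases hp : s.parts = 0
  · by_cases hg : s.graphs = 0
    · exact .inl ⟨hg, hp⟩
    right
    obtain ⟨H, hH⟩ := Multiset.exists_mem_of_ne_zero hg
    obtain ⟨rest, hrest⟩ := Multiset.exists_cons_of_mem hH
    obtain ⟨I, hI⟩ := exists_decomposesInto H
    have hmem : members s = H ::ₘ rest := by simp [members, hp, hrest]
    have hHm : H ∈ members s := by simp [hmem]
    have hHi := hreg.isInduced H hHm
    obtain ⟨a, b, c⟩ := hI.isConsistent hG hHi (h.consistent H hHm)
    have hblock : ∀ P ∈ I, IsBlock P P → T ∩ vs P = ∅ := by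
      intro P hP hPb
      refine Finset.eq_empty_of_forall_notMem fun v hv => ?_
      rw [Finset.mem_inter] at hv
      have h1 := (a P hP).three_le v hv.2 hv.1
      have h2 := deg_le_one_of_isBlock_self hG hr (hI.parts hG hHi P hP).1 hPb (mem_vs.1 hv.2)
      omega
    refine ⟨_, .next s H rest I hp hrest hI, ?_, ?_, ?_⟩
    · intro X hX
      rcases Multiset.mem_add.1 hX with hX | hX
      · exact h.consistent X (by rw [hmem]; exact Multiset.mem_cons_of_mem hX)
      · exact a X (Multiset.mem_of_mem_filter hX)
    · have h1 := h.dim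
      rw [hmem, Multiset.map_cons, Multiset.sum_cons] at h1
      have h2 : ((I.filter fun P => ¬ IsBlock P P).map fun P => weight G r T (vs P)).sum =
          weight G r T (vs H) := by
        rw [← b]
        conv_rhs => rw [← Multiset.filter_add_not (fun P => ¬ IsBlock P P) I]
        rw [Multiset.map_add, Multiset.sum_add, left_eq_add]
        refine Multiset.sum_eq_zero fun x hx => ?_
        rw [Multiset.mem_map] at hx
        obtain ⟨P, hP, rfl⟩ := hx
        rw [Multiset.mem_filter, not_not] at hP
        rw [weight, hblock P hP.1 hP.2, Finset.sum_empty]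
      simp only [members, Multiset.map_add, Multiset.sum_add]
      omega
    · intro v
      refine (h.mem_iff v).trans ?_
      simp only [members, hp, hrest, add_zero, Multiset.mem_cons, Multiset.mem_add,
        Multiset.mem_filter]
      refine or_congr_right (and_congr_right fun hv => ?_)
      constructor
      · rintro ⟨X, rfl | hX, hvX⟩
        · obtain ⟨P, hP, hvP⟩ := (c v).1 hvX
          refine ⟨P, .inr ⟨hP, fun hPb => ?_⟩, hvP⟩
          have : v ∈ T ∩ vs P := Finset.mem_inter.2 ⟨hv, hvP⟩
          rw [hblock P hP hPb] at this
          exact Finset.notMem_empty v this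
        · exact ⟨X, .inl hX, hvX⟩
      · rintro ⟨X, hX | hX, hvX⟩
        · exact ⟨X, .inr hX, hvX⟩
        · exact ⟨H, .inl rfl, (c v).2 ⟨X, hX.1, hvX⟩⟩
  · right
    obtain ⟨P, hPp⟩ := Multiset.exists_mem_of_ne_zero hp
    obtain ⟨rest, hrest⟩ := Multiset.exists_cons_of_mem hPp
    obtain ⟨hc, hi, hb⟩ := hreg.parts P hPp
    have hPm : P ∈ members s := Multiset.mem_add.2 (.inr hPp)
    have hPi := hreg.isInduced P hPm
    obtain ⟨v, hv, h3, hmax, h2⟩ := exists_endblocks hB hr hPi hc hi hb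
    have hcon := h.consistent P hPm
    have hpr := isPruning_removeEndblocks hB hr hPi hv h2
    have hdeg := hcon.deg_eq hr (mem_vs.2 hv) h3 hmax
    have hvT : v ∈ T := (hT v).2 (hdeg ▸ h3)
    have hmem : members s = P ::ₘ (rest + s.graphs) := by
      simp only [members, hrest]
      rw [add_comm, Multiset.cons_add]
    have hmem' : removeEndblocks P v ::ₘ s.graphs + rest =
        removeEndblocks P v ::ₘ (rest + s.graphs) := by
      rw [Multiset.cons_add, add_comm]
    refine ⟨_, .take s P rest v hrest hv h2, ?_, ?_, ?_⟩
    · intro X hX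
      simp only [members] at hX
      rw [hmem'] at hX
      rcases Multiset.mem_cons.1 hX with rfl | hX
      · exact hcon.prune hT hpr hvT hmax
      · exact h.consistent X (by rw [hmem]; exact Multiset.mem_cons_of_mem hX)
    · have h1 := h.dim
      have h4 := hcon.weight_prune hpr hvT
      have h5 := cdeg_eq_deg hG hPi hv (by omega)
      rw [hmem, Multiset.map_cons, Multiset.sum_cons] at h1
      simp only [members]
      rw [hmem', Multiset.map_cons, Multiset.sum_cons]
      omega
    · intro w
      have h4 : w ∈ T → (w ∈ vs P ↔ w = v ∨ w ∈ vs (removeEndblocks P v)) := by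
        intro hw
        have h5 : w ∈ T ∩ vs P ↔ w ∈ insert v (T ∩ vs (removeEndblocks P v)) := by
          rw [hcon.inter_eq hpr hvT]
        rw [Finset.mem_inter, Finset.mem_insert, Finset.mem_inter] at h5
        tauto
      have h5 := h.mem_iff w
      rw [hmem] at h5
      simp only [members]
      rw [hmem']
      simp only [Multiset.mem_cons, or_and_right, exists_or, exists_eq_left] at h5 ⊢
      rw [Set.mem_insert_iff]
      by_cases hw : w ∈ T
      · rw [h4 hw] at h5
        tauto
      · have : w ≠ v := fun h => hw (h ▸ hvT)
        tauto

/-- Some run of the algorithm takes exactly the vertices of the greedy set. -/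
theorem exists_greedy_run (hB : IsBlockGraph (⊤ : G.Subgraph)) (hr : IsPerfectRank G r)
    (hT : IsGreedySet G r T) : ∃ s : AlgState G, Reachable s ∧ IsFinished s ∧
      s.dim = Nat.card V + 1 + weight G r T Finset.univ ∧ ∀ v, v ∈ s.taken ↔ v ∈ T := by
  have key : ∀ k, ∀ s : AlgState G, work r s = k → Reachable s → IsGreedyState r T s →
      ∃ s : AlgState G, Reachable s ∧ IsFinished s ∧ IsGreedyState r T s := by
    intro k
    induction k using Nat.strong_induction_on with
    | _ k ih =>
      intro s hk hs hg
      have hreg := Reachable.isRegular hB.cycleClosed hs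
      rcases hg.exists_step hB hr hT hreg with hf | ⟨s', hs', hg'⟩
      · exact ⟨s, hs, hf, hg⟩
      · exact ih _ (hk ▸ work_lt hB hr hreg hs') s' rfl (hs.tail hs') hg'
  obtain ⟨s, hs, hf, hg⟩ := key _ _ rfl .refl (isGreedyState_initState hT)
  have hmem : members s = 0 := by simp [members, hf.1, hf.2]
  refine ⟨s, hs, hf, ?_, fun v => ?_⟩
  · have := hg.dim
    simpa [hmem] using this
  · refine Iff.trans ?_ (hg.mem_iff v).symm
    simp [hmem]

end Greedy

/-! ### Parametrization of the ideals of minors -/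

section Parametrization

open MvPolynomial

variable (K : Type u) [Field K] {n : ℕ}

/-- The polynomial ring with the variables `s_i`, `a_k`, `b_k`. -/
abbrev ParamRing (n : ℕ) : Type u := MvPolynomial (Fin n ⊕ Fin n ⊕ Fin n) K

open Classical in
/-- The images of the variables under `param`. -/
noncomputable def paramVar (T A : Set (Fin n)) (c : Fin n → Fin n) :
    Fin n ⊕ Fin n → ParamRing K n :=
  Sum.elim
    (fun i => if i ∈ T ∨ c i ∈ A then 0 else X (.inl i) * X (.inr (.inl (c i))))
    (fun i => if i ∈ T then 0 else X (.inl i) * X (.inr (.inr (c i))))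

/-- The homomorphism with `x_i ↦ s_i a_{c i}` and `y_i ↦ s_i b_{c i}`, except that the variables of
the vertices in `T` and the variables `x_i` with label `c i` in `A` are sent to `0`. -/
noncomputable def param (T A : Set (Fin n)) (c : Fin n → Fin n) :
    PolyRing K n →ₐ[K] ParamRing K n :=
  aeval (paramVar K T A c)

/-- The prime ideal of the relations between the images of the variables under `param`. -/
noncomputable def paramPrime (T A : Set (Fin n)) (c : Fin n → Fin n) :
    PrimeSpectrum (PolyRing K n) :=
  ⟨RingHom.ker (param K T A c), RingHom.ker_isPrime _⟩

/-- The ideal of the minors whose two columns have the same label. -/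
noncomputable def minorIdeal (c : Fin n → Fin n) : Ideal (PolyRing K n) :=
  Ideal.span {f | ∃ i j, c i = c j ∧ f = xv K i * yv K j - xv K j * yv K i}

variable {T A : Set (Fin n)} {c : Fin n → Fin n} {i j k : Fin n}

theorem mem_paramPrime {f : PolyRing K n} :
    f ∈ (paramPrime K T A c).asIdeal ↔ param K T A c f = 0 := Iff.rfl

open Classical in
theorem param_xv : param K T A c (xv K i) =
    if i ∈ T ∨ c i ∈ A then 0 else X (.inl i) * X (.inr (.inl (c i))) := by
  rw [xv, param, aeval_X]; rfl

open Classical in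
theorem param_yv : param K T A c (yv K i) =
    if i ∈ T then 0 else X (.inl i) * X (.inr (.inr (c i))) := by
  rw [yv, param, aeval_X]; rfl

/-- The exponent of the image of a variable under `param`. -/
noncomputable def varExp (c : Fin n → Fin n) : Fin n ⊕ Fin n → (Fin n ⊕ Fin n ⊕ Fin n →₀ ℕ) :=
  Sum.elim (fun i => Finsupp.single (.inl i) 1 + Finsupp.single (.inr (.inl (c i))) 1)
    (fun i => Finsupp.single (.inl i) 1 + Finsupp.single (.inr (.inr (c i))) 1)

/-- The exponent of the image of a monomial under `param`. -/
noncomputable def monExp (c : Fin n → Fin n) (m : Fin n ⊕ Fin n →₀ ℕ) :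
    Fin n ⊕ Fin n ⊕ Fin n →₀ ℕ :=
  ∑ v, m v • varExp c v

theorem param_monomial (m : Fin n ⊕ Fin n →₀ ℕ) :
    param K ∅ ∅ c (monomial m 1) = monomial (monExp c m) 1 := by
  have h : ∀ v, paramVar K ∅ ∅ c v = monomial (varExp c v) 1 := by
    rintro (i | i)
    · simp [paramVar, varExp, X, monomial_mul]
    · simp [paramVar, varExp, X, monomial_mul]
  rw [param, aeval_monomial, map_one, one_mul, Finsupp.prod_pow, monExp, monomial_sum_one]
  refine Finset.prod_congr rfl fun v _ => ?_
  rw [h, monomial_pow, one_pow]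

theorem monExp_add (m m' : Fin n ⊕ Fin n →₀ ℕ) :
    monExp c (m + m') = monExp c m + monExp c m' := by
  simp only [monExp, Finsupp.add_apply, add_smul, Finset.sum_add_distrib]

theorem monExp_single (v : Fin n ⊕ Fin n) : monExp c (Finsupp.single v 1) = varExp c v := by
  rw [monExp, Finset.sum_eq_single v]
  · simp
  · intro w _ hw
    simp [Finsupp.single_eq_of_ne hw]
  · simp

theorem monExp_inl (m : Fin n ⊕ Fin n →₀ ℕ) : monExp c m (.inl i) = m (.inl i) + m (.inr i) := by
  simp [monExp, varExp, Finsupp.single_apply]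

theorem monExp_inr_inl (m : Fin n ⊕ Fin n →₀ ℕ) :
    monExp c m (.inr (.inl k)) = ∑ i with c i = k, m (.inl i) := by
  simp [monExp, varExp, Finsupp.single_apply, Finset.sum_filter]

/-- Monomials with the same image are congruent modulo the minors: one is transformed into the
other by replacing products `x_i y_j` by `x_j y_i`, where `i` and `j` have the same label. -/
theorem monomial_sub_mem {m m' : Fin n ⊕ Fin n →₀ ℕ} (h : monExp c m = monExp c m') :
    monomial m 1 - monomial m' 1 ∈ minorIdeal K c := by
  induction hD : ∑ i, (m (.inl i) - m' (.inl i)) using Nat.strong_induction_on generalizing m with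
  | _ D ih =>
    have hrow : ∀ i, m (.inl i) + m (.inr i) = m' (.inl i) + m' (.inr i) := fun i => by
      rw [← monExp_inl (c := c), ← monExp_inl (c := c), h]
    have hcls : ∀ k, ∑ i with c i = k, m (.inl i) = ∑ i with c i = k, m' (.inl i) := fun k => by
      rw [← monExp_inr_inl, ← monExp_inr_inl, h]
    by_cases hle : ∀ i, m (.inl i) ≤ m' (.inl i)
    · have heq : ∀ i, m (.inl i) = m' (.inl i) := fun i =>
        (Finset.sum_eq_sum_iff_of_le fun i _ => hle i).1 (hcls (c i)) i (by simp)
      have : m = m' := by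
        ext (i | i)
        · exact heq i
        · have h1 := hrow i
          have h2 := heq i
          omega
      rw [this, sub_self]
      exact Ideal.zero_mem _
    · push Not at hle
      obtain ⟨i, hi⟩ := hle
      obtain ⟨j, hj, hlt⟩ : ∃ j, c j = c i ∧ m (.inl j) < m' (.inl j) := by
        by_contra hn
        push Not at hn
        have : ∑ j with c j = c i, m' (.inl j) < ∑ j with c j = c i, m (.inl j) :=
          Finset.sum_lt_sum (fun j hj => hn j (Finset.mem_filter.1 hj).2) ⟨i, by simp, hi⟩
        have := hcls (c i)
        omega
      have hij : i ≠ j := by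
        rintro rfl
        omega
      have hyj := hrow j
      -- `m` is divisible by `x_i y_j`
      have hdvd : Finsupp.single (.inl i) 1 + Finsupp.single (.inr j) 1 ≤ m := by
        rw [Finsupp.le_def]
        intro v
        rcases v with k | k
        · by_cases hk : i = k
          · subst hk
            simp
            omega
          · simp [hk]
        · by_cases hk : j = k
          · subst hk
            simp
            omega
          · simp [hk]
      obtain ⟨p, rfl⟩ := exists_add_of_le hdvd
      set q := Finsupp.single (.inl j) 1 + Finsupp.single (.inr i) 1 + p with hq
      have hexp : monExp c q = monExp c m' := by
        rw [← h, hq]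
        simp only [monExp_add, monExp_single, varExp, Sum.elim_inl, Sum.elim_inr, hj]
        abel
      have hdist : ∑ k, (q (.inl k) - m' (.inl k)) < D := by
        rw [← hD]
        refine Finset.sum_lt_sum (fun k _ => ?_) ⟨i, Finset.mem_univ i, ?_⟩
        · by_cases hk : k = j
          · subst hk
            simp [hq, hij] at hlt ⊢
            omega
          · simp [hq, Finsupp.single_apply, Ne.symm hk]
            omega
        · simp [hq, hij.symm] at hi ⊢
          omega
      have h1 := ih _ hdist hexp rfl
      have h2 : monomial (Finsupp.single (.inl i) 1 + Finsupp.single (.inr j) 1 + p) (1 : K) -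
          monomial q 1 = (xv K i * yv K j - xv K j * yv K i) * monomial p 1 := by
        simp only [hq, xv, yv, X, sub_mul, monomial_mul, mul_one]
      rw [← sub_add_sub_cancel _ (monomial q (1 : K)) _]
      refine Ideal.add_mem _ ?_ h1
      rw [h2]
      exact Ideal.mul_mem_right _ _ (Ideal.subset_span ⟨i, j, hj.symm, rfl⟩)

/-- The kernel of `param` is generated by minors. -/
theorem ker_param_le : RingHom.ker (param K ∅ ∅ c) ≤ minorIdeal K c := by
  classical
  intro f hf
  rw [RingHom.mem_ker] at hf
  -- the residue class of a monomial is determined by its image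
  let π := Ideal.Quotient.mkₐ K (minorIdeal K c)
  let g : (Fin n ⊕ Fin n ⊕ Fin n →₀ ℕ) → PolyRing K n ⧸ minorIdeal K c := fun e =>
    if h : ∃ m, monExp c m = e then π (monomial h.choose 1) else 0
  have hg : ∀ m, g (monExp c m) = π (monomial m 1) := by
    intro m
    have h : ∃ m', monExp c m' = monExp c m := ⟨m, rfl⟩
    simp only [g]
    rw [dif_pos h]
    exact Ideal.Quotient.eq.2 (monomial_sub_mem K h.choose_spec)
  let L := (basisMonomials (Fin n ⊕ Fin n ⊕ Fin n) K).constr K g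
  have hL : L ∘ₗ (param K ∅ ∅ c).toLinearMap = π.toLinearMap := by
    refine (basisMonomials (Fin n ⊕ Fin n) K).ext fun m => ?_
    have h1 : L (monomial (monExp c m) 1) = g (monExp c m) := by
      have := (basisMonomials (Fin n ⊕ Fin n ⊕ Fin n) K).constr_basis K g (monExp c m)
      rwa [coe_basisMonomials] at this
    simp only [coe_basisMonomials, LinearMap.comp_apply, AlgHom.toLinearMap_apply]
    rw [param_monomial, h1, hg]
  have h2 : π f = 0 := by
    have := congrArg (fun l => l f) hL
    simp only [LinearMap.comp_apply, AlgHom.toLinearMap_apply, hf, map_zero] at this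
    exact this.symm
  exact Ideal.Quotient.eq_zero_iff_mem.1 h2

end Parametrization

/-! ### Heights of the prime ideals `P_T(G)` -/

section Heights

open MvPolynomial

variable (K : Type u) [Field K] {n : ℕ}
variable {T A : Set (Fin n)} {c : Fin n → Fin n} {i j k : Fin n} {G : SimpleGraph (Fin n)}

/-- The kernel grows when the parametrization is composed with an endomorphism `ψ`. -/
theorem paramPrime_le {T' A' : Set (Fin n)} {c' : Fin n → Fin n}
    (ψ : ParamRing K n →ₐ[K] ParamRing K n)
    (hx : ∀ i, ψ (param K T A c (xv K i)) = param K T' A' c' (xv K i))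
    (hy : ∀ i, ψ (param K T A c (yv K i)) = param K T' A' c' (yv K i)) :
    paramPrime K T A c ≤ paramPrime K T' A' c' := by
  have h : ψ.comp (param K T A c) = param K T' A' c' := by
    refine MvPolynomial.algHom_ext fun v => ?_
    rcases v with i | i
    · exact hx i
    · exact hy i
  intro f hf
  rw [mem_paramPrime] at hf ⊢
  rw [← h, AlgHom.comp_apply, hf, map_zero]

theorem paramPrime_lt {p q : PrimeSpectrum (PolyRing K n)} (hle : p ≤ q) {f : PolyRing K n}
    (hq : f ∈ q.asIdeal) (hp : f ∉ p.asIdeal) : p < q :=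
  lt_of_le_of_ne hle fun h => hp (h ▸ hq)

theorem s_mul_ne_zero (v w : Fin n ⊕ Fin n ⊕ Fin n) :
    (X v * X w : ParamRing K n) ≠ 0 := mul_ne_zero (X_ne_zero v) (X_ne_zero w)

/-- Sending the variables of one more vertex to zero enlarges the kernel; if `x_i` had already been
sent to zero, then `y_i` is new. -/
theorem paramPrime_lt_insert (hi : i ∉ T) :
    paramPrime K T A c < paramPrime K (insert i T) A c := by
  classical
  refine paramPrime_lt K (paramPrime_le K
    (aeval fun v => if v = .inl i then 0 else X v) ?_ ?_) (f := yv K i) ?_ ?_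
  · intro j
    rw [param_xv, param_xv]
    by_cases h : j ∈ T ∨ c j ∈ A
    · have h' : j ∈ insert i T ∨ c j ∈ A := h.imp (Set.mem_insert_of_mem i) id
      rw [if_pos h, if_pos h', map_zero]
    · rw [if_neg h, map_mul, aeval_X, aeval_X]
      rw [not_or] at h
      by_cases hji : j = i
      · simp [hji]
      · simp [hji, h.1, h.2]
  · intro j
    rw [param_yv, param_yv]
    by_cases h : j ∈ T
    · rw [if_pos h, if_pos (Set.mem_insert_of_mem i h), map_zero]
    · rw [if_neg h, map_mul, aeval_X, aeval_X]
      by_cases hji : j = i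
      · simp [hji]
      · simp [hji, h]
  · rw [mem_paramPrime, param_yv, if_pos (Set.mem_insert i T)]
  · rw [mem_paramPrime, param_yv, if_neg hi]
    exact s_mul_ne_zero K _ _

theorem paramPrime_lt_insert_label (hi : i ∉ T) (hA : c i ∉ A) :
    paramPrime K T A c < paramPrime K T (insert (c i) A) c := by
  classical
  refine paramPrime_lt K (paramPrime_le K
    (aeval fun v => if v = .inr (.inl (c i)) then 0 else X v) ?_ ?_) (f := xv K i) ?_ ?_
  · intro j
    rw [param_xv, param_xv]
    by_cases h : j ∈ T ∨ c j ∈ A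
    · have h' : j ∈ T ∨ c j ∈ insert (c i) A := h.imp id (Set.mem_insert_of_mem _)
      rw [if_pos h, if_pos h', map_zero]
    · rw [if_neg h, map_mul, aeval_X, aeval_X]
      rw [not_or] at h
      by_cases hji : c j = c i
      · simp [hji]
      · simp [hji, h.1, h.2]
  · intro j
    rw [param_yv, param_yv]
    by_cases h : j ∈ T
    · rw [if_pos h, map_zero]
    · rw [if_neg h, map_mul, aeval_X, aeval_X]
      simp
  · rw [mem_paramPrime, param_xv, if_pos (.inr (Set.mem_insert _ A))]
  · rw [mem_paramPrime, param_xv, if_neg (not_or.2 ⟨hi, hA⟩)]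
    exact s_mul_ne_zero K _ _

open Classical in
/-- The labelling `c` restricted to `M`; the other vertices keep their own label. -/
noncomputable def partialLabel (c : Fin n → Fin n) (M : Set (Fin n)) (i : Fin n) : Fin n :=
  if i ∈ M then c i else i

/-- Giving the vertex `i` the label `c i` enlarges the kernel by the minor of the columns `i`
and `c i`. -/
theorem paramPrime_lt_merge {M : Set (Fin n)} (hc : ∀ i, c (c i) = c i) (hM : i ∉ M)
    (hi : c i ≠ i) : paramPrime K ∅ ∅ (partialLabel c M) <
      paramPrime K ∅ ∅ (partialLabel c (insert i M)) := by
  classical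
  have hlabel : ∀ j, (if partialLabel c M j = i then c i else partialLabel c M j) =
      partialLabel c (insert i M) j := by
    intro j
    unfold partialLabel
    by_cases hj : j ∈ M
    · have h1 : c j ≠ i := fun h => hi (by rw [← h, hc])
      rw [if_pos hj, if_neg h1, if_pos (Set.mem_insert_of_mem i hj)]
    · by_cases hji : j = i
      · subst hji
        simp [hj]
      · simp [hj, hji]
  have hci : c i ≠ i := hi
  have h1 : partialLabel c (insert i M) i = c i := if_pos (Set.mem_insert i M)
  have h2 : partialLabel c (insert i M) (c i) = c i := by
    unfold partialLabel
    split_ifs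
    · exact hc i
    · rfl
  have h3 : partialLabel c M i = i := if_neg hM
  have h4 : partialLabel c M (c i) = c i := by
    unfold partialLabel
    split_ifs
    · exact hc i
    · rfl
  refine paramPrime_lt K (paramPrime_le K (aeval (Sum.elim (fun k => X (.inl k)) (Sum.elim
    (fun k => X (.inr (.inl (if k = i then c i else k))))
    (fun k => X (.inr (.inr (if k = i then c i else k))))))) ?_ ?_)
    (f := xv K i * yv K (c i) - xv K (c i) * yv K i) ?_ ?_
  · intro j
    simp only [param_xv, Set.mem_empty_iff_false, or_self, if_false, map_mul, aeval_X,
      Sum.elim_inl, Sum.elim_inr, hlabel]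
  · intro j
    simp only [param_yv, Set.mem_empty_iff_false, if_false, map_mul, aeval_X,
      Sum.elim_inl, Sum.elim_inr, hlabel]
  · rw [mem_paramPrime]
    simp only [map_sub, map_mul, param_xv, param_yv, Set.mem_empty_iff_false, or_self, if_false,
      h1, h2]
    ring
  · rw [mem_paramPrime]
    intro h
    -- the minor does not vanish where `b_i = 0` and all other variables are `1`
    have := congrArg (aeval fun v => if v = .inr (.inr i) then (0 : K) else 1) h
    simp [map_sub, map_mul, param_xv, param_yv, h3, h4, hci] at this

theorem height_add_card_le_insert (S : Finset (Fin n)) (hS : ∀ i ∈ S, i ∉ T) :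
    Order.height (paramPrime K T A c) + S.card ≤
      Order.height (paramPrime K (T ∪ S) A c) := by
  classical
  induction S using Finset.induction_on with
  | empty => simp
  | insert i S hi ih =>
    have h1 := ih fun j hj => hS j (Finset.mem_insert_of_mem hj)
    have h2 : i ∉ T ∪ (S : Set (Fin n)) := fun h =>
      h.elim (hS i (Finset.mem_insert_self i S)) hi
    have h3 := Order.height_add_one_le (paramPrime_lt_insert K (A := A) (c := c) h2)
    rw [Finset.card_insert_of_notMem hi, Finset.coe_insert, Set.union_insert]
    refine le_trans ?_ h3
    push_cast
    rw [← add_assoc]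
    gcongr

theorem height_add_card_le_label (S : Finset (Fin n)) (hS : ∀ i ∈ S, i ∉ T ∧ c i = i ∧ i ∉ A) :
    Order.height (paramPrime K T A c) + S.card ≤
      Order.height (paramPrime K T (A ∪ S) c) := by
  classical
  induction S using Finset.induction_on with
  | empty => simp
  | insert i S hi ih =>
    have h1 := ih fun j hj => hS j (Finset.mem_insert_of_mem hj)
    obtain ⟨hiT, hci, hiA⟩ := hS i (Finset.mem_insert_self i S)
    have h2 : c i ∉ A ∪ (S : Set (Fin n)) := by
      rw [hci]
      exact fun h => h.elim hiA hi
    have h3 := Order.height_add_one_le (paramPrime_lt_insert_label K hiT h2)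
    rw [Finset.card_insert_of_notMem hi, Finset.coe_insert, Set.union_insert]
    rw [hci] at h3
    refine le_trans ?_ h3
    push_cast
    rw [← add_assoc]
    gcongr

theorem coheight_add_card_le_insert (S : Finset (Fin n)) (hS : ∀ i ∈ S, i ∉ T) :
    Order.coheight (paramPrime K (T ∪ S) A c) + S.card ≤
      Order.coheight (paramPrime K T A c) := by
  classical
  induction S using Finset.induction_on with
  | empty => simp
  | insert i S hi ih =>
    have h1 := ih fun j hj => hS j (Finset.mem_insert_of_mem hj)
    have h2 : i ∉ T ∪ (S : Set (Fin n)) := fun h =>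
      h.elim (hS i (Finset.mem_insert_self i S)) hi
    have h3 := Order.coheight_add_one_le (paramPrime_lt_insert K (A := A) (c := c) h2)
    rw [Finset.card_insert_of_notMem hi, Finset.coe_insert, Set.union_insert]
    refine le_trans ?_ h1
    push_cast
    rw [add_comm (S.card : ℕ∞), ← add_assoc]
    gcongr

theorem coheight_add_card_le_label (S : Finset (Fin n))
    (hS : ∀ i ∈ S, i ∉ T ∧ c i = i ∧ i ∉ A) :
    Order.coheight (paramPrime K T (A ∪ S) c) + S.card ≤
      Order.coheight (paramPrime K T A c) := by
  classical
  induction S using Finset.induction_on with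
  | empty => simp
  | insert i S hi ih =>
    have h1 := ih fun j hj => hS j (Finset.mem_insert_of_mem hj)
    obtain ⟨hiT, hci, hiA⟩ := hS i (Finset.mem_insert_self i S)
    have h2 : c i ∉ A ∪ (S : Set (Fin n)) := by
      rw [hci]
      exact fun h => h.elim hiA hi
    have h3 := Order.coheight_add_one_le (paramPrime_lt_insert_label K hiT h2)
    rw [Finset.card_insert_of_notMem hi, Finset.coe_insert, Set.union_insert]
    rw [hci] at h3
    refine le_trans ?_ h1
    push_cast
    rw [add_comm (S.card : ℕ∞), ← add_assoc]
    gcongr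

theorem card_le_height_merge (hc : ∀ i, c (c i) = c i) (S : Finset (Fin n))
    (hS : ∀ i ∈ S, c i ≠ i) :
    (S.card : ℕ∞) ≤ Order.height (paramPrime K ∅ ∅ (partialLabel c S)) := by
  classical
  induction S using Finset.induction_on with
  | empty => simp
  | insert i S hi ih =>
    have h1 := ih fun j hj => hS j (Finset.mem_insert_of_mem hj)
    have h3 := Order.height_add_one_le (paramPrime_lt_merge K (M := S) hc
      (fun h => hi (Finset.mem_coe.1 h)) (hS i (Finset.mem_insert_self i S)))
    rw [Finset.card_insert_of_notMem hi, Finset.coe_insert]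
    refine le_trans ?_ h3
    push_cast
    gcongr

/-- `c` labels the vertices in such a way that the vertices outside `T` have the same label if and
only if they lie in the same component of `G` after removal of `T`, and the vertices of `T` have
labels of their own; labels are vertices with this label. -/
structure IsLabelling (G : SimpleGraph (Fin n)) (T : Set (Fin n)) (c : Fin n → Fin n) : Prop where
  idem : ∀ i, c (c i) = c i
  eq_self : ∀ i ∈ T, c i = i
  notMem : ∀ i, i ∉ T → c i ∉ T
  adj_iff : ∀ i j, (completedComponents G T).Adj i j ↔ i ≠ j ∧ i ∉ T ∧ j ∉ T ∧ c i = c j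

open Classical in
/-- The number of labels outside `T`, which is the number of components. -/
noncomputable def labelCount (T : Set (Fin n)) (c : Fin n → Fin n) : ℕ :=
  (Finset.univ.filter fun i => i ∉ T ∧ c i = i).card

theorem minor_mem_of_adj {G : SimpleGraph (Fin n)} (h : G.Adj i j) :
    xv K i * yv K j - xv K j * yv K i ∈ binomialEdgeIdeal K G := by
  rcases lt_trichotomy i j with hlt | rfl | hlt
  · exact Ideal.subset_span ⟨i, j, hlt, h, rfl⟩
  · exact absurd rfl h.ne
  · rw [← neg_sub]
    exact neg_mem (Ideal.subset_span ⟨j, i, hlt, h.symm, rfl⟩)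

theorem minorIdeal_le (hc : IsLabelling G T c) :
    minorIdeal K c ≤ binomialEdgeIdeal K (completedComponents G T) := by
  refine Ideal.span_le.2 ?_
  rintro f ⟨i, j, hij, rfl⟩
  by_cases h : i = j
  · subst h
    rw [sub_self]
    exact Ideal.zero_mem _
  · refine minor_mem_of_adj K ((hc.adj_iff i j).2 ⟨h, fun hi => ?_, fun hj => ?_, hij⟩)
    · by_cases hj : j ∈ T
      · exact h (by rw [← hc.eq_self i hi, hij, hc.eq_self j hj])
      · exact hc.notMem j hj (hij ▸ (hc.eq_self i hi).symm ▸ hi)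
    · by_cases hi : i ∈ T
      · exact h (by rw [← hc.eq_self i hi, hij, hc.eq_self j hj])
      · exact hc.notMem i hi (hij ▸ (hc.eq_self j hj).symm ▸ hj)

/-- `P_T(G)` is the kernel of `param`; in particular it is a prime ideal. -/
theorem primeOf_eq (hc : IsLabelling G T c) : primeOf K G T = (paramPrime K T ∅ c).asIdeal := by
  classical
  refine le_antisymm (sup_le (Ideal.span_le.2 ?_) (Ideal.span_le.2 ?_)) fun f hf => ?_
  · rintro f ⟨i, hi, rfl | rfl⟩
    · change _ ∈ (paramPrime K T ∅ c).asIdeal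
      rw [mem_paramPrime, param_xv, if_pos (.inl hi)]
    · change _ ∈ (paramPrime K T ∅ c).asIdeal
      rw [mem_paramPrime, param_yv, if_pos hi]
  · rintro f ⟨i, j, -, hij, rfl⟩
    rw [hc.adj_iff] at hij
    change _ ∈ (paramPrime K T ∅ c).asIdeal
    rw [mem_paramPrime]
    simp only [map_sub, map_mul, param_xv, param_yv, Set.mem_empty_iff_false, or_false,
      hij.2.1, hij.2.2.1, if_false, hij.2.2.2]
    ring
  · rw [mem_paramPrime] at hf
    -- setting the variables of `T` to zero does not change the residue class of `f`
    let κ : PolyRing K n →ₐ[K] PolyRing K n := aeval (Sum.elim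
      (fun i => if i ∈ T then 0 else xv K i) (fun i => if i ∈ T then 0 else yv K i))
    have hκx : ∀ i, κ (xv K i) = if i ∈ T then 0 else xv K i := fun i => by
      simp only [κ]
      rw [xv, aeval_X, Sum.elim_inl, xv]
    have hκy : ∀ i, κ (yv K i) = if i ∈ T then 0 else yv K i := fun i => by
      simp only [κ]
      rw [yv, aeval_X, Sum.elim_inr, yv]
    set J : Ideal (PolyRing K n) := Ideal.span {f | ∃ i ∈ T, f = xv K i ∨ f = yv K i} with hJ
    have h1 : (Ideal.Quotient.mkₐ K J).comp κ = Ideal.Quotient.mkₐ K J := by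
      refine MvPolynomial.algHom_ext fun v => ?_
      rcases v with i | i
      · change Ideal.Quotient.mkₐ K J (κ (xv K i)) = Ideal.Quotient.mkₐ K J (xv K i)
        rw [hκx]
        split_ifs with hi
        · rw [map_zero]
          have hm : xv K i ∈ J := Ideal.subset_span ⟨i, hi, .inl rfl⟩
          exact (Ideal.Quotient.eq_zero_iff_mem.2 hm).symm
        · rfl
      · change Ideal.Quotient.mkₐ K J (κ (yv K i)) = Ideal.Quotient.mkₐ K J (yv K i)
        rw [hκy]
        split_ifs with hi
        · rw [map_zero]
          have hm : yv K i ∈ J := Ideal.subset_span ⟨i, hi, .inr rfl⟩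
          exact (Ideal.Quotient.eq_zero_iff_mem.2 hm).symm
        · rfl
    have h2 : (param K ∅ ∅ c).comp κ = param K T ∅ c := by
      refine MvPolynomial.algHom_ext fun v => ?_
      rcases v with i | i
      · change param K ∅ ∅ c (κ (xv K i)) = param K T ∅ c (xv K i)
        rw [hκx, param_xv]
        by_cases hi : i ∈ T
        · simp [hi]
        · simp [hi, param_xv]
      · change param K ∅ ∅ c (κ (yv K i)) = param K T ∅ c (yv K i)
        rw [hκy, param_yv]
        by_cases hi : i ∈ T
        · simp [hi]
        · simp [hi, param_yv]
    have h3 : κ f ∈ binomialEdgeIdeal K (completedComponents G T) := by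
      refine minorIdeal_le K hc (ker_param_le K ?_)
      rw [RingHom.mem_ker, ← hf, ← h2, AlgHom.comp_apply]
    have h4 : f - κ f ∈ J := by
      refine Ideal.Quotient.eq.1 ?_
      have := congrArg (fun l => l f) h1
      exact this.symm
    rw [← sub_add_cancel f (κ f)]
    exact Ideal.add_mem _ (Ideal.mem_sup_left h4) (Ideal.mem_sup_right h3)

theorem krullDim_polyRing : Order.krullDim (PrimeSpectrum (PolyRing K n)) = ((2 * n : ℕ) : ℕ∞) := by
  have h : ringKrullDim (PolyRing K n) = ringKrullDim K + Nat.card (Fin n ⊕ Fin n) :=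
    MvPolynomial.ringKrullDim_of_isNoetherianRing
  rw [ringKrullDim_eq_zero_of_field, zero_add, Nat.card_sum, Nat.card_fin, ← two_mul] at h
  exact h

theorem height_add_coheight_le (p : PrimeSpectrum (PolyRing K n)) :
    Order.height p + Order.coheight p ≤ (2 * n : ℕ) := by
  have h := krullDim_polyRing K (n := n)
  rw [Order.krullDim_eq_iSup_height_add_coheight_of_nonempty] at h
  have h' := WithBot.coe_injective h
  rw [← h']
  exact le_iSup (fun a => Order.height a + Order.coheight a) p

/-- The height of `P_T(G)` is `n + |T| - c(T)` and its coheight is `n + c(T) - |T|`. Both are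
bounded from below by chains of primes, and the bounds add up to the dimension `2n` of `S`. -/
theorem height_coheight_paramPrime (hc : IsLabelling G T c) :
    Order.height (paramPrime K T ∅ c) + labelCount T c = n + T.ncard ∧
    Order.coheight (paramPrime K T ∅ c) + T.ncard = n + labelCount T c := by
  classical
  set N := Finset.univ.filter fun i => c i ≠ i with hN
  set F := Finset.univ.filter fun i => i ∉ T ∧ c i = i with hF
  set D := Finset.univ.filter fun i => i ∉ T with hD
  set Tf := Finset.univ.filter fun i => i ∈ T with hTf
  have hTc : (Tf : Set (Fin n)) = T := by ext; simp [hTf]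
  have hTcard : T.ncard = Tf.card := by rw [← hTc, Set.ncard_coe_finset]
  have hcardD : Tf.card + D.card = n := by
    have := Finset.card_filter_add_card_filter_not (s := (Finset.univ : Finset (Fin n))) (· ∈ T)
    rwa [Finset.card_univ, Fintype.card_fin] at this
  have hcardN : F.card + N.card = D.card := by
    have h1 := Finset.card_filter_add_card_filter_not (s := D) (fun i => c i = i)
    have h2 : D.filter (fun i => c i = i) = F := by ext; simp [hD, hF]
    have h3 : D.filter (fun i => ¬ c i = i) = N := by
      ext i
      simp only [hD, hN, Finset.mem_filter, Finset.mem_univ, true_and]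
      exact ⟨fun h => h.2, fun h => ⟨fun hi => h (hc.eq_self i hi), h⟩⟩
    rwa [h2, h3] at h1
  have hlabel : partialLabel c N = c := by
    ext1 i
    unfold partialLabel
    split_ifs with h
    · rfl
    · simpa [hN, eq_comm] using h
  -- the chain of primes below: merge the labels, remove the `x_i`, then the `y_i` for `i ∈ T`
  have h1 := card_le_height_merge K hc.idem N fun i hi => (Finset.mem_filter.1 hi).2
  rw [hlabel] at h1
  have h2 := height_add_card_le_label K (T := ∅) (A := ∅) (c := c) Tf fun i hi =>
    ⟨fun h => h, hc.eq_self i (Finset.mem_filter.1 hi).2, fun h => h⟩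
  have h3 := height_add_card_le_insert K (T := ∅) (A := ∅ ∪ Tf) (c := c) Tf fun i _ h => h
  have h4 : paramPrime K (∅ ∪ Tf) (∅ ∪ Tf) c = paramPrime K T ∅ c := by
    have : param K T T c = param K T ∅ c := by
      refine MvPolynomial.algHom_ext fun v => ?_
      rcases v with i | i
      · change param K T T c (xv K i) = param K T ∅ c (xv K i)
        rw [param_xv, param_xv]
        have : c i ∈ T → i ∈ T := fun h => by_contra fun hi => hc.notMem i hi h
        by_cases hi : i ∈ T
        · simp [hi]
        · simp [hi, mt this hi]
      · change param K T T c (yv K i) = param K T ∅ c (yv K i)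
        rw [param_yv, param_yv]
    rw [Set.empty_union, hTc]
    refine PrimeSpectrum.ext ?_
    simp only [paramPrime, this]
  rw [h4] at h3
  -- the chain of primes above: remove all `x_i`, then all `y_i`
  have h5 := coheight_add_card_le_label K (T := T) (A := ∅) (c := c) F fun i hi =>
    ⟨(Finset.mem_filter.1 hi).2.1, (Finset.mem_filter.1 hi).2.2, fun h => h⟩
  have h6 := coheight_add_card_le_insert K (T := T) (A := ∅ ∪ F) (c := c) D fun i hi =>
    (Finset.mem_filter.1 hi).2
  have h7 := height_add_coheight_le K (paramPrime K T ∅ c)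
  have hl : labelCount T c = F.card := rfl
  have hh : ((N.card + Tf.card + Tf.card : ℕ) : ℕ∞) ≤ Order.height (paramPrime K T ∅ c) := by
    push_cast
    exact le_trans (by gcongr; exact le_trans (by gcongr) h2) h3
  have hcoh : ((D.card + F.card : ℕ) : ℕ∞) ≤ Order.coheight (paramPrime K T ∅ c) := by
    push_cast
    exact le_trans (by gcongr; exact le_trans (by simp) h6) h5
  rw [hl, hTcard]
  generalize Order.height (paramPrime K T ∅ c) = a at *
  generalize Order.coheight (paramPrime K T ∅ c) = b at *
  have ha : a ≠ ⊤ := fun h => by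
    rw [h, top_add] at h7
    exact absurd h7 (by norm_cast)
  have hb : b ≠ ⊤ := fun h => by
    rw [h, add_top] at h7
    exact absurd h7 (by norm_cast)
  lift a to ℕ using ha
  lift b to ℕ using hb
  norm_cast at *
  omega

end Heights

/-! ### Krull dimension and the minimal primes of minimum height -/

section Dimension

open MvPolynomial

variable (K : Type u) [Field K] {n : ℕ}
variable {G : SimpleGraph (Fin n)} {r : Fin n → ℕ} {T : Set (Fin n)} {c : Fin n → Fin n}

theorem binomialEdgeIdeal_le_primeOf (G : SimpleGraph (Fin n)) (T : Set (Fin n)) :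
    binomialEdgeIdeal K G ≤ primeOf K G T := by
  refine Ideal.span_le.2 ?_
  rintro f ⟨i, j, hlt, hij, rfl⟩
  have hT : ∀ k ∈ T, xv K k ∈ primeOf K G T ∧ yv K k ∈ primeOf K G T := fun k hk =>
    ⟨Ideal.mem_sup_left (Ideal.subset_span ⟨k, hk, .inl rfl⟩),
      Ideal.mem_sup_left (Ideal.subset_span ⟨k, hk, .inr rfl⟩)⟩
  by_cases hi : i ∈ T
  · exact sub_mem (Ideal.mul_mem_right _ _ (hT i hi).1) (Ideal.mul_mem_left _ _ (hT i hi).2)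
  by_cases hj : j ∈ T
  · exact sub_mem (Ideal.mul_mem_left _ _ (hT j hj).2) (Ideal.mul_mem_right _ _ (hT j hj).1)
  have hadj : (G.induce Tᶜ).Adj ⟨i, hi⟩ ⟨j, hj⟩ := hij
  exact Ideal.mem_sup_right (Ideal.subset_span ⟨i, j, hlt, ⟨hij.ne, hi, hj, hadj.reachable⟩, rfl⟩)

/-- Modulo a prime ideal containing `J_G`, the minors propagate along paths that avoid the vertices
both of whose variables lie in the ideal. -/
theorem exists_primeOf_le {Q : Ideal (PolyRing K n)} [hQ : Q.IsPrime]
    (h : binomialEdgeIdeal K G ≤ Q) : ∃ T : Set (Fin n), primeOf K G T ≤ Q := by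
  refine ⟨{i | xv K i ∈ Q ∧ yv K i ∈ Q}, sup_le (Ideal.span_le.2 ?_) (Ideal.span_le.2 ?_)⟩
  · rintro f ⟨i, hi, rfl | rfl⟩
    exacts [hi.1, hi.2]
  · rintro f ⟨i, j, -, ⟨-, hi, hj, hreach⟩, rfl⟩
    obtain ⟨p⟩ := hreach
    have key : ∀ (a b : ({i | xv K i ∈ Q ∧ yv K i ∈ Q}ᶜ : Set (Fin n)))
        (p : (G.induce ({i | xv K i ∈ Q ∧ yv K i ∈ Q}ᶜ)).Walk a b),
        xv K a.1 * yv K b.1 - xv K b.1 * yv K a.1 ∈ Q := by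
      intro a b p
      induction p with
      | nil => rw [sub_self]; exact Q.zero_mem
      | @cons a k b hak p ih =>
        have h1 : xv K a.1 * yv K k.1 - xv K k.1 * yv K a.1 ∈ Q :=
          h (minor_mem_of_adj K (show G.Adj a.1 k.1 from hak))
        have hx : xv K k.1 * (xv K a.1 * yv K b.1 - xv K b.1 * yv K a.1) ∈ Q := by
          have e : xv K k.1 * (xv K a.1 * yv K b.1 - xv K b.1 * yv K a.1) =
              xv K a.1 * (xv K k.1 * yv K b.1 - xv K b.1 * yv K k.1) +
                xv K b.1 * (xv K a.1 * yv K k.1 - xv K k.1 * yv K a.1) := by ring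
          rw [e]
          exact add_mem (Q.mul_mem_left _ ih) (Q.mul_mem_left _ h1)
        have hy : yv K k.1 * (xv K a.1 * yv K b.1 - xv K b.1 * yv K a.1) ∈ Q := by
          have e : yv K k.1 * (xv K a.1 * yv K b.1 - xv K b.1 * yv K a.1) =
              yv K a.1 * (xv K k.1 * yv K b.1 - xv K b.1 * yv K k.1) +
                yv K b.1 * (xv K a.1 * yv K k.1 - xv K k.1 * yv K a.1) := by ring
          rw [e]
          exact add_mem (Q.mul_mem_left _ ih) (Q.mul_mem_left _ h1)
        rcases hQ.mem_or_mem hx with hx | hx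
        · rcases hQ.mem_or_mem hy with hy | hy
          · exact absurd ⟨hx, hy⟩ k.2
          · exact hy
        · exact hx
    exact key ⟨i, hi⟩ ⟨j, hj⟩ p

/-- If `d = n + c(T₀) - |T₀|` is the maximum of the numbers `n + c(T) - |T|`, which are the
dimensions of the rings `S / P_T(G)`, then `d` is the dimension of `S / J_G`, and `P_{T₀}(G)` is a
minimal prime ideal of minimum height. -/
theorem ringKrullDim_and_mem_minHeightPrimes {c : Set (Fin n) → Fin n → Fin n}
    (hc : ∀ T, IsLabelling G T (c T)) {d : ℕ} {T₀ : Set (Fin n)}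
    (h1 : d + T₀.ncard = n + labelCount T₀ (c T₀))
    (h2 : ∀ T : Set (Fin n), n + labelCount T (c T) ≤ d + T.ncard) :
    ringKrullDim (PolyRing K n ⧸ binomialEdgeIdeal K G) = (d : WithBot ℕ∞) ∧
      primeOf K G T₀ ∈ minHeightPrimes K G := by
  set P : Set (Fin n) → PrimeSpectrum (PolyRing K n) := fun T => paramPrime K T ∅ (c T) with hP
  have hPe : ∀ T, primeOf K G T = (P T).asIdeal := fun T => primeOf_eq K (hc T)
  have hJP : ∀ T, binomialEdgeIdeal K G ≤ (P T).asIdeal := fun T =>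
    hPe T ▸ binomialEdgeIdeal_le_primeOf K G T
  have hcoh : ∀ T, Order.coheight (P T) ≤ d := fun T => by
    have h := (height_coheight_paramPrime K (hc T)).2
    change Order.coheight (P T) + _ = _ at h
    have hT := h2 T
    generalize Order.coheight (P T) = a at *
    have ha : a ≠ ⊤ := fun ht => by
      rw [ht, top_add] at h
      exact absurd h (by norm_cast)
    lift a to ℕ using ha
    norm_cast at *
    omega
  have hcoh0 : (d : ℕ∞) ≤ Order.coheight (P T₀) := by
    have h := (height_coheight_paramPrime K (hc T₀)).2
    change Order.coheight (P T₀) + _ = _ at h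
    generalize Order.coheight (P T₀) = a at *
    have ha : a ≠ ⊤ := fun ht => by
      rw [ht, top_add] at h
      exact absurd h (by norm_cast)
    lift a to ℕ using ha
    norm_cast at *
    omega
  have hht : ∀ T, (P T₀).asIdeal.height ≤ (P T).asIdeal.height := fun T => by
    rw [PrimeSpectrum.height_eq_orderHeight, PrimeSpectrum.height_eq_orderHeight]
    have h := (height_coheight_paramPrime K (hc T)).1
    have h0 := (height_coheight_paramPrime K (hc T₀)).1
    change Order.height (P T) + _ = _ at h
    change Order.height (P T₀) + _ = _ at h0
    have hT := h2 T
    generalize Order.height (P T) = a at *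
    generalize Order.height (P T₀) = b at *
    have ha : a ≠ ⊤ := fun ht => by
      rw [ht, top_add] at h
      exact absurd h (by norm_cast)
    have hb : b ≠ ⊤ := fun ht => by
      rw [ht, top_add] at h0
      exact absurd h0 (by norm_cast)
    lift a to ℕ using ha
    lift b to ℕ using hb
    norm_cast at *
    omega
  have hle : ∀ Q : Ideal (PolyRing K n), Q.IsPrime → binomialEdgeIdeal K G ≤ Q →
      ∃ T, (P T).asIdeal ≤ Q := fun Q _ hQ => by
    obtain ⟨T, hT⟩ := exists_primeOf_le K hQ
    exact ⟨T, hPe T ▸ hT⟩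
  refine ⟨?_, ?_, ?_⟩
  · rw [ringKrullDim_quotient]
    refine le_antisymm (iSup_le fun l => ?_) ?_
    · obtain ⟨T, hT⟩ := hle _ l.head.1.2 l.head.2
      have h3 := Order.length_le_coheight (x := P T) (p := l.map
        (Subtype.val : PrimeSpectrum.zeroLocus (binomialEdgeIdeal K G : Set (PolyRing K n)) →
          PrimeSpectrum (PolyRing K n)) (fun _ _ h => h)) hT
      have h4 : (l.length : ℕ∞) ≤ d := le_trans h3 (hcoh T)
      exact_mod_cast h4
    · obtain ⟨l, hl, hlen⟩ := Order.exists_series_of_le_coheight (P T₀) hcoh0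
      have hmem : ∀ i, l i ∈ PrimeSpectrum.zeroLocus
          (binomialEdgeIdeal K G : Set (PolyRing K n)) := fun i =>
        (PrimeSpectrum.mem_zeroLocus _ _).2 (le_trans (hJP T₀) (hl ▸ l.head_le i))
      let l' : LTSeries (PrimeSpectrum.zeroLocus (binomialEdgeIdeal K G : Set (PolyRing K n))) :=
        { length := l.length
          toFun := fun i => ⟨l i, hmem i⟩
          step := fun i => l.step i }
      have h5 := Order.LTSeries.length_le_krullDim l'
      rw [← hlen]
      exact h5
  · refine ⟨⟨hPe T₀ ▸ (P T₀).2, hPe T₀ ▸ hJP T₀⟩, fun Q hQ hQP => ?_⟩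
    have := hQ.1
    obtain ⟨T, hT⟩ := hle Q hQ.1 hQ.2
    rw [hPe] at hQP ⊢
    have := (P T₀).2
    exact (Ideal.eq_of_le_of_height_le _ hQP ((hht T).trans (Ideal.height_mono hT))).ge
  · intro Q hQ
    obtain ⟨T, hT⟩ := hle Q hQ.1.1 hQ.1.2
    rw [hPe]
    exact (hht T).trans (Ideal.height_mono hT)

open Classical in
/-- The labelling by the vertices of lowest rank of the components outside `T`. -/
noncomputable def rootLabel (G : SimpleGraph (Fin n)) (r : Fin n → ℕ) (T : Set (Fin n))
    (i : Fin n) : Fin n :=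
  if i ∈ T then i else root G r (Finset.univ \ fs T) i

theorem isLabelling_rootLabel (hr : IsPerfectRank G r) (T : Set (Fin n)) :
    IsLabelling G T (rootLabel G r T) := by
  have hmem : ∀ i, i ∈ Finset.univ \ fs T ↔ i ∉ T := fun i => by simp [mem_fs]
  have hroot : ∀ i, i ∉ T → root G r (Finset.univ \ fs T) i ∈ minima G r (Finset.univ \ fs T) :=
    fun i hi => root_mem_minima hr ((hmem i).2 hi)
  have hrootT : ∀ i, i ∉ T → root G r (Finset.univ \ fs T) i ∉ T := fun i hi =>
    (hmem _).1 (mem_minima.1 (hroot i hi)).1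
  refine ⟨fun i => ?_, fun i hi => if_pos hi, fun i hi => ?_, fun i j => ?_⟩
  · by_cases hi : i ∈ T
    · rw [show rootLabel G r T i = i from if_pos hi, show rootLabel G r T i = i from if_pos hi]
    · rw [show rootLabel G r T i = _ from if_neg hi, rootLabel, if_neg (hrootT i hi)]
      exact root_eq_self (hroot i hi)
  · simp only [rootLabel, if_neg hi]
    exact hrootT i hi
  · have hreach : ∀ i (hi : i ∈ Tᶜ), ∃ hx : root G r (Finset.univ \ fs T) i ∈ Tᶜ,
        (G.induce Tᶜ).Reachable ⟨i, hi⟩ ⟨_, hx⟩ := fun i hi => by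
      refine root_induction (G := G) (r := r) (W := Finset.univ \ fs T)
        (P := fun a b => ∀ ha : a ∈ Tᶜ, ∃ hb : b ∈ Tᶜ, (G.induce Tᶜ).Reachable ⟨a, ha⟩ ⟨b, hb⟩)
        (fun w _ hw => ⟨hw, .rfl⟩) (fun w _ x hx y hwx h hw => ?_) ((hmem i).2 hi) hi
      obtain ⟨hy, hr⟩ := h ((hmem x).1 hx)
      have hadj : (G.induce Tᶜ).Adj ⟨w, hw⟩ ⟨x, (hmem x).1 hx⟩ := hwx
      exact ⟨hy, hadj.reachable.trans hr⟩
    constructor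
    · rintro ⟨hne, hi, hj, ⟨p⟩⟩
      refine ⟨hne, hi, hj, ?_⟩
      have key : ∀ (a b : (Tᶜ : Set (Fin n))) (p : (G.induce Tᶜ).Walk a b),
          root G r (Finset.univ \ fs T) a.1 = root G r (Finset.univ \ fs T) b.1 := by
        intro a b p
        induction p with
        | nil => rfl
        | @cons a k b hak p ih =>
          exact (root_eq_of_adj hr ((hmem _).2 a.2) ((hmem _).2 k.2) hak).trans ih
      have hi' : i ∉ T := hi
      have hj' : j ∉ T := hj
      simp only [rootLabel, if_neg hi', if_neg hj']
      exact key ⟨i, hi⟩ ⟨j, hj⟩ p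
    · rintro ⟨hne, hi, hj, he⟩
      simp only [rootLabel, if_neg hi, if_neg hj] at he
      obtain ⟨h1, h2⟩ := hreach i hi
      obtain ⟨h3, h4⟩ := hreach j hj
      refine ⟨hne, hi, hj, h2.trans ?_⟩
      have : (⟨root G r (Finset.univ \ fs T) i, h1⟩ : (Tᶜ : Set (Fin n))) = ⟨_, h3⟩ :=
        Subtype.ext he
      rw [this]
      exact h4.symm

theorem labelCount_rootLabel (hr : IsPerfectRank G r) (T : Set (Fin n)) :
    labelCount T (rootLabel G r T) = comp G r (Finset.univ \ fs T) := by
  classical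
  rw [labelCount, comp]
  congr 1
  ext i
  have hmem : ∀ i, i ∈ Finset.univ \ fs T ↔ i ∉ T := fun i => by simp [mem_fs]
  simp only [Finset.mem_filter, Finset.mem_univ, true_and]
  constructor
  · rintro ⟨hi, he⟩
    rw [rootLabel, if_neg hi] at he
    exact he ▸ root_mem_minima hr ((hmem i).2 hi)
  · intro h
    have hi := (hmem i).1 (mem_minima.1 h).1
    exact ⟨hi, by rw [rootLabel, if_neg hi]; exact root_eq_self h⟩

/-- Correctness of every run of the algorithm. -/
theorem correct_of_stuck (hB : IsBlockGraph (⊤ : G.Subgraph)) (hc : G.Connected)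
    (hr : IsPerfectRank G r) {s : AlgState G} (h : Reachable s) (hs : ∀ s', ¬ Step s s') :
    IsFinished s ∧
      ringKrullDim (PolyRing K n ⧸ binomialEdgeIdeal K G) = (s.dim : WithBot ℕ∞) ∧
      IsCutset (⊤ : G.Subgraph) s.taken ∧ primeOf K G s.taken ∈ minHeightPrimes K G := by
  have hf := isFinished_of_stuck hB hr (h.isRegular hB.cycleClosed) hs
  obtain ⟨h1, h2⟩ := (h.isSound hB hr hc).optimal hr hc hf
  have hcard : ∀ T : Set (Fin n), (fs T).card = T.ncard := fun T => by
    rw [← Set.ncard_coe_finset]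
    congr 1
    ext
    simp [mem_fs]
  have h3 := ringKrullDim_and_mem_minHeightPrimes K (d := s.dim) (T₀ := s.taken)
    (isLabelling_rootLabel hr)
    (by rw [labelCount_rootLabel hr, ← hcard, h1, Nat.card_eq_fintype_card, Fintype.card_fin])
    (fun T => by
      have := h2 (fs T)
      rwa [Nat.card_eq_fintype_card, Fintype.card_fin, hcard, ← labelCount_rootLabel hr] at this)
  exact ⟨hf, h3.1, isCutset_of_optimal hr h1 h2, h3.2⟩

end Dimension

/-! ### Reasoning about programs -/

section Programs

/-- Started with memory `m`, the program `p` halts after at most `b` steps, with a memory that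
satisfies `Q`. -/
def Runs (p : Prog) (m : Mem) (b : ℕ) (Q : Mem → Prop) : Prop :=
  ∃ t m', Exec p m t m' ∧ t ≤ b ∧ Q m'

variable {p q : Prog} {m : Mem} {b b' : ℕ} {Q Q' : Mem → Prop}

theorem Runs.mono (h : Runs p m b Q) (hb : b ≤ b') (hQ : ∀ m', Q m' → Q' m') : Runs p m b' Q' := by
  obtain ⟨t, m', h1, h2, h3⟩ := h
  exact ⟨t, m', h1, h2.trans hb, hQ _ h3⟩

theorem Runs.skip (h : Q m) : Runs .skip m 1 Q :=
  ⟨1, _, .skip m, le_rfl, h⟩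

theorem Runs.const {r k : ℕ} (h : Q (m.setReg r k)) : Runs (.const r k) m 1 Q :=
  ⟨1, _, .const m r k, le_rfl, h⟩

theorem Runs.copy {r s : ℕ} (h : Q (m.setReg r (m.reg s))) : Runs (.copy r s) m 1 Q :=
  ⟨1, _, .copy m r s, le_rfl, h⟩

theorem Runs.inc {r : ℕ} (h : Q (m.setReg r (m.reg r + 1))) : Runs (.inc r) m 1 Q :=
  ⟨1, _, .inc m r, le_rfl, h⟩

theorem Runs.dec {r : ℕ} (h : Q (m.setReg r (m.reg r - 1))) : Runs (.dec r) m 1 Q :=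
  ⟨1, _, .dec m r, le_rfl, h⟩

theorem Runs.load {r a i : ℕ} (h : Q (m.setReg r (m.arr a (m.reg i)))) :
    Runs (.load r a i) m 1 Q :=
  ⟨1, _, .load m r a i, le_rfl, h⟩

theorem Runs.store {a i r : ℕ} (h : Q (m.setArr a (m.reg i) (m.reg r))) :
    Runs (.store a i r) m 1 Q :=
  ⟨1, _, .store m a i r, le_rfl, h⟩

theorem Runs.seq (h : Runs p m b fun m' => Runs q m' b' Q) : Runs (.seq p q) m (b + b') Q := by
  obtain ⟨t, m', h1, h2, t', m'', h3, h4, h5⟩ := h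
  exact ⟨t + t', m'', .seq _ _ _ _ _ _ _ h1 h3, add_le_add h2 h4, h5⟩

theorem Runs.ite {c : Test} (h1 : c.Holds m → Runs p m b Q) (h2 : ¬ c.Holds m → Runs q m b Q) :
    Runs (.ite c p q) m (b + 1) Q := by
  by_cases hc : c.Holds m
  · obtain ⟨t, m', h3, h4, h5⟩ := h1 hc
    exact ⟨t + 1, m', .iteTrue _ _ _ _ _ _ hc h3, Nat.succ_le_succ h4, h5⟩
  · obtain ⟨t, m', h3, h4, h5⟩ := h2 hc
    exact ⟨t + 1, m', .iteFalse _ _ _ _ _ _ hc h3, Nat.succ_le_succ h4, h5⟩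

/-- The rule for loops with `N` passes: `I k φ` is the invariant after `k` passes, where `φ` is a
bound for the time that the remaining passes will take. -/
theorem Runs.loop {c : Test} {N : ℕ} {I : ℕ → ℕ → Mem → Prop}
    (htest : ∀ k φ m, k ≤ N → I k φ m → (c.Holds m ↔ k < N))
    (hbody : ∀ k φ m, k < N → I k φ m →
      ∃ φ' b, b + 1 + φ' ≤ φ ∧ Runs p m b (I (k + 1) φ')) {φ : ℕ} (h0 : I 0 φ m) :
    Runs (.loop c p) m (φ + 1) fun m' => ∃ φ', I N φ' m' := by
  have key : ∀ j k φ m, k + j = N → I k φ m →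
      Runs (.loop c p) m (φ + 1) fun m' => ∃ φ', I N φ' m' := by
    intro j
    induction j with
    | zero =>
      intro k φ m hk hI
      have hkN : k = N := hk
      subst hkN
      exact ⟨1, m, .loopDone _ _ _ (by simp [htest k φ m le_rfl hI]), by omega, φ, hI⟩
    | succ j ih =>
      intro k φ m hk hI
      have hlt : k < N := by omega
      obtain ⟨φ', b, hb, t, m', h1, h2, h3⟩ := hbody k φ m hlt hI
      obtain ⟨t', m'', h4, h5, h6⟩ := ih (k + 1) φ' m' (by omega) h3
      exact ⟨t + t' + 1, m'', .loopStep _ _ _ _ _ _ _ ((htest k φ m hlt.le hI).2 hlt) h1 h4,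
        by omega, h6⟩
  exact key N 0 φ m (zero_add N) h0

/-- The rule for loops with `N` passes, each of which takes at most `B` steps. -/
theorem Runs.loop_const {c : Test} {N B : ℕ} {I : ℕ → Mem → Prop}
    (htest : ∀ k m, k ≤ N → I k m → (c.Holds m ↔ k < N))
    (hbody : ∀ k m, k < N → I k m → Runs p m B (I (k + 1))) (h0 : I 0 m) :
    Runs (.loop c p) m ((B + 1) * N + 1) (I N) := by
  refine (Runs.loop (N := N) (I := fun k φ m => I k m ∧ φ = (B + 1) * (N - k))
    (fun k φ m hk h => htest k m hk h.1) (fun k φ m hk h => ⟨(B + 1) * (N - (k + 1)), B, ?_,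
      (hbody k m hk h.1).mono le_rfl fun m' h' => ⟨h', rfl⟩⟩) ⟨h0, rfl⟩).mono le_rfl
    fun m' h => h.choose_spec.1
  obtain ⟨j, rfl⟩ := Nat.exists_eq_add_of_lt hk
  rw [h.2, show k + j + 1 - k = j + 1 by omega, show k + j + 1 - (k + 1) = j by omega, mul_add]
  omega

@[simp] theorem Mem.setReg_reg (m : Mem) (r s x : ℕ) :
    (m.setReg r x).reg s = if s = r then x else m.reg s := by
  simp [Mem.setReg, Function.update_apply]

@[simp] theorem Mem.setReg_arr (m : Mem) (r x : ℕ) : (m.setReg r x).arr = m.arr := rfl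

@[simp] theorem Mem.setArr_reg (m : Mem) (a i x : ℕ) : (m.setArr a i x).reg = m.reg := rfl

@[simp] theorem Mem.setArr_arr (m : Mem) (a i x b j : ℕ) :
    (m.setArr a i x).arr b j = if b = a ∧ j = i then x else m.arr b j := by
  by_cases hb : b = a
  · subst hb
    simp [Mem.setArr, Function.update_apply]
  · simp [Mem.setArr, hb]

end Programs

/-! ### Adjacency lists -/

section Adjacency

variable {n : ℕ} {G : SimpleGraph (Fin n)} {L : Fin n → List (Fin n)}

/-- The arrays `0` and `1` of `m` contain the adjacency lists `L`. -/
structure HoldsLists (L : Fin n → List (Fin n)) (m : Mem) : Prop where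
  next : ∀ v : Fin n, m.arr 0 (v + 1) = m.arr 0 v + (L v).length
  entry : ∀ (v : Fin n) (k : ℕ) (hk : k < (L v).length), m.arr 1 (m.arr 0 v + k) = (L v)[k]

theorem holdsLists_inputMem (L : Fin n → List (Fin n)) : HoldsLists L (inputMem L) := by
  have hlen : (List.ofFn L).length = n := List.length_ofFn
  have hget : ∀ v : Fin n, (List.ofFn L)[(v : ℕ)]'(by rw [hlen]; exact v.2) = L v := fun v => by
    rw [List.getElem_ofFn]
  constructor
  · intro v
    simp only [inputMem, if_true]
    rw [List.take_add_one, List.getElem?_eq_getElem (by rw [hlen]; exact v.2), hget]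
    simp
  · intro v k hk
    have hv : (v : ℕ) < (List.ofFn L).length := by rw [hlen]; exact v.2
    simp only [inputMem, if_true, one_ne_zero, if_false]
    have hsplit : List.ofFn L = (List.ofFn L).take v ++ L v :: (List.ofFn L).drop (v + 1) := by
      conv_lhs => rw [← List.take_append_drop v (List.ofFn L), List.drop_eq_getElem_cons hv, hget]
    have hf : (List.ofFn L).flatten = ((List.ofFn L).take v).flatten ++
        (L v ++ ((List.ofFn L).drop (v + 1)).flatten) := by
      conv_lhs => rw [hsplit]
      rw [List.flatten_append, List.flatten_cons]
    rw [hf, List.map_append, List.map_append, ← List.length_flatten]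
    generalize ((List.ofFn L).take v).flatten = A
    rw [List.getD_append_right _ _ _ _ (by simp), List.getD_append _ _ _ _ (by simpa using hk)]
    simp [hk]

theorem IsAdjacencyList.sum_length (h : IsAdjacencyList G L) :
    ∑ v, (L v).length = 2 * G.edgeSet.ncard := by
  classical
  rw [Set.ncard_eq_toFinset_card', ← SimpleGraph.edgeFinset,
    ← SimpleGraph.sum_degrees_eq_twice_card_edges]
  refine Finset.sum_congr rfl fun v _ => ?_
  rw [← List.toFinset_card_of_nodup (h v).1, ← SimpleGraph.card_neighborFinset_eq_degree]
  congr 1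
  ext w
  simp [(h v).2]

end Adjacency

/-! ### Breadth-first search -/

section Search

variable {n : ℕ} {G : SimpleGraph (Fin n)} {L : Fin n → List (Fin n)} {x₀ v w : Fin n}
  {r : Fin n → ℕ} {p : Fin n → Fin n} {t k : ℕ}

/-- A breadth-first search from `x₀` that has discovered `t` vertices: `r v` is the number of
vertices discovered before `v`, with the value `n` for undiscovered vertices, and `p v` is the
vertex from which `v` was discovered. -/
structure IsSearch (G : SimpleGraph (Fin n)) (x₀ : Fin n) (r : Fin n → ℕ) (p : Fin n → Fin n)
    (t : ℕ) : Prop where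
  inj : ∀ u v, r u < t → r u = r v → u = v
  far : ∀ v, ¬ r v < t → r v = n
  surj : ∀ i < t, ∃ v, r v = i
  root : r x₀ = 0
  pos : 0 < t
  parent : ∀ v, r v < t → v ≠ x₀ → G.Adj v (p v) ∧ r (p v) < r v ∧ ∀ u, G.Adj v u → r (p v) ≤ r u

/-- All neighbours of the first `k` vertices have been discovered. -/
def IsScanned (G : SimpleGraph (Fin n)) (r : Fin n → ℕ) (t k : ℕ) : Prop :=
  ∀ v, r v < k → ∀ u, G.Adj v u → r u < t

theorem IsSearch.le (h : IsSearch G x₀ r p t) : t ≤ n := by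
  have h1 : Finset.range t ⊆ Finset.univ.image r := fun i hi => by
    obtain ⟨v, rfl⟩ := h.surj i (Finset.mem_range.1 hi)
    exact Finset.mem_image_of_mem r (Finset.mem_univ v)
  calc t = (Finset.range t).card := (Finset.card_range t).symm
    _ ≤ (Finset.univ.image r).card := Finset.card_le_card h1
    _ ≤ (Finset.univ : Finset (Fin n)).card := Finset.card_image_le
    _ = n := by simp

theorem IsSearch.lt (h : IsSearch G x₀ r p t) (hw : ¬ r w < t) : t < n := by
  have h1 : Finset.range t ⊆ (Finset.univ.erase w).image r := fun i hi => by
    obtain ⟨v, rfl⟩ := h.surj i (Finset.mem_range.1 hi)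
    refine Finset.mem_image_of_mem r (Finset.mem_erase.2 ⟨?_, Finset.mem_univ v⟩)
    rintro rfl
    exact hw (Finset.mem_range.1 hi)
  calc t = (Finset.range t).card := (Finset.card_range t).symm
    _ ≤ ((Finset.univ.erase w).image r).card := Finset.card_le_card h1
    _ ≤ (Finset.univ.erase w).card := Finset.card_image_le
    _ < (Finset.univ : Finset (Fin n)).card := Finset.card_erase_lt_of_mem (Finset.mem_univ w)
    _ = n := by simp

/-- When the queue is empty, a connected graph has been searched completely. -/
theorem IsSearch.lt_of_scanned (h : IsSearch G x₀ r p t) (hc : G.Connected)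
    (hs : IsScanned G r t t) (v : Fin n) : r v < t := by
  obtain ⟨q⟩ := hc.preconnected x₀ v
  have key : ∀ a b, G.Walk a b → r a < t → r b < t := by
    intro a b q
    induction q with
    | nil => exact id
    | @cons a c b hac q ih => exact fun ha => ih (hs a ha c hac)
  exact key x₀ v q (h.root ▸ h.pos)

theorem IsSearch.eq_of_forall_lt (h : IsSearch G x₀ r p t) (hs : ∀ v, r v < t) : t = n := by
  refine le_antisymm h.le ?_
  calc n = (Finset.univ.image r).card := by
        rw [Finset.card_image_of_injective _ fun u v huv => h.inj u v (hs u) huv]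
        simp
    _ ≤ (Finset.range t).card := Finset.card_le_card fun i hi => by
        obtain ⟨v, -, rfl⟩ := Finset.mem_image.1 hi
        exact Finset.mem_range.2 (hs v)
    _ = t := Finset.card_range t

/-- Discovering a neighbour `w` of the vertex `v` that is being scanned. The parent `v` has the
lowest rank among the neighbours of `w`, as the neighbours of all earlier vertices have been
discovered. -/
theorem IsSearch.visit (h : IsSearch G x₀ r p t) (hs : IsScanned G r t (r v)) (hv : r v < t)
    (hvw : G.Adj v w) (hw : ¬ r w < t) :
    IsSearch G x₀ (Function.update r w t) (Function.update p w v) (t + 1) := by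
  have htn := h.lt hw
  have ne : ∀ {u}, r u < t → u ≠ w := fun hu e => hw (e ▸ hu)
  have upd : ∀ {u}, u ≠ w → Function.update r w t u = r u := fun hu =>
    Function.update_of_ne hu _ _
  refine ⟨fun u u' hu huu' => ?_, fun u hu => ?_, fun i hi => ?_, ?_, Nat.succ_pos t,
    fun u hu hu0 => ?_⟩
  · by_cases h1 : u = w
    · by_cases h2 : u' = w
      · rw [h1, h2]
      · rw [h1, Function.update_self, upd h2] at huu'
        have := h.far u' (by omega)
        omega
    · rw [upd h1] at hu huu'
      by_cases h2 : u' = w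
      · rw [h2, Function.update_self] at huu'
        have := h.far u (by omega)
        omega
      · rw [upd h2] at huu'
        by_cases hlt : r u < t
        · exact h.inj u u' hlt huu'
        · have := h.far u hlt
          omega
  · by_cases h1 : u = w
    · rw [h1, Function.update_self] at hu
      omega
    · rw [upd h1] at hu ⊢
      exact h.far u (by omega)
  · rcases Nat.lt_succ_iff_lt_or_eq.1 hi with hi | rfl
    · obtain ⟨u, rfl⟩ := h.surj i hi
      exact ⟨u, upd (ne hi)⟩
    · exact ⟨w, Function.update_self _ _ _⟩
  · rw [upd (ne (h.root ▸ h.pos)), h.root]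
  · by_cases h1 : u = w
    · subst h1
      rw [Function.update_self, Function.update_self, upd (ne hv)]
      refine ⟨hvw.symm, hv, fun u' hu' => ?_⟩
      rw [upd hu'.ne']
      by_contra hlt
      exact hw (hs u' (by omega) u hu'.symm)
    · rw [upd h1] at hu
      have hut : r u < t := by
        by_contra hlt
        have := h.far u hlt
        omega
      obtain ⟨h2, h3, h4⟩ := h.parent u hut hu0
      rw [Function.update_of_ne h1, upd (ne (h3.trans hut)), upd h1]
      refine ⟨h2, h3, fun u' hu' => ?_⟩
      by_cases h5 : u' = w
      · rw [h5, Function.update_self]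
        omega
      · rw [upd h5]
        exact h4 u' hu'

/-- Initialization: `reg 0` becomes `n + 1`, and the vertex `0` is put into the queue. The
registers `2`, `3`, `4` hold the constants `1`, `3`, `0`, the registers `5`, `6` hold the ends of
the queue. -/
def initProg : Prog :=
  .seq (.inc 0) <| .seq (.const 2 1) <| .seq (.const 3 3) <| .seq (.const 6 1) (.store 3 4 2)

/-- Put the ends of the adjacency list of the vertex in `reg 7` into the registers `8` and `9`. -/
def openList : Prog :=
  .seq (.load 8 0 7) <| .seq (.copy 9 7) <| .seq (.inc 9) (.load 9 0 9)

/-- Read the next neighbour from the adjacency list of the vertex in `reg 7`. If the array `3` says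
that it has not been discovered, then note this there, note its parent in the array `5` and its
initial count `1` in the array `6`, and append it to the queue in the array `4`. -/
def visitProg : Prog :=
  .seq (.load 10 1 8) <| .seq (.load 11 3 10) <| .seq
    (.ite (.eq 11 4)
      (.seq (.store 3 10 2) <| .seq (.store 5 10 7) <| .seq (.store 6 10 2) <|
        .seq (.store 4 6 10) (.inc 6))
      .skip)
    (.inc 8)

/-- Breadth-first search. -/
def searchProg : Prog :=
  .loop (.lt 5 6) <| .seq (.load 7 4 5) <| .seq openList <|
    .seq (.loop (.lt 8 9) visitProg) (.inc 5)

/-- The memory during the search, when the first `k` vertices have been treated. -/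
structure SearchMem (L : Fin n → List (Fin n)) (x₀ : Fin n) (r : Fin n → ℕ) (p : Fin n → Fin n)
    (t k : ℕ) (m : Mem) : Prop where
  lists : HoldsLists L m
  reg0 : m.reg 0 = n + 1
  reg2 : m.reg 2 = 1
  reg3 : m.reg 3 = 3
  reg4 : m.reg 4 = 0
  reg5 : m.reg 5 = k
  reg6 : m.reg 6 = t
  queue : ∀ v, r v < t → m.arr 4 (r v) = v
  found : ∀ v : Fin n, m.arr 3 v = if r v < t then 1 else 0
  parent : ∀ v : Fin n, r v < t → v ≠ x₀ → m.arr 5 v = p v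
  count : ∀ v : Fin n, r v < t → m.arr 6 v = if v = x₀ then 0 else 1
  taken : ∀ v : Fin n, m.arr 2 v = 0
  mark : ∀ v : Fin n, m.arr 7 v = 0

/-- A bound for the number of steps that the search needs for all but the first `k` vertices. -/
def cost (L : Fin n → List (Fin n)) (r : Fin n → ℕ) (k : ℕ) : ℕ :=
  ∑ v with k ≤ r v, (10 * (L v).length + 8)

theorem HoldsLists.setReg {m : Mem} (h : HoldsLists L m) (a x : ℕ) : HoldsLists L (m.setReg a x) :=
  ⟨h.next, h.entry⟩

theorem HoldsLists.setArr {m : Mem} (h : HoldsLists L m) {a : ℕ} (ha : 2 ≤ a) (i x : ℕ) :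
    HoldsLists L (m.setArr a i x) := by
  have h0 : 0 ≠ a := by omega
  have h1 : 1 ≠ a := by omega
  constructor
  · intro v
    simp [h0, h.next]
  · intro v k hk
    simp [h0, h1, h.entry v k hk]

theorem runs_openList {m : Mem} {v : Fin n} (hL : HoldsLists L m) (hv : m.reg 7 = v)
    {Q : Mem → Prop}
    (h : Q (((m.setReg 8 (m.arr 0 v)).setReg 9 (v + 1)).setReg 9 (m.arr 0 v + (L v).length))) :
    Runs openList m 4 Q := by
  refine .seq (.load (.seq (b := 1) (b' := 2) (.copy (.seq (b := 1) (b' := 1) (.inc (.load ?_))))))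
  have e : ∀ a b : ℕ, ((m.setReg 8 a).setReg 9 b).setReg 9 (b + 1) =
      (m.setReg 8 a).setReg 9 (b + 1) := fun a b => by
    simp [Mem.setReg]
  simpa [hv, e, hL.next v] using h

/-- One pass of the inner loop of the search, which reads entry `j` of the list of `v`. -/
theorem runs_visitProg {m : Mem} {v : Fin n} {j : ℕ} (ht : IsSearch G x₀ r p t)
    (hs : IsScanned G r t k) (hk : k < t) (hv : r v = k) (hm : SearchMem L x₀ r p t k m)
    (hL : IsAdjacencyList G L) (hj : j < (L v).length) (h7 : m.reg 7 = v)
    (h8 : m.reg 8 = m.arr 0 v + j) (h9 : m.reg 9 = m.arr 0 v + (L v).length)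
    (hfound : ∀ i (hi : i < (L v).length), i < j → r (L v)[i] < t) :
    Runs visitProg m 9 fun m' => ∃ r' p' t', IsSearch G x₀ r' p' t' ∧ IsScanned G r' t' k ∧ k < t' ∧
      r' v = k ∧ SearchMem L x₀ r' p' t' k m' ∧ m'.reg 7 = v ∧ m'.reg 8 = m'.arr 0 v + (j + 1) ∧
      m'.reg 9 = m'.arr 0 v + (L v).length ∧
      (∀ i (hi : i < (L v).length), i < j + 1 → r' (L v)[i] < t') ∧
      cost L r' (k + 1) = cost L r (k + 1) := by
  have hw1 : m.arr 1 (m.reg 8) = ((L v)[j] : Fin n) := by rw [h8, hm.lists.entry v j hj]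
  have hadj : G.Adj v (L v)[j] := ((hL v).2 _).1 (List.getElem_mem hj)
  set w := (L v)[j] with hw
  have hfw := hm.found w
  refine .seq (.load (.seq (b := 1) (b' := 7) (.load (.seq (b := 6) (b' := 1) (.ite ?_ ?_)))))
  · intro hc
    have hnot : ¬ r w < t := fun h => by
      simp [Test.Holds, hw1, hfw, h, hm.reg4] at hc
    refine .seq (.store (.seq (b := 1) (b' := 3) (.store (.seq (b := 1) (b' := 2) (.store
      (.seq (b := 1) (b' := 1) (.store (.inc (.inc ?_)))))))))
    have htn := ht.lt hnot
    have hwn := ht.far w hnot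
    have ne : ∀ {u}, r u < t → u ≠ w := fun hu e => hnot (e ▸ hu)
    have upd : ∀ {u}, u ≠ w → Function.update r w t u = r u := fun hu =>
      Function.update_of_ne hu _ _
    have hlt : ∀ u, Function.update r w t u < t + 1 ↔ u = w ∨ r u < t := fun u => by
      by_cases hu : u = w
      · simp [hu]
      · rw [upd hu]
        have := ht.far u
        simp only [hu, false_or]
        omega
    have hx : x₀ ≠ w := ne (ht.root ▸ ht.pos)
    have hvw : v ≠ w := hadj.ne
    have hval : ∀ {u : Fin n}, u ≠ w → (u : ℕ) ≠ w := fun hu h => hu (Fin.ext h)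
    refine ⟨Function.update r w t, Function.update p w v, t + 1,
      ht.visit (hv ▸ hs) (hv ▸ hk) hadj hnot, ?_, by omega, by rw [upd hvw, hv], ?_, ?_, ?_, ?_,
      ?_, ?_⟩
    · intro u hu u' huu'
      rw [hlt]
      by_cases h1 : u = w
      · rw [h1, Function.update_self] at hu
        omega
      · rw [upd h1] at hu
        exact .inr (hs u hu u' huu')
    · constructor
      · exact (((((((hm.lists.setReg _ _).setReg _ _).setArr (by omega) _ _).setArr
          (by omega) _ _).setArr (by omega) _ _).setArr (by omega) _ _).setReg _ _).setReg _ _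
      · simp [hm.reg0]
      · simp [hm.reg2]
      · simp [hm.reg3]
      · simp [hm.reg4]
      · simp [hm.reg5]
      · simp [hm.reg6]
      · intro u hu
        rw [hlt] at hu
        by_cases h1 : u = w
        · simp [h1, hm.reg6, hw1]
        · have h2 := hu.resolve_left h1
          simp [upd h1, hm.reg6, hm.queue u h2, h2.ne]
      · intro u
        simp only [hlt]
        by_cases h1 : u = w
        · simp [h1, hw1, hm.reg2]
        · simp [h1, hw1, hval h1, hm.found]
      · intro u hu hu0
        rw [hlt] at hu
        by_cases h1 : u = w
        · simp [h1, hw1, h7]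
        · simp [h1, hw1, hval h1, hm.parent u (hu.resolve_left h1) hu0]
      · intro u hu
        rw [hlt] at hu
        by_cases h1 : u = w
        · simp [h1, hw1, hx.symm, hm.reg2]
        · simp [hw1, hval h1, hm.count u (hu.resolve_left h1)]
      · intro u
        simp [hm.taken]
      · intro u
        simp [hm.mark]
    · simp [h7]
    · simp [h8, add_assoc]
    · simp [h9]
    · intro i hi hij
      rw [hlt]
      rcases Nat.lt_succ_iff_lt_or_eq.1 hij with h | rfl
      · exact .inr (hfound i hi h)
      · exact .inl rfl
    · rw [cost, cost]
      congr 1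
      ext u
      simp only [Finset.mem_filter, Finset.mem_univ, true_and]
      by_cases h1 : u = w
      · rw [h1, Function.update_self]
        omega
      · rw [upd h1]
  · intro hc
    have hyes : r w < t := by
      by_contra h
      exact hc (by simp [Test.Holds, hw1, hfw, h, hm.reg4])
    refine (Runs.skip (.inc ?_)).mono (by omega) fun _ => id
    refine ⟨r, p, t, ht, hs, hk, hv, ?_, ?_, ?_, ?_, ?_, rfl⟩
    · exact ⟨((hm.lists.setReg _ _).setReg _ _).setReg _ _, by simp [hm.reg0], by simp [hm.reg2],
        by simp [hm.reg3], by simp [hm.reg4], by simp [hm.reg5], by simp [hm.reg6],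
        hm.queue, hm.found, hm.parent, hm.count, hm.taken, hm.mark⟩
    · simp [h7]
    · simp [h8, add_assoc]
    · simp [h9]
    · intro i hi hij
      rcases Nat.lt_succ_iff_lt_or_eq.1 hij with h | rfl
      · exact hfound i hi h
      · exact hyes

theorem runs_searchProg {m : Mem} (hc : G.Connected) (hL : IsAdjacencyList G L)
    (ht : IsSearch G x₀ r p t) (hm : SearchMem L x₀ r p t 0 m) :
    Runs searchProg m (cost L r 0 + 1) fun m' => ∃ r' p', IsSearch G x₀ r' p' n ∧
      SearchMem L x₀ r' p' n n m' := by
  refine (Runs.loop (N := n) (I := fun k φ m => ∃ r p t, IsSearch G x₀ r p t ∧ IsScanned G r t k ∧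
    k ≤ t ∧ SearchMem L x₀ r p t k m ∧ φ = cost L r k) ?_ ?_ ?_).mono le_rfl ?_
  · rintro k φ m - ⟨r, p, t, ht, hs, hk, hm, -⟩
    simp only [Test.Holds, hm.reg5, hm.reg6]
    have := ht.le
    refine ⟨fun h => by omega, fun h => ?_⟩
    by_contra hkt
    have hkt : k = t := by omega
    subst hkt
    have := ht.eq_of_forall_lt (ht.lt_of_scanned hc hs)
    omega
  · rintro k φ m hkn ⟨r, p, t, ht, hs, hk, hm, rfl⟩
    have hkt : k < t := by
      by_contra hkt
      have hkt : k = t := by omega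
      subst hkt
      have := ht.eq_of_forall_lt (ht.lt_of_scanned hc hs)
      omega
    obtain ⟨v, hv⟩ := ht.surj k hkt
    refine ⟨cost L r (k + 1), 1 + (4 + (10 * (L v).length + 1 + 1)), ?_, ?_⟩
    · have h1 : (Finset.univ.filter fun u => k ≤ r u) =
          insert v (Finset.univ.filter fun u => k + 1 ≤ r u) := by
        ext u
        simp only [Finset.mem_filter, Finset.mem_univ, true_and, Finset.mem_insert]
        constructor
        · intro h
          by_cases he : r u = k
          · exact .inl (ht.inj u v (by omega) (by omega))
          · exact .inr (by omega)
        · rintro (rfl | h) <;> omega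
      rw [cost, cost, h1, Finset.sum_insert (by simp [hv])]
      omega
    · have h7 : m.arr 4 (m.reg 5) = v := by rw [hm.reg5, ← hv, hm.queue v (by omega)]
      refine .seq (.load (.seq (runs_openList (v := v) (hm.lists.setReg _ _) (by simp [h7]) (.seq
        (((Runs.loop_const (B := 9) (N := (L v).length) (I := fun j m' => ∃ r' p' t',
          IsSearch G x₀ r' p' t' ∧ IsScanned G r' t' k ∧ k < t' ∧ r' v = k ∧
          SearchMem L x₀ r' p' t' k m' ∧ m'.reg 7 = v ∧ m'.reg 8 = m'.arr 0 v + j ∧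
          m'.reg 9 = m'.arr 0 v + (L v).length ∧
          (∀ i (hi : i < (L v).length), i < j → r' (L v)[i] < t') ∧
          cost L r' (k + 1) = cost L r (k + 1)) ?_ ?_ ?_).mono le_rfl ?_))))))
      · rintro j m' - ⟨r', p', t', -, -, -, -, -, -, h8, h9, -⟩
        simp [Test.Holds, h8, h9]
      · rintro j m' hj ⟨r', p', t', ht', hs', hk', hv', hm', h7', h8', h9', hf', hcost⟩
        rw [← hcost]
        exact runs_visitProg ht' hs' hk' hv' hm' hL hj h7' h8' h9' hf'
      · refine ⟨r, p, t, ht, hs, hkt, hv, ?_, by simp [h7], by simp, by simp, by simp, rfl⟩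
        exact ⟨(((hm.lists.setReg _ _).setReg _ _).setReg _ _).setReg _ _, by simp [hm.reg0],
          by simp [hm.reg2], by simp [hm.reg3], by simp [hm.reg4], by simp [hm.reg5],
          by simp [hm.reg6], hm.queue, hm.found, hm.parent, hm.count, hm.taken, hm.mark⟩
      · rintro m' ⟨r', p', t', ht', hs', hk', hv', hm', -, -, -, hf', hcost⟩
        refine .inc ⟨r', p', t', ht', ?_, hk', ?_, hcost.symm⟩
        · intro u hu u' huu'
          rcases Nat.lt_succ_iff_lt_or_eq.1 hu with h | h
          · exact hs' u h u' huu'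
          · have := ht'.inj u v (by omega) (by omega)
            subst this
            obtain ⟨i, hi, rfl⟩ := List.mem_iff_getElem.1 (((hL u).2 u').2 huu')
            exact hf' i hi hi
        · exact ⟨hm'.lists.setReg _ _, by simp [hm'.reg0], by simp [hm'.reg2], by simp [hm'.reg3],
            by simp [hm'.reg4], by simp [hm'.reg5], by simp [hm'.reg6], hm'.queue, hm'.found,
            hm'.parent, hm'.count, hm'.taken, hm'.mark⟩
  · exact ⟨r, p, t, ht, fun v hv => absurd hv (Nat.not_lt_zero _), Nat.zero_le _, hm, rfl⟩
  · rintro m' ⟨φ', r', p', t', ht', -, hk', hm', -⟩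
    have : t' = n := le_antisymm ht'.le hk'
    subst this
    exact ⟨r', p', ht', hm'⟩

/-- The search that has discovered only the vertex `x₀`. -/
theorem isSearch_init (G : SimpleGraph (Fin n)) (x₀ : Fin n) :
    IsSearch G x₀ (fun v => if v = x₀ then 0 else n) id 1 := by
  have hn : 0 < n := lt_of_le_of_lt (Nat.zero_le _) x₀.2
  have hlt : ∀ v, (if v = x₀ then 0 else n) < 1 → v = x₀ := fun v hv => by
    by_contra h
    rw [if_neg h] at hv
    omega
  refine ⟨fun u v hu huv => ?_, fun v hv => ?_, fun i hi => ⟨x₀, ?_⟩, if_pos rfl, one_pos,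
    fun v hv h => absurd (hlt v hv) h⟩
  · rw [hlt u hu, hlt v (by simpa only [← huv] using hu)]
  · refine if_neg fun h => hv ?_
    simp [h]
  · simp; omega

theorem runs_initProg (hx : (x₀ : ℕ) = 0) (L : Fin n → List (Fin n)) :
    Runs initProg (inputMem L) 5
      (SearchMem L x₀ (fun v => if v = x₀ then 0 else n) id 1 0) := by
  refine .seq (.inc (.seq (b := 1) (b' := 3) (.const (.seq (b := 1) (b' := 2) (.const
    (.seq (b := 1) (b' := 1) (.const (.store ?_))))))))
  have hn : 0 < n := lt_of_le_of_lt (Nat.zero_le _) x₀.2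
  have hlt : ∀ v, (if v = x₀ then 0 else n) < 1 ↔ v = x₀ := fun v => by
    by_cases h : v = x₀
    · simp [h]
    · simp only [h, if_false, iff_false]; omega
  constructor
  · exact ((((((holdsLists_inputMem L).setReg _ _).setReg _ _).setReg _ _).setReg _ _)).setArr
      (by omega) _ _
  · simp [inputMem]
  · simp
  · simp
  · simp [inputMem]
  · simp [inputMem]
  · simp
  · intro v hv
    rw [hlt] at hv
    simp [hv, inputMem, hx]
  · intro v
    simp only [hlt]
    by_cases h : v = x₀
    · simp [h, inputMem, hx]
    · have : (v : ℕ) ≠ 0 := fun h' => h (Fin.ext (h'.trans hx.symm))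
      simp [h, inputMem, this]
  · intro v hv h
    exact absurd ((hlt v).1 hv) h
  · intro v hv
    rw [hlt] at hv
    simp [hv, inputMem]
  · intro v
    simp [inputMem]
  · intro v
    simp [inputMem]

end Search

/-! ### The greedy set along a search order -/

section GreedySet

variable {n : ℕ} {G : SimpleGraph (Fin n)} {x₀ v w : Fin n} {r : Fin n → ℕ} {p : Fin n → Fin n}
  {T : Finset (Fin n)} {k : ℕ}

/-- Membership of `v` only depends on vertices of higher rank, so that the greedy set can be built
by recursion on falling ranks. -/
theorem exists_isGreedySet (hr : Function.Injective r) (hlt : ∀ v, r v < n) :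
    ∃ T, IsGreedySet G r T := by
  classical
  have key : ∀ j, ∃ T : Finset (Fin n), ∀ v, n ≤ r v + j → (v ∈ T ↔ 3 ≤ liveDeg G r T v) := by
    intro j
    induction j with
    | zero => exact ⟨∅, fun v hv => absurd (hlt v) (by omega)⟩
    | succ j ih =>
      obtain ⟨T, hT⟩ := ih
      let T' : Finset (Fin n) := Finset.univ.filter fun u =>
        (n ≤ r u + j ∧ u ∈ T) ∨ (n = r u + (j + 1) ∧ 3 ≤ liveDeg G r T u)
      have hT' : ∀ v, n ≤ r v + (j + 1) → liveDeg G r T' v = liveDeg G r T v := by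
        intro v hv
        have : liveNbrs G r T' v = liveNbrs G r T v := by
          ext u
          simp only [mem_liveNbrs, T', Finset.mem_filter, Finset.mem_univ, true_and]
          refine and_congr_right fun hvu => ?_
          have hne : r u ≠ r v := fun h => hvu.ne (hr h).symm
          by_cases hlt : r u < r v
          · simp [hlt]
          · have h1 : n ≤ r u + j := by omega
            have h2 : n ≠ r u + (j + 1) := by omega
            simp [h1, h2]
        rw [liveDeg, liveDeg, this]
      refine ⟨T', fun v hv => ?_⟩
      rw [hT' v hv]
      simp only [T', Finset.mem_filter, Finset.mem_univ, true_and]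
      by_cases h : n ≤ r v + j
      · have h1 : n ≠ r v + (j + 1) := by omega
        simp [h, h1, hT v h]
      · have h1 : n = r v + (j + 1) := by omega
        simp [h, ← h1]
  obtain ⟨T, hT⟩ := key n
  exact ⟨T, fun v => hT v (Nat.le_add_left _ _)⟩

theorem IsSearch.rank_lt (hs : IsSearch G x₀ r p n) (v : Fin n) : r v < n := by
  by_contra h
  exact absurd (hs.lt h) (lt_irrefl n)

theorem IsSearch.injective (hs : IsSearch G x₀ r p n) : Function.Injective r :=
  fun u v h => hs.inj u v (hs.rank_lt u) h

theorem IsSearch.isPerfectRank (hs : IsSearch G x₀ r p n) (hG : CycleClosed G) :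
    IsPerfectRank G r :=
  hG.isPerfectRank hs.injective x₀ fun v hv =>
    ⟨p v, (hs.parent v (hs.rank_lt v) hv).1, (hs.parent v (hs.rank_lt v) hv).2.1⟩

theorem IsSearch.ne_root (hs : IsSearch G x₀ r p n) (hw : r w ≠ 0) : w ≠ x₀ := by
  rintro rfl
  exact hw hs.root

open Classical in
/-- The neighbours of `v` of lower rank, and those of rank at least `k` outside `T`. -/
noncomputable def partNbrs (G : SimpleGraph (Fin n)) (r : Fin n → ℕ) (T : Finset (Fin n)) (k : ℕ)
    (v : Fin n) : Finset (Fin n) :=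
  Finset.univ.filter fun u => G.Adj v u ∧ (r u < r v ∨ k ≤ r u ∧ u ∉ T)

/-- The number of blocks at `v` that are known to be left when the vertices of rank at least `k`
have been treated. -/
noncomputable def partDeg (G : SimpleGraph (Fin n)) (r : Fin n → ℕ) (T : Finset (Fin n)) (k : ℕ)
    (v : Fin n) : ℕ :=
  ((partNbrs G r T k v).image (cls G v)).card

/-- `v` shares the block towards its parent with a vertex outside `T` of rank at least `k`. -/
def IsMarked (G : SimpleGraph (Fin n)) (r : Fin n → ℕ) (p : Fin n → Fin n) (T : Finset (Fin n))
    (k : ℕ) (v : Fin n) : Prop :=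
  ∃ u, G.Adj v u ∧ k ≤ r u ∧ u ∉ T ∧ p u ≠ v

variable {u : Fin n}

theorem mem_partNbrs : u ∈ partNbrs G r T k v ↔ G.Adj v u ∧ (r u < r v ∨ k ≤ r u ∧ u ∉ T) := by
  simp [partNbrs]

theorem partDeg_eq_liveDeg (hr : Function.Injective r) (hk : k ≤ r v + 1) :
    partDeg G r T k v = liveDeg G r T v := by
  have : partNbrs G r T k v = liveNbrs G r T v := by
    ext u
    rw [mem_partNbrs, mem_liveNbrs]
    refine and_congr_right fun hvu => ?_
    have hne : r u ≠ r v := fun h => hvu.ne (hr h).symm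
    by_cases hlt : r u < r v
    · simp [hlt]
    · have : k ≤ r u := by omega
      simp [hlt, this]
  rw [partDeg, liveDeg, this]

theorem IsSearch.partDeg_init (hs : IsSearch G x₀ r p n) (hG : CycleClosed G) (v : Fin n) :
    partDeg G r T n v = if v = x₀ then 0 else 1 := by
  have hr := hs.isPerfectRank hG
  split_ifs with h
  · rw [partDeg, Finset.card_eq_zero, Finset.image_eq_empty, Finset.eq_empty_iff_forall_notMem]
    intro u hu
    rw [mem_partNbrs, h, hs.root] at hu
    have := hs.rank_lt u
    omega
  · obtain ⟨h1, h2, -⟩ := hs.parent v (hs.rank_lt v) h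
    rw [partDeg, Finset.card_eq_one]
    refine ⟨cls G v (p v), ?_⟩
    ext C
    rw [Finset.mem_image, Finset.mem_singleton]
    constructor
    · rintro ⟨u, hu, rfl⟩
      rw [mem_partNbrs] at hu
      have h3 : r u < r v := by
        have := hs.rank_lt u
        omega
      rw [cls_eq_iff hG hu.1 h1]
      by_cases h4 : u = p v
      · exact .inl h4
      · exact .inr (hr.clique v u (p v) hu.1 h1 h4 h3 h2)
    · rintro rfl
      exact ⟨p v, mem_partNbrs.2 ⟨h1, .inl h2⟩, rfl⟩

theorem partNbrs_of_mem (hr : Function.Injective r) (hw : w ∈ T) (v : Fin n) :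
    partNbrs G r T (r w) v = partNbrs G r T (r w + 1) v := by
  ext u
  rw [mem_partNbrs, mem_partNbrs]
  refine and_congr_right fun _ => or_congr_right (and_congr_left fun hu => ?_)
  have : r u ≠ r w := fun h => hu (hr h ▸ hw)
  omega

theorem partNbrs_of_notMem (hr : Function.Injective r) (hw : w ∉ T) (hvw : G.Adj v w) :
    partNbrs G r T (r w) v = insert w (partNbrs G r T (r w + 1) v) := by
  ext u
  rw [Finset.mem_insert, mem_partNbrs, mem_partNbrs]
  by_cases h : u = w
  · subst h
    simp [hvw, hw]
  · have : r u ≠ r w := fun h' => h (hr h')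
    have h2 : r w ≤ r u ↔ r w + 1 ≤ r u := by omega
    simp only [h, false_or, h2]

theorem partNbrs_of_not_adj (hr : Function.Injective r) (hvw : ¬ G.Adj v w) :
    partNbrs G r T (r w) v = partNbrs G r T (r w + 1) v := by
  ext u
  rw [mem_partNbrs, mem_partNbrs]
  refine and_congr_right fun hu => ?_
  have : r u ≠ r w := fun h' => hvw (hr h' ▸ hu)
  have h2 : r w ≤ r u ↔ r w + 1 ≤ r u := by omega
  rw [h2]

theorem partDeg_of_mem (hr : Function.Injective r) (hw : w ∈ T) (v : Fin n) :
    partDeg G r T (r w) v = partDeg G r T (r w + 1) v := by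
  rw [partDeg, partDeg, partNbrs_of_mem hr hw]

/-- A vertex `w` outside `T` leaves the counts of the vertices other than its parent unchanged. -/
theorem IsSearch.partDeg_of_ne (hs : IsSearch G x₀ r p n) (hG : CycleClosed G) (hw : w ∉ T)
    (hw0 : w ≠ x₀) (hv : v ≠ p w) : partDeg G r T (r w) v = partDeg G r T (r w + 1) v := by
  by_cases hvw : G.Adj v w
  · rw [partDeg, partDeg, partNbrs_of_notMem hs.injective hw hvw, Finset.image_insert,
      Finset.insert_eq_of_mem]
    have hne : r v ≠ r w := fun h => hvw.ne (hs.injective h)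
    rcases lt_or_gt_of_ne hne with hlt | hlt
    · obtain ⟨h1, h2, h3⟩ := hs.parent w (hs.rank_lt w) hw0
      have h4 := (hs.isPerfectRank hG).clique w v (p w) hvw.symm h1 hv hlt h2
      refine Finset.mem_image.2 ⟨p w, mem_partNbrs.2 ⟨h4, .inl ?_⟩, ?_⟩
      · exact lt_of_le_of_ne (h3 v hvw.symm) fun h => hv (hs.injective h).symm
      · exact (cls_eq_iff hG h4 hvw).2 (.inr h1.symm)
    · exact Finset.mem_image.2 ⟨w, mem_partNbrs.2 ⟨hvw, .inl hlt⟩, rfl⟩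
  · rw [partDeg, partDeg, partNbrs_of_not_adj hs.injective hvw]

/-- The vertex `w` is marked if and only if its block has already been counted at its parent. -/
theorem IsSearch.isMarked_iff (hs : IsSearch G x₀ r p n) (hG : CycleClosed G) (hw0 : w ≠ x₀) :
    IsMarked G r p T (r w + 1) w ↔
      cls G (p w) w ∈ (partNbrs G r T (r w + 1) (p w)).image (cls G (p w)) := by
  obtain ⟨h1, h2, h3⟩ := hs.parent w (hs.rank_lt w) hw0
  have hr := hs.isPerfectRank hG
  rw [Finset.mem_image]
  constructor
  · rintro ⟨u, hwu, hlt, huT, hpu⟩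
    have hu0 : u ≠ x₀ := hs.ne_root (by omega)
    obtain ⟨h4, h5, h6⟩ := hs.parent u (hs.rank_lt u) hu0
    have h7 : r (p u) ≤ r w := h6 w hwu.symm
    have h8 : r (p u) < r w := lt_of_le_of_ne h7 fun h => hpu (hs.injective h)
    have h9 : G.Adj w (p u) := (hr.clique u w (p u) hwu.symm h4 hpu.symm (by omega) h5)
    have h10 : p w = p u := by
      by_contra hne
      have h11 := hr.clique w (p w) (p u) h1 h9 hne h2 h8
      have h12 := (cls_eq_iff hG h1 hwu).1 (((cls_eq_iff hG h1 h9).2 (.inr h11)).trans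
        ((cls_eq_iff hG h9 hwu).2 (.inr h4.symm)))
      rcases h12 with h12 | h12
      · rw [h12] at h2
        omega
      · have h13 := h6 (p w) h12.symm
        exact hne (hs.injective (le_antisymm (h3 (p u) h9) h13))
    rw [h10]
    rw [h10] at h1
    exact ⟨u, mem_partNbrs.2 ⟨h4.symm, .inr ⟨hlt, huT⟩⟩, (cls_eq_iff hG h4.symm h1.symm).2
      (.inr hwu.symm)⟩
  · rintro ⟨u, hu, he⟩
    rw [mem_partNbrs] at hu
    rw [cls_eq_iff hG hu.1 h1.symm] at he
    rcases he with rfl | he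
    · rcases hu.2 with h | h <;> omega
    · have hge := h3 u he.symm
      obtain ⟨hlt, huT⟩ := hu.2.resolve_left (by omega)
      refine ⟨u, he.symm, hlt, huT, fun h => ?_⟩
      have := (hs.parent u (hs.rank_lt u) (hs.ne_root (by omega))).2.2 (p w) hu.1.symm
      rw [h] at this
      omega

theorem IsSearch.partDeg_of_isMarked (hs : IsSearch G x₀ r p n) (hG : CycleClosed G) (hw : w ∉ T)
    (hw0 : w ≠ x₀) (hm : IsMarked G r p T (r w + 1) w) :
    partDeg G r T (r w) (p w) = partDeg G r T (r w + 1) (p w) := by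
  rw [hs.isMarked_iff hG hw0] at hm
  rw [partDeg, partDeg, partNbrs_of_notMem hs.injective hw (hs.parent w (hs.rank_lt w) hw0).1.symm,
    Finset.image_insert, Finset.insert_eq_of_mem hm]

theorem IsSearch.partDeg_of_not_isMarked (hs : IsSearch G x₀ r p n) (hG : CycleClosed G)
    (hw : w ∉ T) (hw0 : w ≠ x₀) (hm : ¬ IsMarked G r p T (r w + 1) w) :
    partDeg G r T (r w) (p w) = partDeg G r T (r w + 1) (p w) + 1 := by
  rw [hs.isMarked_iff hG hw0] at hm
  rw [partDeg, partDeg, partNbrs_of_notMem hs.injective hw (hs.parent w (hs.rank_lt w) hw0).1.symm,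
    Finset.image_insert, Finset.card_insert_of_notMem hm]

theorem isMarked_step (hr : Function.Injective r) :
    IsMarked G r p T (r w) v ↔
      IsMarked G r p T (r w + 1) v ∨ (w ∉ T ∧ G.Adj w v ∧ v ≠ p w) := by
  constructor
  · rintro ⟨u, h1, h2, h3, h4⟩
    by_cases h : u = w
    · subst h
      exact .inr ⟨h3, h1.symm, h4.symm⟩
    · have : r u ≠ r w := fun h' => h (hr h')
      exact .inl ⟨u, h1, by omega, h3, h4⟩
  · rintro (⟨u, h1, h2, h3, h4⟩ | ⟨h1, h2, h3⟩)
    · exact ⟨u, h1, by omega, h3, h4⟩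
    · exact ⟨w, h2.symm, le_rfl, h1, h3.symm⟩

theorem weight_univ (hT : IsGreedySet G r T) :
    weight G r T Finset.univ = ∑ v, (liveDeg G r T v - 2) := by
  rw [weight, Finset.inter_univ]
  refine Finset.sum_subset (Finset.subset_univ T) fun v _ hv => ?_
  rw [hT] at hv
  omega

end GreedySet

/-! ### The program for the greedy set -/

section GreedyProgram

variable {n : ℕ} {G : SimpleGraph (Fin n)} {L : Fin n → List (Fin n)} {x₀ w : Fin n}
  {r : Fin n → ℕ} {p : Fin n → Fin n} {T : Finset (Fin n)} {k : ℕ} {c : Fin n → ℕ}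
  {M : Fin n → Prop} {m : Mem}

/-- If the vertex in `reg 7` is not marked (`reg 11`), then increase the count of its parent in `reg
10`. If this count is at least two, this adds one to the output `reg 0`, and the parent is taken
(array `2`). -/
def countProg : Prog :=
  .ite (.eq 11 4)
    (.seq (.load 12 6 10) <| .seq
      (.ite (.lt 2 12) (.seq (.inc 0) (.store 2 10 2)) .skip) <|
      .seq (.inc 12) (.store 6 10 12))
    .skip

/-- Read the next neighbour from an adjacency list and mark it (array `7`), unless it is the vertex
in `reg 10`. -/
def markProg : Prog :=
  .seq (.load 11 1 8) <| .seq (.ite (.eq 11 10) .skip (.store 7 11 2)) (.inc 8)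

/-- Treat the vertices in reverse search order. A vertex is passed over if its count is at least
three. -/
def greedyProg : Prog :=
  .loop (.lt 2 5) <| .seq (.dec 5) <| .seq (.load 7 4 5) <| .seq (.load 8 6 7) <|
    .ite (.lt 8 3)
      (.seq (.load 10 5 7) <| .seq (.load 11 7 7) <| .seq countProg <| .seq openList <|
        .loop (.lt 8 9) markProg)
      .skip

/-- The memory when the vertices of rank at least `k` have been treated, for the counts `c` and the
marks `M`. -/
structure GreedyMem (L : Fin n → List (Fin n)) (x₀ : Fin n) (r : Fin n → ℕ) (p : Fin n → Fin n)
    (k : ℕ) (c : Fin n → ℕ) (M : Fin n → Prop) (m : Mem) : Prop where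
  lists : HoldsLists L m
  reg0 : m.reg 0 = n + 1 + ∑ v, (c v - 2)
  reg2 : m.reg 2 = 1
  reg3 : m.reg 3 = 3
  reg4 : m.reg 4 = 0
  reg5 : m.reg 5 = k
  queue : ∀ v, m.arr 4 (r v) = v
  parent : ∀ v : Fin n, v ≠ x₀ → m.arr 5 v = p v
  count : ∀ v : Fin n, m.arr 6 v = c v
  taken : ∀ v : Fin n, m.arr 2 v = 1 ↔ 3 ≤ c v
  mark : ∀ v : Fin n, r v < k → (m.arr 7 v = 0 ↔ ¬ M v)

theorem GreedyMem.setReg (h : GreedyMem L x₀ r p k c M m) {a : ℕ} (ha : 6 ≤ a) (x : ℕ) :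
    GreedyMem L x₀ r p k c M (m.setReg a x) := by
  have e : ∀ i, i < 6 → (m.setReg a x).reg i = m.reg i := fun i hi => by
    rw [Mem.setReg_reg, if_neg (by omega)]
  exact ⟨h.lists.setReg _ _, by rw [e 0 (by omega), h.reg0], by rw [e 2 (by omega), h.reg2],
    by rw [e 3 (by omega), h.reg3], by rw [e 4 (by omega), h.reg4], by rw [e 5 (by omega), h.reg5],
    h.queue, h.parent, h.count, h.taken, h.mark⟩

theorem sum_update_sub (c : Fin n → ℕ) (q : Fin n) :
    ∑ v, (Function.update c q (c q + 1) v - 2) = ∑ v, (c v - 2) + if 1 < c q then 1 else 0 := by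
  rw [← Finset.add_sum_erase _ _ (Finset.mem_univ q),
    ← Finset.add_sum_erase Finset.univ (fun v => c v - 2) (Finset.mem_univ q), Function.update_self,
    Finset.sum_congr rfl fun v hv => by
      rw [Function.update_of_ne (Finset.ne_of_mem_erase hv)]]
  split_ifs <;> omega

open Classical in
/-- `y` says whether the block has already been counted. -/
theorem runs_countProg {q : Fin n} {y : Prop} [Decidable y] (h : GreedyMem L x₀ r p k c M m)
    (h10 : m.reg 10 = q) (h11 : m.reg 11 = 0 ↔ ¬ y) :
    Runs countProg m 7 fun m' =>
      GreedyMem L x₀ r p k (if y then c else Function.update c q (c q + 1)) M m' ∧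
        m'.reg 7 = m.reg 7 ∧ m'.reg 10 = q := by
  have hv : ∀ {v : Fin n}, v ≠ q → (v : ℕ) ≠ q := fun hv he => hv (Fin.ext he)
  refine .ite (fun hc => ?_) fun hc => ?_
  · have hy : ¬ y := by
      rw [← h11]
      simpa [Test.Holds, h.reg4] using hc
    simp only [hy, if_false]
    have hq : m.arr 6 (m.reg 10) = c q := by rw [h10, h.count]
    refine .seq (.load (.seq (b := 3) (b' := 2) (.ite (fun hc => ?_) fun hc => ?_)))
    · have hcq : 1 < c q := by simpa [Test.Holds, h.reg2, hq] using hc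
      refine .seq (.inc (.store (.seq (b := 1) (b' := 1) (.inc (.store ⟨?_, ?_, ?_⟩)))))
      · constructor
        · exact ((((h.lists.setReg _ _).setReg _ _).setArr (by omega) _ _).setReg _ _).setArr
            (by omega) _ _
        · simp [h.reg0, sum_update_sub, hcq, add_assoc]
        · simp [h.reg2]
        · simp [h.reg3]
        · simp [h.reg4]
        · simp [h.reg5]
        · simp [h.queue]
        · intro v hv0
          simp [h.parent v hv0]
        · intro v
          by_cases hvq : v = q
          · simp [hvq, h10, h.count]
          · simp [hvq, hv hvq, h10, h.count]
        · intro v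
          by_cases hvq : v = q
          · simp [hvq, h10, h.reg2]
            omega
          · simp [hvq, hv hvq, h10, h.taken]
        · intro v hvk
          simp [h.mark v hvk]
      · simp
      · simp [h10]
    · have hcq : ¬ 1 < c q := by simpa [Test.Holds, h.reg2, hq] using hc
      refine (Runs.skip (.seq (b := 1) (b' := 1) (.inc (.store ⟨?_, ?_, ?_⟩)))).mono (by omega)
        fun _ => id
      · constructor
        · exact ((h.lists.setReg _ _).setReg _ _).setArr (by omega) _ _
        · simp [h.reg0, sum_update_sub, hcq]
        · simp [h.reg2]
        · simp [h.reg3]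
        · simp [h.reg4]
        · simp [h.reg5]
        · simp [h.queue]
        · intro v hv0
          simp [h.parent v hv0]
        · intro v
          by_cases hvq : v = q
          · simp [hvq, h10, h.count]
          · simp [hvq, hv hvq, h10, h.count]
        · intro v
          by_cases hvq : v = q
          · simp [hvq, h.taken]
            omega
          · simp [hvq, h.taken]
        · intro v hvk
          simp [h.mark v hvk]
      · simp
      · simp [h10]
  · have hy : y := by
      by_contra hy
      exact hc (by simpa [Test.Holds, h.reg4] using h11.2 hy)
    simp only [hy, if_true]
    exact (Runs.skip ⟨h, rfl, h10⟩).mono (by omega) fun _ => id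

theorem runs_markLoop {q : Fin n} (h : GreedyMem L x₀ r p k c M m) (h8 : m.reg 8 = m.arr 0 w)
    (h9 : m.reg 9 = m.arr 0 w + (L w).length) (h10 : m.reg 10 = q) :
    Runs (.loop (.lt 8 9) markProg) m (5 * (L w).length + 1)
      (GreedyMem L x₀ r p k c fun v => M v ∨ (v ∈ L w ∧ v ≠ q)) := by
  refine (Runs.loop_const (B := 4) (N := (L w).length) (I := fun j m' =>
    GreedyMem L x₀ r p k c (fun v => M v ∨ ((∃ i, ∃ hi : i < (L w).length, i < j ∧ (L w)[i] = v) ∧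
      v ≠ q)) m' ∧ m'.reg 8 = m'.arr 0 w + j ∧ m'.reg 9 = m'.arr 0 w + (L w).length ∧
      m'.reg 10 = q) ?_ ?_ ?_).mono le_rfl ?_
  · rintro j m' - ⟨-, h8, h9, -⟩
    simp [Test.Holds, h8, h9]
  · rintro j m' hj ⟨hm, h8, h9, h10⟩
    have hu : m'.arr 1 (m'.reg 8) = ((L w)[j] : Fin n) := by rw [h8, hm.lists.entry w j hj]
    have hex : ∀ v, (∃ i, ∃ hi : i < (L w).length, i < j + 1 ∧ (L w)[i] = v) ↔
        (∃ i, ∃ hi : i < (L w).length, i < j ∧ (L w)[i] = v) ∨ (L w)[j] = v := fun v => by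
      constructor
      · rintro ⟨i, hi, hij, he⟩
        rcases Nat.lt_succ_iff_lt_or_eq.1 hij with h | rfl
        · exact .inl ⟨i, hi, h, he⟩
        · exact .inr he
      · rintro (⟨i, hi, hij, he⟩ | he)
        · exact ⟨i, hi, by omega, he⟩
        · exact ⟨j, hj, by omega, he⟩
    simp only [hex]
    refine .seq (.load (.seq (b := 2) (b' := 1) (.ite (fun hc => ?_) fun hc => ?_)))
    · have hq : (L w)[j] = q := by
        have : (((L w)[j] : Fin n) : ℕ) = q := by simpa [Test.Holds, hu, h10] using hc
        exact Fin.ext this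
      refine .skip (.inc ⟨?_, by simp [h8, add_assoc], by simp [h9], by simp [h10]⟩)
      have h1 := (hm.setReg (a := 11) (by omega) (m'.arr 1 (m'.reg 8))).setReg (a := 8) (by omega)
        (m'.reg 8 + 1)
      simp only [Mem.setReg_reg, if_neg (show 8 ≠ 11 by omega)]
      refine ⟨h1.lists, h1.reg0, h1.reg2, h1.reg3, h1.reg4, h1.reg5, h1.queue, h1.parent, h1.count,
        h1.taken, fun v hv => (h1.mark v hv).trans (not_congr (or_congr_right ?_))⟩
      constructor
      · exact fun h => ⟨.inl h.1, h.2⟩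
      · rintro ⟨h | h, h'⟩
        · exact ⟨h, h'⟩
        · exact absurd (h.symm.trans hq) h'
    · have hq : (L w)[j] ≠ q := fun he => hc (by simp [Test.Holds, hu, h10, he])
      refine .store (.inc ⟨?_, by simp [h8, add_assoc], by simp [h9], by simp [h10]⟩)
      constructor
      · exact ((hm.lists.setReg _ _).setArr (by omega) _ _).setReg _ _
      · simp [hm.reg0]
      · simp [hm.reg2]
      · simp [hm.reg3]
      · simp [hm.reg4]
      · simp [hm.reg5]
      · simp [hm.queue]
      · intro v hv0
        simp [hm.parent v hv0]
      · simp [hm.count]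
      · simp [hm.taken]
      · intro v hv
        by_cases hvu : v = (L w)[j]
        · simp [hvu, hu, hm.reg2, hq]
        · have h1 : (v : ℕ) ≠ ((L w)[j] : Fin n) := fun he => hvu (Fin.ext he)
          have h2 := hm.mark v hv
          simpa [h1, hu, Ne.symm hvu] using h2
  · refine ⟨⟨h.lists, h.reg0, h.reg2, h.reg3, h.reg4, h.reg5, h.queue, h.parent, h.count, h.taken,
      fun v hv => by simp [h.mark v hv]⟩, by simp [h8], h9, h10⟩
  · rintro m' ⟨hm, -⟩
    have hex : ∀ v, (∃ i, ∃ hi : i < (L w).length, i < (L w).length ∧ (L w)[i] = v) ↔ v ∈ L w :=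
      fun v => by
        rw [List.mem_iff_getElem]
        exact ⟨fun ⟨i, hi, _, he⟩ => ⟨i, hi, he⟩, fun ⟨i, hi, he⟩ => ⟨i, hi, hi, he⟩⟩
    simpa only [hex] using hm

theorem GreedyMem.congr {c' : Fin n → ℕ} {M' : Fin n → Prop} (h : GreedyMem L x₀ r p k c M m)
    (hc : ∀ v, c v = c' v) (hM : ∀ v, r v < k → (M v ↔ M' v)) : GreedyMem L x₀ r p k c' M' m := by
  obtain rfl : c = c' := funext hc
  exact ⟨h.lists, h.reg0, h.reg2, h.reg3, h.reg4, h.reg5, h.queue, h.parent, h.count, h.taken,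
    fun v hv => (h.mark v hv).trans (not_congr (hM v hv))⟩

/-- One pass of the loop of `greedyProg`, for the vertex `w`. -/
theorem runs_greedyStep (hs : IsSearch G x₀ r p n) (hG : CycleClosed G) (hT : IsGreedySet G r T)
    (hL : IsAdjacencyList G L) (hw0 : w ≠ x₀)
    (h : GreedyMem L x₀ r p (r w + 1) (partDeg G r T (r w + 1)) (IsMarked G r p T (r w + 1)) m) :
    Runs (.seq (.dec 5) <| .seq (.load 7 4 5) <| .seq (.load 8 6 7) <|
      .ite (.lt 8 3)
        (.seq (.load 10 5 7) <| .seq (.load 11 7 7) <| .seq countProg <| .seq openList <|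
          .loop (.lt 8 9) markProg)
        .skip) m (5 * (L w).length + 18)
      (GreedyMem L x₀ r p (r w) (partDeg G r T (r w)) (IsMarked G r p T (r w))) := by
  classical
  have hr := hs.injective
  have hw7 : m.arr 4 (m.reg 5 - 1) = w := by rw [h.reg5, Nat.add_sub_cancel, h.queue]
  have hwc : m.arr 6 w = liveDeg G r T w := by rw [h.count, partDeg_eq_liveDeg hr le_rfl]
  have hmk := h.mark w (Nat.lt_succ_self _)
  have h1 : GreedyMem L x₀ r p (r w) (partDeg G r T (r w + 1)) (IsMarked G r p T (r w + 1))
      (m.setReg 5 (m.reg 5 - 1)) :=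
    ⟨h.lists.setReg _ _, by simp [h.reg0], by simp [h.reg2], by simp [h.reg3], by simp [h.reg4],
      by simp [h.reg5], h.queue, h.parent, h.count, h.taken, fun v hv => h.mark v (by omega)⟩
  refine (Runs.seq (b := 1) (b' := 1 + (1 + (1 + (1 + (7 + (4 + (5 * (L w).length + 1)))) + 1)))
    (.dec (.seq (.load (.seq (.load (.ite (fun hc => ?_) fun hc => ?_))))))).mono (by omega)
    fun _ => id
  · have hw : w ∉ T := by
      rw [hT w, not_le]
      simpa [Test.Holds, hw7, hwc, h.reg3] using hc
    have hpar := hs.parent w (hs.rank_lt w) hw0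
    refine .seq (.load (.seq (.load (.seq ((runs_countProg (q := p w)
      (y := IsMarked G r p T (r w + 1) w) ((((h1.setReg (by omega) _).setReg (by omega) _).setReg
        (by omega) _).setReg (by omega) _) ?_ ?_).mono le_rfl fun m' h' => .seq
          (runs_openList (v := w) h'.1.lists ?_ ((runs_markLoop (w := w) (q := p w)
            (((h'.1.setReg (by omega) _).setReg (by omega) _).setReg (by omega) _) ?_ ?_ ?_).mono
              le_rfl fun m'' h'' => h''.congr ?_ ?_)))))))
    · simp [hw7, h.parent w hw0]
    · simpa [hw7] using hmk
    · rw [h'.2.1]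
      simp [hw7]
    · simp
    · simp
    · simp [h'.2.2]
    · intro v
      by_cases hm : IsMarked G r p T (r w + 1) w
      · rw [if_pos hm]
        by_cases hv : v = p w
        · rw [hv, hs.partDeg_of_isMarked hG hw hw0 hm]
        · rw [hs.partDeg_of_ne hG hw hw0 hv]
      · rw [if_neg hm]
        by_cases hv : v = p w
        · rw [hv, Function.update_self, hs.partDeg_of_not_isMarked hG hw hw0 hm]
        · rw [Function.update_of_ne hv, hs.partDeg_of_ne hG hw hw0 hv]
    · intro v _
      rw [isMarked_step hr, (hL w).2]
      simp [hw]
  · have hw : w ∈ T := by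
      rw [hT w, ← not_lt]
      simpa [Test.Holds, hw7, hwc, h.reg3] using hc
    refine (Runs.skip (((h1.setReg (by omega) _).setReg (by omega) _).congr (fun v =>
      (partDeg_of_mem hr hw v).symm) fun v _ => ?_)).mono (by omega) fun _ => id
    rw [isMarked_step hr]
    simp [hw]

theorem runs_greedyProg (hs : IsSearch G x₀ r p n) (hG : CycleClosed G) (hT : IsGreedySet G r T)
    (hL : IsAdjacencyList G L) (hm : SearchMem L x₀ r p n n m) :
    Runs greedyProg m (∑ v, (5 * (L v).length + 19) + 1) fun m' =>
      m'.reg 0 = n + 1 + weight G r T Finset.univ ∧ ∀ v : Fin n, m'.arr 2 v = 1 ↔ v ∈ T := by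
  have hr := hs.injective
  have hn : 0 < n := lt_of_le_of_lt (Nat.zero_le _) x₀.2
  refine (Runs.loop (N := n - 1) (I := fun j φ m' =>
    GreedyMem L x₀ r p (n - j) (partDeg G r T (n - j)) (IsMarked G r p T (n - j)) m' ∧
      φ = ∑ v with r v < n - j, (5 * (L v).length + 19)) ?_ ?_ ?_).mono le_rfl ?_
  · rintro j φ m' - ⟨h, -⟩
    simp only [Test.Holds, h.reg2, h.reg5]
    omega
  · rintro j φ m' hj ⟨h, rfl⟩
    obtain ⟨w, hw⟩ := hs.surj (n - (j + 1)) (by omega)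
    have hk : n - j = r w + 1 := by omega
    have hw0 : w ≠ x₀ := by
      rintro rfl
      rw [hs.root] at hw
      omega
    rw [← hw]
    rw [hk] at h ⊢
    refine ⟨_, _, ?_, (runs_greedyStep hs hG hT hL hw0 h).mono le_rfl fun m'' h' => ⟨h', rfl⟩⟩
    have h1 : (Finset.univ.filter fun u => r u < r w + 1) =
        insert w (Finset.univ.filter fun u => r u < r w) := by
      ext u
      simp only [Finset.mem_filter, Finset.mem_univ, true_and, Finset.mem_insert]
      constructor
      · intro h
        by_cases he : r u = r w
        · exact .inl (hr he)
        · exact .inr (by omega)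
      · rintro (rfl | h) <;> omega
    rw [h1, Finset.sum_insert (by simp)]
  · have hfilter : (Finset.univ.filter fun v => r v < n - 0) = Finset.univ :=
      Finset.filter_true_of_mem fun v _ => hs.rank_lt v
    refine ⟨?_, by rw [hfilter]⟩
    rw [Nat.sub_zero]
    have hle : ∀ v, partDeg G r T n v ≤ 1 := fun v => by
      rw [hs.partDeg_init hG]
      split_ifs <;> omega
    refine ⟨hm.lists, ?_, hm.reg2, hm.reg3, hm.reg4, hm.reg5, fun v => hm.queue v (hs.rank_lt v),
      fun v => hm.parent v (hs.rank_lt v), fun v => ?_, fun v => ?_, fun v _ => ?_⟩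
    · rw [hm.reg0, Finset.sum_eq_zero fun v _ => by have := hle v; omega, add_zero]
    · rw [hm.count v (hs.rank_lt v), hs.partDeg_init hG]
    · have := hle v
      simp only [hm.taken, zero_ne_one, false_iff]
      omega
    · simp only [hm.mark, true_iff]
      rintro ⟨u, -, hu, -⟩
      have := hs.rank_lt u
      omega
  · rintro m' ⟨φ', h, -⟩
    have e : n - (n - 1) = 1 := by omega
    rw [e] at h
    have hd : ∀ v, partDeg G r T 1 v = liveDeg G r T v := fun v =>
      partDeg_eq_liveDeg hr (by omega)
    refine ⟨?_, fun v => ?_⟩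
    · rw [h.reg0, weight_univ hT]
      simp only [hd]
    · rw [h.taken, hd, hT v]

end GreedyProgram

/-! ### Linear time -/

section LinearTime

variable {n : ℕ} {G : SimpleGraph (Fin n)} {L : Fin n → List (Fin n)}

/-- The program finds, in linear time, the output of the run that always takes the vertex that comes
last in a breadth-first search. -/
theorem exists_exec (hc : G.Connected) (hB : IsBlockGraph (⊤ : G.Subgraph))
    (hL : IsAdjacencyList G L) :
    ∃ (t : ℕ) (m : Mem), Exec (.seq initProg (.seq searchProg greedyProg)) (inputMem L) t m ∧
      t ≤ 40 * (n + G.edgeSet.ncard) ∧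
      ∃ s : AlgState G, Reachable s ∧ IsFinished s ∧
        m.reg 0 = s.dim ∧ ∀ v : Fin n, v ∈ s.taken ↔ m.arr 2 v = 1 := by
  classical
  have hn : 0 < n := by
    obtain ⟨v⟩ := hc.nonempty
    exact lt_of_le_of_lt (Nat.zero_le _) v.2
  have hG := hB.cycleClosed
  obtain ⟨t, m, hexec, ht, s, h1, h2, h3, h4⟩ :
      Runs (.seq initProg (.seq searchProg greedyProg)) (inputMem L)
        (5 + (cost L (fun v => if v = ⟨0, hn⟩ then 0 else n) 0 + 1 +
          (∑ v, (5 * (L v).length + 19) + 1))) fun m =>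
        ∃ s : AlgState G, Reachable s ∧ IsFinished s ∧ m.reg 0 = s.dim ∧
          ∀ v : Fin n, v ∈ s.taken ↔ m.arr 2 v = 1 := by
    refine .seq ((runs_initProg (x₀ := ⟨0, hn⟩) rfl L).mono le_rfl fun m hm => .seq
      ((runs_searchProg hc hL (isSearch_init G _) hm).mono le_rfl ?_))
    rintro m' ⟨r, p, hs, hm'⟩
    obtain ⟨T, hT⟩ := exists_isGreedySet hs.injective hs.rank_lt
    obtain ⟨s, h1, h2, h3, h4⟩ := exists_greedy_run hB (hs.isPerfectRank hG) hT
    refine (runs_greedyProg hs hG hT hL hm').mono le_rfl fun m'' h => ⟨s, h1, h2, ?_, fun v => ?_⟩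
    · rw [h.1, h3, Nat.card_eq_fintype_card, Fintype.card_fin]
    · rw [h4, h.2]
  refine ⟨t, m, hexec, ht.trans ?_, s, h1, h2, h3, h4⟩
  have h5 := hL.sum_length
  simp only [cost, Nat.zero_le, Finset.filter_true, Finset.sum_add_distrib, ← Finset.mul_sum,
    Finset.sum_const, Finset.card_univ, Fintype.card_fin, smul_eq_mul, h5]
  omega

end LinearTime

end BEI

theorem mainTheorem6 :
    -- correctness, for every run of the algorithm
    (∀ (K : Type*) [Field K] (n : ℕ) (G : SimpleGraph (Fin n)),
      G.Connected → BEI.IsBlockGraph (⊤ : G.Subgraph) →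
        -- the algorithm terminates
        (¬ ∃ run : ℕ → BEI.AlgState G,
          run 0 = BEI.initState G ∧ ∀ k, BEI.Step (run k) (run (k + 1))) ∧
        -- if no further step is possible, it has finished, with the dimension as its output
        -- and a cutset of minimum height
        (∀ s : BEI.AlgState G, BEI.Reachable s → (∀ s', ¬ BEI.Step s s') →
          BEI.IsFinished s ∧
          ringKrullDim (BEI.PolyRing K n ⧸ BEI.binomialEdgeIdeal K G) = (s.dim : WithBot ℕ∞) ∧
          BEI.IsCutset (⊤ : G.Subgraph) s.taken ∧
          BEI.primeOf K G s.taken ∈ BEI.minHeightPrimes K G)) ∧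
    -- implementation in linear time
    (∃ (p : BEI.Prog) (C : ℕ), ∀ (n : ℕ) (G : SimpleGraph (Fin n)),
      G.Connected → BEI.IsBlockGraph (⊤ : G.Subgraph) →
        ∀ L : Fin n → List (Fin n), BEI.IsAdjacencyList G L →
          ∃ (t : ℕ) (m : BEI.Mem), BEI.Exec p (BEI.inputMem L) t m ∧
            t ≤ C * (n + G.edgeSet.ncard) ∧
            -- the output is that of a complete run of the algorithm
            ∃ s : BEI.AlgState G, BEI.Reachable s ∧ BEI.IsFinished s ∧
              m.reg 0 = s.dim ∧ ∀ v : Fin n, v ∈ s.taken ↔ m.arr 2 v = 1) := by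
  refine ⟨fun K _ n G hc hB => ?_, .seq BEI.initProg (.seq BEI.searchProg BEI.greedyProg), 40,
    fun n G hc hB L hL => BEI.exists_exec hc hB hL⟩
  obtain ⟨r, hr⟩ := BEI.exists_isPerfectRank hB.cycleClosed hc
  exact ⟨BEI.not_exists_infinite_run hB hr, fun s h hs => BEI.correct_of_stuck K hB hc hr h hs⟩
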